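/- Let $d\ge 1$, $k\ge 0$, $1\le p<\infty$, $T>0$ and $M\ge 0$, and write $\langle v\rangle=(1+|v|^2)^{1/2}$, $\mathbb T^d=\mathbb R^d/\mathbb Z^d$. There is a constant $K=K(d,k,p,T,M)$ such that the following holds. Let $u\in L^1(0,T;W^{1,\infty}(\mathbb T^d;\mathbb R^d))$ with $\int_0^T\|u(t)\|_{W^{1,\infty}}\,dt\le M$, where $\|w\|_{W^{1,\infty}}=\|w\|_{L^\infty}+\|\nabla_x w\|_{L^\infty}$. Let $f_0\ge 0$ be a locally integrable function on $\mathbb T^d\times\mathbb R^d$ with locally integrable weak gradients $\nabla_xf_0$, $\nabla_vf_0$ and $$\int_{\mathbb T^d}\int_{\mathbb R^d}\langle v\rangle^{kp}\{|f_0|^p+|\nabla_xf_0|^p+|\nabla_vf_0|^p\}\,dv\,dx<\infty .$$ Let $f$ be a weak solution of the kinetic equation $$\partial_tf+v\cdot\nabla_xf+\nabla_v\cdot\big((u-v)f\big)=0\quad\text{in }(0,T)\times\mathbb T^d\times\mathbb R^d,\qquad f(0,\cdot,\cdot)=f_0,$$ that is: $f$ is measurable, $\sup_{t\in[0,T]}\int_{A}|f(t,x,v)|\,dx\,dv<\infty$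 for every compact set $A$, and for every smooth compactly supported test function $\varphi$ and every $t\in[0,T]$ $$\iint f(t)\varphi(t)\,dx\,dv=\iint f_0\,\varphi(0)\,dx\,dv+\int_0^t\iint f\,\big(\partial_s\varphi+v\cdot\nabla_x\varphi+(u-v)\cdot\nabla_v\varphi\big)\,dx\,dv\,ds .$$ Then for every $t\in[0,T]$ the function $f(t)$ has locally integrable weak gradients $\nabla_xf(t)$, $\nabla_vf(t)$, and $$\int_{\mathbb T^d}\int_{\mathbb R^d}\langle v\rangle^{kp}\{|f(t)|^p+|\nabla_xf(t)|^p+|\nabla_vf(t)|^p\}\,dv\,dx\le K\int_{\mathbb T^d}\int_{\mathbb R^d}\langle v\rangle^{kp}\{|f_0|^p+|\nabla_xf_0|^p+|\nabla_vf_0|^p\}\,dv\,dx .$$ -/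

import Mathlib

open MeasureTheory
open scoped ContDiff NNReal ENNReal

/-- The Euclidean space `ℝᵈ`. -/
abbrev Eucl (d : ℕ) : Type := EuclideanSpace ℝ (Fin d)

/-- The phase space `ℝᵈ × ℝᵈ` with points `(x, v)`; functions on `𝕋ᵈ × ℝᵈ` are functions on it that
are periodic in `x`. It carries the product Lebesgue measure. -/
abbrev Phase (d : ℕ) : Type := Eucl d × Eucl d

/-- `ℤᵈ`-periodic functions on `ℝᵈ`, i.e. functions on the torus `𝕋ᵈ = ℝᵈ / ℤᵈ`. -/
def TorusPeriodic {d : ℕ} {β : Type*} (g : Eucl d → β) : Prop :=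
  ∀ (x : Eucl d) (i : Fin d), g (x + EuclideanSpace.single i (1 : ℝ)) = g x

/-- The fundamental domain `[0,1)ᵈ` of the torus. -/
def unitCell (d : ℕ) : Set (Eucl d) := {x | ∀ i, x i ∈ Set.Ico (0 : ℝ) 1}

/-- The bracket `⟨v⟩ = (1 + |v|²)^{1/2}`. -/
noncomputable def bracket {d : ℕ} (v : Eucl d) : ℝ := Real.sqrt (1 + ‖v‖ ^ 2)

/-- `Dw` is the weak (distributional) derivative of the vector field `w` on `ℝᵈ`. For a periodic `w`
this is the same as the weak derivative on the torus. -/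
structure HasWeakDerivField {d : ℕ} (w : Eucl d → Eucl d) (Dw : Eucl d → Eucl d →L[ℝ] Eucl d) :
    Prop where
  locInt : LocallyIntegrable w
  locInt_deriv : LocallyIntegrable Dw
  integral_eq : ∀ φ : Eucl d → ℝ, ContDiff ℝ ∞ φ → HasCompactSupport φ → ∀ e : Eucl d,
    ∫ x, (fderiv ℝ φ x e) • w x = - ∫ x, φ x • Dw x e

/-- `gx` and `gv` are the weak (distributional) gradients `∇ₓ f` and `∇ᵥ f` of `f`. -/
structure HasWeakGrads {d : ℕ} (f : Phase d → ℝ) (gx gv : Phase d → Eucl d) : Prop where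
  locInt : LocallyIntegrable f
  locInt_x : LocallyIntegrable gx
  locInt_v : LocallyIntegrable gv
  integral_x : ∀ φ : Phase d → ℝ, ContDiff ℝ ∞ φ → HasCompactSupport φ → ∀ e : Eucl d,
    ∫ z, f z * fderiv ℝ φ z (e, 0) = - ∫ z, inner ℝ (gx z) e * φ z
  integral_v : ∀ φ : Phase d → ℝ, ContDiff ℝ ∞ φ → HasCompactSupport φ → ∀ e : Eucl d,
    ∫ z, f z * fderiv ℝ φ z (0, e) = - ∫ z, inner ℝ (gv z) e * φ z

/-- The norm `∫₀ᵀ ‖u(t)‖_{W^{1,∞}} dt`, where `‖w‖_{W^{1,∞}} = ‖w‖_{L^∞} + ‖∇ₓ w‖_{L^∞}` and `Du t`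
is the weak derivative of `u t`. For periodic functions the essential suprema over `ℝᵈ` are those
over the torus. -/
noncomputable def normL1W1inf {d : ℕ} (T : ℝ) (u : ℝ → Eucl d → Eucl d)
    (Du : ℝ → Eucl d → Eucl d →L[ℝ] Eucl d) : ℝ≥0∞ :=
  ∫⁻ t in Set.Ioo 0 T, (eLpNorm (u t) ⊤ volume + eLpNorm (Du t) ⊤ volume)

/-- `u ∈ L¹(0,T; W^{1,∞}(𝕋ᵈ; ℝᵈ))`, with weak `x`-derivative `Du`. -/
structure MemL1W1inf {d : ℕ} (T : ℝ) (u : ℝ → Eucl d → Eucl d)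
    (Du : ℝ → Eucl d → Eucl d →L[ℝ] Eucl d) : Prop where
  periodic : ∀ t ∈ Set.Ioo 0 T, TorusPeriodic (u t)
  aesm : AEStronglyMeasurable (fun q : ℝ × Eucl d => u q.1 q.2)
    ((volume.restrict (Set.Ioo 0 T)).prod volume)
  aesm_deriv : AEStronglyMeasurable (fun q : ℝ × Eucl d => Du q.1 q.2)
    ((volume.restrict (Set.Ioo 0 T)).prod volume)
  weakDeriv : ∀ᵐ t ∂(volume.restrict (Set.Ioo 0 T)), HasWeakDerivField (u t) (Du t)
  norm_lt_top : normL1W1inf T u Du < ⊤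

/-- `f` is a weak (distributional) solution on `[0,T] × 𝕋ᵈ × ℝᵈ`, with initial datum `f₀`, of
`∂ₜ f + v · ∇ₓ f + ∇ᵥ · ((u - v) f) = 0`. It lies in `L^∞(0,T; L¹_loc)`, and the weak formulation
holds on `[0,t]` for every `t ∈ [0,T]`. In it,
`fderiv ℝ φ (s, x, v) (1, v, u s x - v) = ∂ₛ φ + v · ∇ₓ φ + (u - v) · ∇ᵥ φ`. -/
structure IsKineticSolution {d : ℕ} (T : ℝ) (u : ℝ → Eucl d → Eucl d) (f₀ : Phase d → ℝ)
    (f : ℝ → Phase d → ℝ) : Prop where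
  periodic : ∀ t ∈ Set.Icc 0 T, ∀ v : Eucl d, TorusPeriodic (fun x => f t (x, v))
  aesm : AEStronglyMeasurable (fun q : ℝ × Phase d => f q.1 q.2)
    ((volume.restrict (Set.Ioo 0 T)).prod volume)
  locInt : ∀ t ∈ Set.Icc 0 T, LocallyIntegrable (f t)
  locBound : ∀ K : Set (Phase d), IsCompact K →
    ∃ B : ℝ, ∀ t ∈ Set.Icc 0 T, ∫ z in K, |f t z| ≤ B
  weakForm : ∀ φ : ℝ × Phase d → ℝ, ContDiff ℝ ∞ φ → HasCompactSupport φ →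
    ∀ t ∈ Set.Icc 0 T,
      ∫ z, f t z * φ (t, z) = (∫ z, f₀ z * φ (0, z)) +
        ∫ s in (0 : ℝ)..t, ∫ z : Phase d,
          f s z * fderiv ℝ φ (s, z) (1, z.2, u s z.1 - z.2)

/-- The weighted moment `∫_{𝕋ᵈ} ∫_{ℝᵈ} ⟨v⟩^{kp} (|f|^p + |gx|^p + |gv|^p) dv dx`. -/
noncomputable def weightedMoment {d : ℕ} (k p : ℝ) (f : Phase d → ℝ) (gx gv : Phase d → Eucl d) :
    ℝ≥0∞ :=
  ∫⁻ z in unitCell d ×ˢ (Set.univ : Set (Eucl d)),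
    ENNReal.ofReal (bracket z.2 ^ (k * p) * (|f z| ^ p + ‖gx z‖ ^ p + ‖gv z‖ ^ p))

set_option linter.unusedSectionVars false

open Filter Set Topology

/-! The characteristic field b(t,x,v) = (v, u(t,x) - v) is Lipschitz in (x,v) with a constant 1 +
m(t), where m is integrable and ∫ m ≤ M, and its divergence is the constant -d. Its flow maps,
forward and backward, are therefore Lipschitz with a constant controlled by C = 2 exp(2(T + M)), and
the flow Φ from time 0 to time t pushes Lebesgue measure forward to exp(dt) times itself. Writing Ψ
for its inverse, the solution must be f(t) = exp(dt) f₀ ∘ Ψ. The chain rule bounds the gradients of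
f(t) at z by exp(dt) C times those of f₀ at Ψ z. Gronwall for the velocity component alone compares
⟨v⟩ at z and at Ψ z. So the integrand of the moment at time t is at most a constant times H ∘ Ψ,
where H is the integrand at time 0. Since H is periodic in x and the flow commutes with lattice
translations, Ψ carries the unit cell to another fundamental domain. Hence the integral of H ∘ Ψ
over the cell is exp(-dt) ≤ 1 times that of H.

The delicate point is that f is only a distributional solution, so the formula for f(t) is a
uniqueness statement. It is proved by duality: φ(s,y) = ψ(Φ_{s→t} y) solves the backward transport
equation, but is merely Lipschitz in y and absolutely continuous in s, hence not a test function.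
The equation is tested instead with a bump centred at y, multiplied by φ(s,y), and integrated over
y. The error is a commutator, at most Lip(φ) L(s) ε per unit mass of f for bumps of radius ε, and it
vanishes in the limit (`abs_integral_commutator_le`, `IsContinuitySolution.integral_mul_eq`).
Applied to the explicit solution exp(ct) with c = d, the same theorem gives the change of volume
without any Jacobian (`map_flow_eq_smul`), and with it the formula for f(t)
(`IsContinuitySolution.ae_eq`).

Two further points need care at this regularity. The field u is defined up to null sets, and
`MemL1W1inf.exists_regular` selects a jointly measurable representative that is Lipschitz in x at
every time. The chain rule for weak gradients under the Lipschitz map Ψ,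
`HasWeakFDeriv.comp_homeomorph`, is proved by transporting the test function rather than by
approximating f₀. -/

/-! ### Gronwall's inequality with an integrable coefficient -/

lemma AbsolutelyContinuousOnInterval.of_dist_le {X Y : Type*} [PseudoMetricSpace X]
    [PseudoMetricSpace Y] {f : ℝ → X} {g : ℝ → Y} {a b C : ℝ}
    (hg : AbsolutelyContinuousOnInterval g a b)
    (h : ∀ s ∈ uIcc a b, ∀ t ∈ uIcc a b, dist (f s) (f t) ≤ C * dist (g s) (g t)) :
    AbsolutelyContinuousOnInterval f a b := by
  unfold AbsolutelyContinuousOnInterval at hg ⊢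
  have h0 := hg.const_mul C
  rw [mul_zero] at h0
  refine squeeze_zero' ?_ ?_ h0
  · exact Eventually.of_forall fun E => Finset.sum_nonneg fun _ _ => dist_nonneg
  · filter_upwards [mem_inf_of_right (mem_principal_self _)] with E hE
    rw [Finset.mul_sum]
    refine Finset.sum_le_sum fun i hi => ?_
    exact h _ (hE.1 i hi).1 _ (hE.1 i hi).2

/-- This is the fundamental theorem of calculus for exp(cΛ), where Λ is the primitive of L. As L is
only integrable, the chain rule holds almost everywhere, and absolute continuity of exp(cΛ) has to
be supplied. -/
lemma integral_mul_exp_primitive {L : ℝ → ℝ} (hL : Integrable L) (c s t : ℝ) :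
    c * ∫ r in s..t, L r * Real.exp (c * ∫ q in s..r, L q)
      = Real.exp (c * ∫ q in s..t, L q) - 1 := by
  set Λ : ℝ → ℝ := fun r => ∫ q in s..r, L q with hΛ
  have hLi : IntervalIntegrable L volume s t := hL.intervalIntegrable
  have hΛac : AbsolutelyContinuousOnInterval Λ s t :=
    hLi.absolutelyContinuousOnInterval_intervalIntegral left_mem_uIcc
  obtain ⟨R, hR⟩ := hΛac.exists_bound
  have hexp : AbsolutelyContinuousOnInterval (fun r => Real.exp (c * Λ r)) s t := by
    -- The values of cΛ stay in a compact interval, where exp is Lipschitz.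
    obtain ⟨K, hK⟩ := (Real.contDiff_exp (n := 1)).contDiffOn.exists_lipschitzOnWith (by decide)
      (convex_Icc (-(|c| * R)) (|c| * R)) isCompact_Icc
    have hmem : ∀ r ∈ uIcc s t, c * Λ r ∈ Icc (-(|c| * R)) (|c| * R) := fun r hr => by
      rw [mem_Icc, ← abs_le, abs_mul]
      exact mul_le_mul_of_nonneg_left (hR r hr) (abs_nonneg c)
    refine (hΛac.const_mul c).of_dist_le (C := K) fun p hp q hq => ?_
    exact hK.dist_le_mul _ (hmem p hp) _ (hmem q hq)
  have hd := hexp.integral_deriv_eq_sub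
  have h0 : Λ s = 0 := by simp [hΛ]
  rw [h0, mul_zero, Real.exp_zero] at hd
  rw [← hd, ← intervalIntegral.integral_const_mul]
  refine intervalIntegral.integral_congr_ae ?_
  filter_upwards [LocallyIntegrable.ae_hasDerivAt_integral hL.locallyIntegrable] with r hr _
  have := (((hr s).const_mul c).exp).deriv
  rw [this]; ring

/-- The left side equals (w - 1)/2 for the weight w = exp(2|∫L|). For t before s the primitive
changes sign, and the constant -2 replaces 2. The gain of 1/2 over w is what makes the Picard map a
contraction and closes Gronwall. -/
lemma abs_integral_mul_exp_abs_primitive_le {L : ℝ → ℝ} (hL : Integrable L) (h0 : ∀ t, 0 ≤ L t)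
    (s t : ℝ) :
    |∫ r in s..t, L r * Real.exp (2 * |∫ q in s..r, L q|)|
      ≤ Real.exp (2 * |∫ q in s..t, L q|) / 2 := by
  rcases le_total s t with h | h
  · have hpos : ∀ r ∈ Icc s t, |∫ q in s..r, L q| = ∫ q in s..r, L q := fun r hr =>
      abs_of_nonneg (intervalIntegral.integral_nonneg hr.1 fun _ _ => h0 _)
    have h1 : ∫ r in s..t, L r * Real.exp (2 * |∫ q in s..r, L q|)
        = ∫ r in s..t, L r * Real.exp (2 * ∫ q in s..r, L q) :=
      intervalIntegral.integral_congr fun r hr => by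
        rw [uIcc_of_le h] at hr
        simp only [hpos r hr]
    have h2 := integral_mul_exp_primitive hL 2 s t
    rw [h1, hpos t ⟨h, le_rfl⟩, abs_of_nonneg]
    · linarith
    · exact intervalIntegral.integral_nonneg h fun r _ => mul_nonneg (h0 r) (Real.exp_pos _).le
  · have hneg : ∀ r ∈ Icc t s, |∫ q in s..r, L q| = -∫ q in s..r, L q := fun r hr => by
      rw [abs_of_nonpos]
      rw [intervalIntegral.integral_symm, neg_nonpos]
      exact intervalIntegral.integral_nonneg hr.2 fun _ _ => h0 _
    have h1 : ∫ r in s..t, L r * Real.exp (2 * |∫ q in s..r, L q|)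
        = ∫ r in s..t, L r * Real.exp (-2 * ∫ q in s..r, L q) :=
      intervalIntegral.integral_congr fun r hr => by
        rw [uIcc_of_ge h] at hr
        simp only [hneg r hr]
        congr 2; ring
    have h2 := integral_mul_exp_primitive hL (-2) s t
    rw [h1, hneg t ⟨le_rfl, h⟩, abs_of_nonpos]
    · rw [show 2 * -(∫ q in s..t, L q) = -2 * ∫ q in s..t, L q by ring]
      linarith
    · rw [intervalIntegral.integral_symm, neg_nonpos]
      exact intervalIntegral.integral_nonneg h fun r _ => mul_nonneg (h0 r) (Real.exp_pos _).le

lemma abs_intervalIntegral_le_integral {L : ℝ → ℝ} (hL : Integrable L) (h0 : ∀ t, 0 ≤ L t)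
    (s t : ℝ) : |∫ q in s..t, L q| ≤ ∫ q, L q := by
  rw [← Real.norm_eq_abs]
  refine (intervalIntegral.norm_integral_le_integral_norm_uIoc).trans ?_
  simp only [Real.norm_of_nonneg (h0 _)]
  exact setIntegral_le_integral hL (Eventually.of_forall h0)

/-- A Gronwall inequality for bounded functions and an integrable coefficient. -/
lemma gronwall_of_le_abs_integral {L : ℝ → ℝ} (hL : Integrable L) (h0 : ∀ t, 0 ≤ L t) {h : ℝ → ℝ}
    {B : ℝ} (hB : ∀ t, h t ≤ B) (hn : ∀ t, 0 ≤ h t) {δ s : ℝ}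
    (hle : ∀ t, h t ≤ δ + |∫ r in s..t, L r * h r|) (t : ℝ) :
    h t ≤ 2 * δ * Real.exp (2 * |∫ r in s..t, L r|) := by
  set w : ℝ → ℝ := fun t => Real.exp (2 * |∫ r in s..t, L r|) with hw
  have hw1 : ∀ t, 1 ≤ w t := fun t => Real.one_le_exp (by positivity)
  have hwc : Continuous w := by
    have := intervalIntegral.continuous_primitive (fun a b => hL.intervalIntegrable) s
    fun_prop
  have hwB : ∀ t, w t ≤ Real.exp (2 * ∫ r, L r) := fun t => by
    have := abs_intervalIntegral_le_integral hL h0 s t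
    exact Real.exp_le_exp.2 (by linarith)
  -- The a priori bound on h serves only to make this supremum finite, so that it can be absorbed
  -- below.
  have hbdd : BddAbove (range fun t => h t / w t) := by
    refine ⟨B, ?_⟩
    rintro _ ⟨t, rfl⟩
    exact (div_le_self (hn t) (hw1 t)).trans (hB t)
  set m := ⨆ t, h t / w t with hm
  have hm0 : 0 ≤ m := Real.iSup_nonneg fun t => div_nonneg (hn t) (zero_le_one.trans (hw1 t))
  have hle' : ∀ t, h t ≤ m * w t := fun t => by
    rw [← div_le_iff₀ (zero_lt_one.trans_le (hw1 t))]
    exact le_ciSup hbdd t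
  have hδ : 0 ≤ δ := by
    have := hle s
    simp only [intervalIntegral.integral_same, abs_zero, add_zero] at this
    exact (hn s).trans this
  have hint : ∀ t, |∫ r in s..t, L r * h r| ≤ m * (w t / 2) := fun t => by
    have hi : IntervalIntegrable (fun r => m * (L r * w r)) volume s t :=
      ((hL.intervalIntegrable).mul_continuousOn hwc.continuousOn).const_mul m
    rw [← Real.norm_eq_abs]
    refine (intervalIntegral.norm_integral_le_abs_of_norm_le (Eventually.of_forall fun r => ?_)
      hi).trans ?_
    · rw [Real.norm_of_nonneg (mul_nonneg (h0 r) (hn r))]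
      calc L r * h r ≤ L r * (m * w r) := mul_le_mul_of_nonneg_left (hle' r) (h0 r)
        _ = _ := by ring
    · rw [intervalIntegral.integral_const_mul, abs_mul, abs_of_nonneg hm0]
      exact mul_le_mul_of_nonneg_left (abs_integral_mul_exp_abs_primitive_le hL h0 s t) hm0
  have hmle : m ≤ 2 * δ := by
    -- Dividing the hypothesis by w ≥ 1 and taking the supremum; the term m/2 is then absorbed.
    have : m ≤ δ + m / 2 := by
      refine ciSup_le fun t => ?_
      rw [div_le_iff₀ (zero_lt_one.trans_le (hw1 t))]
      have h1 := hle t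
      have h2 := hint t
      nlinarith [hw1 t]
    linarith
  exact (hle' t).trans (mul_le_mul_of_nonneg_right hmle (zero_le_one.trans (hw1 t)))

/-! ### The flow of a field that is Lipschitz in space and integrable in time -/

section Flow

variable {E : Type*} [NormedAddCommGroup E] [NormedSpace ℝ E] [CompleteSpace E]
  [SecondCountableTopology E] [MeasurableSpace E] [BorelSpace E]

/-- A time-dependent vector field, measurable in time and Lipschitz in space with an integrable
Lipschitz constant. -/
structure IsLipField (b : ℝ → E → E) (L : ℝ → ℝ) : Prop where
  meas : Measurable (Function.uncurry b)
  integrable : Integrable L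
  lip : ∀ t y z, ‖b t y - b t z‖ ≤ L t * ‖y - z‖
  growth : ∀ t, ‖b t 0‖ ≤ L t

namespace IsLipField

variable {b : ℝ → E → E} {L : ℝ → ℝ}

lemma nonneg (hb : IsLipField b L) (t : ℝ) : 0 ≤ L t := (norm_nonneg _).trans (hb.growth t)

lemma norm_le (hb : IsLipField b L) (t : ℝ) (y : E) : ‖b t y‖ ≤ L t * (1 + ‖y‖) := by
  have h1 := hb.lip t y 0
  have h2 := hb.growth t
  have h3 := norm_le_norm_add_norm_sub' (b t y) (b t 0)
  rw [sub_zero] at h1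
  linarith

lemma integrable_comp (hb : IsLipField b L) {Y : ℝ → E} (hY : Continuous Y) {R : ℝ}
    (hR : ∀ t, ‖Y t‖ ≤ R) : Integrable fun r => b r (Y r) := by
  refine (hb.integrable.mul_const (1 + R)).mono' ?_ (Eventually.of_forall fun r => ?_)
  · exact (hb.meas.comp (measurable_id.prodMk hY.measurable)).aestronglyMeasurable
  · refine (hb.norm_le r (Y r)).trans ?_
    exact mul_le_mul_of_nonneg_left (by linarith [hR r]) (hb.nonneg r)

/-- `Y` is the bounded solution of `Y' = b(t, Y)`, `Y(s) = z`. -/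
structure IsCurve (b : ℝ → E → E) (s : ℝ) (z : E) (Y : ℝ → E) : Prop where
  cont : Continuous Y
  bdd : ∃ R, ∀ t, ‖Y t‖ ≤ R
  eq : ∀ t, Y t = z + ∫ r in s..t, b r (Y r)

lemma exists_isCurve (hb : IsLipField b L) (s : ℝ) (z : E) : ∃ Y, IsCurve b s z Y := by
  -- A Bielecki weight: in the norm sup ‖Y‖/w the Picard map contracts by 1/2 on the whole line,
  -- with no smallness of L. The unknown is W = Y/w, a bounded continuous function.
  set w : ℝ → ℝ := fun t => Real.exp (2 * |∫ r in s..t, L r|) with hw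
  have hw1 : ∀ t, 1 ≤ w t := fun t => Real.one_le_exp (by positivity)
  have hw0 : ∀ t, 0 < w t := fun t => zero_lt_one.trans_le (hw1 t)
  have hwc : Continuous w := by
    have := intervalIntegral.continuous_primitive
      (fun a b => hb.integrable.intervalIntegrable) s
    fun_prop
  have hwB : ∀ t, w t ≤ Real.exp (2 * ∫ r, L r) := fun t => by
    have := abs_intervalIntegral_le_integral hb.integrable hb.nonneg s t
    exact Real.exp_le_exp.2 (by linarith)
  set A := Real.exp (2 * ∫ r, L r) with hA
  have hbd : ∀ W : BoundedContinuousFunction ℝ E, ∀ t, ‖w t • W t‖ ≤ A * ‖W‖ := fun W t => by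
    rw [norm_smul, Real.norm_of_nonneg (hw0 t).le]
    exact mul_le_mul (hwB t) (W.norm_coe_le_norm t) (norm_nonneg _) (Real.exp_pos _).le
  have hcw : ∀ W : BoundedContinuousFunction ℝ E, Continuous fun t => w t • W t := fun W =>
    hwc.smul W.continuous
  have hI : ∀ W : BoundedContinuousFunction ℝ E, Integrable fun r => b r (w r • W r) := fun W =>
    hb.integrable_comp (hcw W) (hbd W)
  have hwinv : Continuous fun t => (w t)⁻¹ := hwc.inv₀ fun t => (hw0 t).ne'
  have hwinv1 : ∀ t, ‖(w t)⁻¹‖ ≤ 1 := fun t => by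
    rw [Real.norm_of_nonneg (inv_nonneg.2 (hw0 t).le)]
    exact inv_le_one_of_one_le₀ (hw1 t)
  let G : BoundedContinuousFunction ℝ E → BoundedContinuousFunction ℝ E := fun W =>
    BoundedContinuousFunction.ofNormedAddCommGroup
      (fun t => (w t)⁻¹ • (z + ∫ r in s..t, b r (w r • W r)))
      (hwinv.smul (continuous_const.add
        (intervalIntegral.continuous_primitive (fun a c => (hI W).intervalIntegrable) s)))
      (‖z‖ + ∫ r, ‖b r (w r • W r)‖) (fun t => by
        rw [norm_smul]
        refine (mul_le_of_le_one_left (norm_nonneg _) (hwinv1 t)).trans ?_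
        refine (norm_add_le _ _).trans (add_le_add le_rfl ?_)
        refine (intervalIntegral.norm_integral_le_integral_norm_uIoc).trans ?_
        exact setIntegral_le_integral (hI W).norm (Eventually.of_forall fun _ => norm_nonneg _))
  have hG : ContractingWith (1 / 2 : ℝ≥0) G := by
    refine ⟨by rw [← NNReal.coe_lt_coe]; norm_num, LipschitzWith.of_dist_le_mul fun W V => ?_⟩
    rw [dist_eq_norm, dist_eq_norm]
    refine (BoundedContinuousFunction.norm_le (by positivity)).2 fun t => ?_
    have e1 : (G W - G V) t = (w t)⁻¹ • ∫ r in s..t, (b r (w r • W r) - b r (w r • V r)) := by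
      rw [intervalIntegral.integral_sub (hI W).intervalIntegrable (hI V).intervalIntegrable]
      simp only [G, BoundedContinuousFunction.coe_sub, Pi.sub_apply,
        BoundedContinuousFunction.coe_ofNormedAddCommGroup, ← smul_sub, add_sub_add_left_eq_sub]
    rw [e1, norm_smul, Real.norm_of_nonneg (inv_nonneg.2 (hw0 t).le)]
    have hi : IntervalIntegrable (fun r => ‖W - V‖ * (L r * w r)) volume s t :=
      (hb.integrable.intervalIntegrable.mul_continuousOn hwc.continuousOn).const_mul _
    have h1 : ‖∫ r in s..t, (b r (w r • W r) - b r (w r • V r))‖ ≤ ‖W - V‖ * (w t / 2) := by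
      refine (intervalIntegral.norm_integral_le_abs_of_norm_le (Eventually.of_forall fun r => ?_)
        hi).trans ?_
      · refine (hb.lip r _ _).trans ?_
        rw [← smul_sub, norm_smul, Real.norm_of_nonneg (hw0 r).le]
        have := (W - V).norm_coe_le_norm r
        calc L r * (w r * ‖W r - V r‖) = L r * w r * ‖W r - V r‖ := by ring
          _ ≤ L r * w r * ‖W - V‖ :=
            mul_le_mul_of_nonneg_left this (mul_nonneg (hb.nonneg r) (hw0 r).le)
          _ = _ := by ring
      · rw [intervalIntegral.integral_const_mul, abs_mul, abs_of_nonneg (norm_nonneg _)]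
        exact mul_le_mul_of_nonneg_left
          (abs_integral_mul_exp_abs_primitive_le hb.integrable hb.nonneg s t) (norm_nonneg _)
    calc (w t)⁻¹ * _ ≤ (w t)⁻¹ * (‖W - V‖ * (w t / 2)) :=
          mul_le_mul_of_nonneg_left h1 (inv_nonneg.2 (hw0 t).le)
      _ = ((1 / 2 : ℝ≥0) : ℝ) * ‖W - V‖ := by
          have := (hw0 t).ne'
          push_cast
          field_simp
  have hfix : G (hG.fixedPoint) = hG.fixedPoint := hG.fixedPoint_isFixedPt
  set W := hG.fixedPoint with hW
  refine ⟨fun t => w t • W t, hcw W, ⟨_, hbd W⟩, fun t => ?_⟩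
  have : W t = (w t)⁻¹ • (z + ∫ r in s..t, b r (w r • W r)) := by
    conv_lhs => rw [← hfix]
    rfl
  conv_lhs => rw [this]
  rw [smul_inv_smul₀ (hw0 t).ne']

/-- Gronwall applied to the difference of two curves; it gives uniqueness and Lipschitz dependence
on the datum at once. -/
lemma IsCurve.dist_le (hb : IsLipField b L) {s : ℝ} {y z : E} {Y Z : ℝ → E}
    (hY : IsCurve b s y Y) (hZ : IsCurve b s z Z) (t : ℝ) :
    ‖Y t - Z t‖ ≤ 2 * ‖y - z‖ * Real.exp (2 * |∫ r in s..t, L r|) := by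
  obtain ⟨R, hR⟩ := hY.bdd
  obtain ⟨S, hS⟩ := hZ.bdd
  have hYi := hb.integrable_comp hY.cont hR
  have hZi := hb.integrable_comp hZ.cont hS
  refine gronwall_of_le_abs_integral hb.integrable hb.nonneg (h := fun t => ‖Y t - Z t‖)
    (B := R + S)
    (fun t => (norm_sub_le _ _).trans (add_le_add (hR t) (hS t))) (fun t => norm_nonneg _)
    (fun t => ?_) t
  have e : Y t - Z t = (y - z) + ∫ r in s..t, (b r (Y r) - b r (Z r)) := by
    rw [intervalIntegral.integral_sub hYi.intervalIntegrable hZi.intervalIntegrable,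
      hY.eq t, hZ.eq t]
    abel
  change ‖Y t - Z t‖ ≤ _
  rw [e]
  refine (norm_add_le _ _).trans (add_le_add le_rfl ?_)
  refine intervalIntegral.norm_integral_le_abs_of_norm_le
    (Eventually.of_forall fun r => hb.lip r _ _) ?_
  exact hb.integrable.intervalIntegrable.mul_continuousOn
    (hY.cont.sub hZ.cont).norm.continuousOn

/-- The flow: `hb.flow s z` is the solution equal to `z` at time `s`. -/
noncomputable def flow (hb : IsLipField b L) (s : ℝ) (z : E) : ℝ → E :=
  (hb.exists_isCurve s z).choose

lemma isCurve_flow (hb : IsLipField b L) (s : ℝ) (z : E) : IsCurve b s z (hb.flow s z) :=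
  (hb.exists_isCurve s z).choose_spec

lemma IsCurve.eq_flow (hb : IsLipField b L) {s : ℝ} {z : E} {Y : ℝ → E} (hY : IsCurve b s z Y) :
    Y = hb.flow s z := by
  funext t
  have := hY.dist_le hb (hb.isCurve_flow s z) t
  rw [sub_self, norm_zero, mul_zero, zero_mul] at this
  exact sub_eq_zero.1 (norm_le_zero_iff.1 this)

lemma flow_self (hb : IsLipField b L) (s : ℝ) (z : E) : hb.flow s z s = z := by
  rw [(hb.isCurve_flow s z).eq]; simp

lemma integrable_flow (hb : IsLipField b L) (s : ℝ) (z : E) :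
    Integrable fun r => b r (hb.flow s z r) :=
  let ⟨_, hR⟩ := (hb.isCurve_flow s z).bdd
  hb.integrable_comp (hb.isCurve_flow s z).cont hR

/-- Restarting a curve at time r only splits its integral, so uniqueness applies. -/
lemma flow_flow (hb : IsLipField b L) (s r t : ℝ) (z : E) :
    hb.flow r (hb.flow s z r) t = hb.flow s z t := by
  have h : IsCurve b r (hb.flow s z r) (hb.flow s z) := by
    refine ⟨(hb.isCurve_flow s z).cont, (hb.isCurve_flow s z).bdd, fun q => ?_⟩
    have hi := hb.integrable_flow s z
    rw [(hb.isCurve_flow s z).eq q, (hb.isCurve_flow s z).eq r, add_assoc,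
      intervalIntegral.integral_add_adjacent_intervals hi.intervalIntegrable
      hi.intervalIntegrable]
  exact congrFun (h.eq_flow hb).symm t

/-- A Lipschitz constant of the flow maps. -/
noncomputable def lipConst (_ : IsLipField b L) : ℝ≥0 := ⟨2 * Real.exp (2 * ∫ r, L r), by positivity⟩

lemma coe_lipConst (hb : IsLipField b L) :
    (hb.lipConst : ℝ) = 2 * Real.exp (2 * ∫ r, L r) := rfl

lemma norm_flow_sub_le (hb : IsLipField b L) (s t : ℝ) (y z : E) :
    ‖hb.flow s y t - hb.flow s z t‖ ≤ hb.lipConst * ‖y - z‖ := by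
  refine ((hb.isCurve_flow s y).dist_le hb (hb.isCurve_flow s z) t).trans ?_
  have := abs_intervalIntegral_le_integral hb.integrable hb.nonneg s t
  rw [coe_lipConst, mul_right_comm]
  gcongr

lemma lipschitzWith_flow (hb : IsLipField b L) (s t : ℝ) :
    LipschitzWith hb.lipConst fun z => hb.flow s z t :=
  LipschitzWith.of_dist_le_mul fun y z => by
    simpa only [dist_eq_norm] using hb.norm_flow_sub_le s t y z

lemma one_add_norm_flow_le (hb : IsLipField b L) (s t : ℝ) (z : E) :
    1 + ‖hb.flow s z t‖ ≤ hb.lipConst * (1 + ‖z‖) := by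
  have hc := (hb.isCurve_flow s z).cont
  obtain ⟨R, hR⟩ := (hb.isCurve_flow s z).bdd
  have h := gronwall_of_le_abs_integral hb.integrable hb.nonneg
    (h := fun t => 1 + ‖hb.flow s z t‖) (B := 1 + R)
    (fun t => by linarith [hR t]) (fun t => by positivity) (δ := 1 + ‖z‖) (s := s)
    (fun t => ?_) t
  · refine h.trans ?_
    have := abs_intervalIntegral_le_integral hb.integrable hb.nonneg s t
    rw [coe_lipConst, mul_right_comm]
    gcongr
  · rw [add_assoc]
    refine add_le_add le_rfl ?_
    rw [(hb.isCurve_flow s z).eq t]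
    refine (norm_add_le _ _).trans (add_le_add le_rfl ?_)
    refine intervalIntegral.norm_integral_le_abs_of_norm_le
      (Eventually.of_forall fun r => hb.norm_le r _) ?_
    exact hb.integrable.intervalIntegrable.mul_continuousOn
      (continuous_const.add hc.norm).continuousOn

lemma norm_flow_sub_self_le (hb : IsLipField b L) (s t : ℝ) (z : E) :
    ‖hb.flow s z t - z‖ ≤ hb.lipConst * (1 + ‖z‖) * |∫ r in s..t, L r| := by
  rw [(hb.isCurve_flow s z).eq t, add_sub_cancel_left]
  refine (intervalIntegral.norm_integral_le_abs_of_norm_le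
    (g := fun r => hb.lipConst * (1 + ‖z‖) * L r)
    (Eventually.of_forall fun r => ?_) (hb.integrable.const_mul _).intervalIntegrable).trans ?_
  · refine (hb.norm_le r _).trans ?_
    rw [mul_comm]
    exact mul_le_mul_of_nonneg_right (hb.one_add_norm_flow_le s r z) (hb.nonneg r)
  · rw [intervalIntegral.integral_const_mul, abs_mul, abs_of_nonneg (by positivity)]

/-- The reference curve is restarted at the varying initial time, so that two curves issued at the
same time are compared. Only continuity of one curve and the Lipschitz bound in space are then
needed. -/
lemma continuous_flow (hb : IsLipField b L) (t : ℝ) :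
    Continuous fun q : ℝ × E => hb.flow q.1 q.2 t := by
  rw [continuous_iff_continuousAt]
  rintro ⟨s, z⟩
  have hs : Tendsto (fun q : ℝ × E => hb.flow s q.2 q.1) (𝓝 (s, z)) (𝓝 z) := by
    rw [tendsto_iff_norm_sub_tendsto_zero]
    have hc := (hb.isCurve_flow s z).cont
    have h1 : Tendsto (fun q : ℝ × E => hb.lipConst * ‖q.2 - z‖ + ‖hb.flow s z q.1 - z‖)
        (𝓝 (s, z)) (𝓝 0) := by
      have : Continuous fun q : ℝ × E =>
          (hb.lipConst : ℝ) * ‖q.2 - z‖ + ‖hb.flow s z q.1 - z‖ := by fun_prop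
      have := this.tendsto (s, z)
      simpa [hb.flow_self] using this
    refine squeeze_zero (fun _ => norm_nonneg _) (fun q => ?_) h1
    calc ‖hb.flow s q.2 q.1 - z‖
        = ‖(hb.flow s q.2 q.1 - hb.flow s z q.1) + (hb.flow s z q.1 - z)‖ := by
          rw [sub_add_sub_cancel]
      _ ≤ _ := (norm_add_le _ _).trans (add_le_add (hb.norm_flow_sub_le _ _ _ _) le_rfl)
  change Tendsto (fun q : ℝ × E => hb.flow q.1 q.2 t) (𝓝 (s, z)) (𝓝 (hb.flow s z t))
  rw [tendsto_iff_norm_sub_tendsto_zero]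
  have h2 : Tendsto (fun q : ℝ × E => hb.lipConst * ‖q.2 - hb.flow s z q.1‖) (𝓝 (s, z)) (𝓝 0) := by
    have hc := (hb.isCurve_flow s z).cont
    have : Continuous fun q : ℝ × E => (hb.lipConst : ℝ) * ‖q.2 - hb.flow s z q.1‖ := by fun_prop
    have := this.tendsto (s, z)
    simpa [hb.flow_self] using this
  refine squeeze_zero (fun _ => norm_nonneg _) (fun q => ?_) h2
  have h3 := hb.norm_flow_sub_le q.1 t q.2 (hb.flow s z q.1)
  rwa [hb.flow_flow] at h3

/-- The flow map between two times, as a homeomorphism. -/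
noncomputable def flowHomeo (hb : IsLipField b L) (s t : ℝ) : E ≃ₜ E where
  toFun z := hb.flow s z t
  invFun z := hb.flow t z s
  left_inv z := by simp only [hb.flow_flow, hb.flow_self]
  right_inv z := by simp only [hb.flow_flow, hb.flow_self]
  continuous_toFun := (hb.lipschitzWith_flow s t).continuous
  continuous_invFun := (hb.lipschitzWith_flow t s).continuous

end IsLipField

end Flow

/-! ### Observables carried back along the flow: the backward transport equation -/

lemma hasDerivAt_zero_of_norm_le {F : Type*} [NormedAddCommGroup F] [NormedSpace ℝ F]
    {f : ℝ → F} {g : ℝ → ℝ} {s : ℝ} (hg : HasDerivAt g 0 s) (hs : g s = 0)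
    (h : ∀ x, ‖f x‖ ≤ ‖g x‖) : HasDerivAt f 0 s := by
  have hfs : f s = 0 := by simpa [hs] using h s
  rw [hasDerivAt_iff_isLittleO] at hg ⊢
  simp only [hs, hfs, sub_zero, smul_zero] at hg ⊢
  exact (Asymptotics.IsBigO.of_bound 1 (Eventually.of_forall fun x => by simpa using h x)).trans_isLittleO hg

namespace IsLipField

section

variable {E : Type*} [NormedAddCommGroup E] [NormedSpace ℝ E] [CompleteSpace E]
  [SecondCountableTopology E] [MeasurableSpace E] [BorelSpace E]
  {b : ℝ → E → E} {L : ℝ → ℝ}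

/-- Freezing the curve at y in the integral equation leaves an error e(x) of size (∫ₛˣ L)². At a
point where the primitive of L is differentiable this is o(x - s), so only the derivative of ∫
b(r,y) dr survives, with a minus sign. -/
lemma hasDerivAt_flow_initial (hb : IsLipField b L) {s : ℝ} {y : E}
    (hL : HasDerivAt (fun x => ∫ r in s..x, L r) (L s) s)
    (hby : HasDerivAt (fun x => ∫ r in s..x, b r y) (b s y) s) :
    HasDerivAt (fun s' => hb.flow s' y s) (-b s y) s := by
  have hiy : Integrable fun r => b r y :=
    hb.integrable_comp continuous_const (R := ‖y‖) fun _ => le_rfl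
  set e : ℝ → E := fun x => ∫ r in s..x, (b r (hb.flow x y r) - b r y) with he
  have heq : (fun s' => hb.flow s' y s) = fun x => y - (∫ r in s..x, b r y) - e x := by
    funext x
    rw [(hb.isCurve_flow x y).eq s, he]
    simp only
    rw [intervalIntegral.integral_sub (hb.integrable_flow x y).intervalIntegrable
      hiy.intervalIntegrable, intervalIntegral.integral_symm s x]
    abel
  have hC : 0 ≤ hb.lipConst * (1 + ‖y‖) := by positivity
  have hed : HasDerivAt e 0 s := by
    refine hasDerivAt_zero_of_norm_le
      (g := fun x => hb.lipConst * (1 + ‖y‖) * (∫ r in s..x, L r) ^ 2) ?_ (by simp) fun x => ?_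
    · simpa using (hL.pow 2).const_mul (hb.lipConst * (1 + ‖y‖))
    · have hbound : ∀ r ∈ uIoc s x, ‖b r (hb.flow x y r) - b r y‖
          ≤ hb.lipConst * (1 + ‖y‖) * |∫ q in s..x, L q| * L r := fun r hr => by
        refine (hb.lip r _ _).trans ?_
        rw [mul_comm]
        refine mul_le_mul_of_nonneg_right ?_ (hb.nonneg r)
        refine (hb.norm_flow_sub_self_le x r y).trans (mul_le_mul_of_nonneg_left ?_ hC)
        -- For r between s and x, the integral of L between x and r is at most the one between s and
        -- x; this uniform bound supplies the second factor of the square.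
        rw [intervalIntegral.integral_symm r x, abs_neg]
        refine intervalIntegral.abs_integral_mono_interval ?_
          (Eventually.of_forall hb.nonneg) hb.integrable.intervalIntegrable
        rcases le_total s x with h | h
        · rw [uIoc_of_le h] at hr ⊢
          rw [uIoc_of_le hr.2]
          exact Ioc_subset_Ioc_left hr.1.le
        · rw [uIoc_of_ge h] at hr ⊢
          rw [uIoc_of_ge hr.1.le]
          exact Ioc_subset_Ioc_right hr.2
      refine (intervalIntegral.norm_integral_le_abs_of_norm_le
        (g := fun r => hb.lipConst * (1 + ‖y‖) * |∫ q in s..x, L q| * L r) ?_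
        (hb.integrable.const_mul _).intervalIntegrable).trans ?_
      · exact (ae_restrict_iff' measurableSet_uIoc).2 (Eventually.of_forall hbound)
      · rw [intervalIntegral.integral_const_mul, abs_mul, abs_mul, abs_abs, abs_of_nonneg hC,
          norm_mul, norm_pow, Real.norm_of_nonneg hC, Real.norm_eq_abs, sq, mul_assoc]
  rw [heq]
  have := (hby.const_sub y).sub hed
  rw [sub_zero] at this
  exact this

/-- The observable `ψ` at time `t` carried back along the flow to time `s`. -/
noncomputable def pull (hb : IsLipField b L) (ψ : E → ℝ) (t s : ℝ) (y : E) : ℝ :=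
  ψ (hb.flow s y t)

variable {ψ : E → ℝ} {C : ℝ≥0}

lemma pull_self (hb : IsLipField b L) (t : ℝ) : hb.pull ψ t t = ψ := by
  funext y; rw [pull, hb.flow_self]

lemma continuous_pull (hb : IsLipField b L) (hψ : Continuous ψ) (t : ℝ) :
    Continuous (Function.uncurry (hb.pull ψ t)) :=
  hψ.comp (hb.continuous_flow t)

lemma lipschitzWith_pull (hb : IsLipField b L) (hψ : LipschitzWith C ψ) (t s : ℝ) :
    LipschitzWith (C * hb.lipConst) (hb.pull ψ t s) :=
  hψ.comp (hb.lipschitzWith_flow s t)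

lemma pull_eq_pull_flow (hb : IsLipField b L) (t s s' : ℝ) (y : E) :
    hb.pull ψ t s' y = hb.pull ψ t s (hb.flow s' y s) := by
  rw [pull, pull, hb.flow_flow]

/-- Changing the initial time from s to s' amounts to moving y along the flow between the two times,
a displacement bounded by the increment of the primitive of L. -/
lemma absolutelyContinuousOnInterval_pull (hb : IsLipField b L) (hψ : LipschitzWith C ψ) (t : ℝ)
    (y : E) (a c : ℝ) :
    AbsolutelyContinuousOnInterval (fun s => hb.pull ψ t s y) a c := by
  have hΛ := (hb.integrable.intervalIntegrable (a := a) (b := c)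
    ).absolutelyContinuousOnInterval_intervalIntegral left_mem_uIcc
  refine hΛ.of_dist_le (C := C * hb.lipConst * (hb.lipConst * (1 + ‖y‖))) fun s _ s' _ => ?_
  rw [hb.pull_eq_pull_flow t s s', dist_comm (∫ v in a..s, L v),
    Real.dist_eq (∫ v in a..s', L v),
    intervalIntegral.integral_interval_sub_left hb.integrable.intervalIntegrable
      hb.integrable.intervalIntegrable]
  refine ((hb.lipschitzWith_pull hψ t s).dist_le_mul _ _).trans ?_
  rw [mul_assoc, NNReal.coe_mul, dist_comm, dist_eq_norm]
  refine mul_le_mul_of_nonneg_left ?_ (by positivity)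
  refine (hb.norm_flow_sub_self_le s' s y).trans_eq ?_
  rw [intervalIntegral.integral_symm s s', abs_neg]

lemma hasDerivAt_pull (hb : IsLipField b L) {t s : ℝ} {y : E}
    (hL : HasDerivAt (fun x => ∫ r in s..x, L r) (L s) s)
    (hby : HasDerivAt (fun x => ∫ r in s..x, b r y) (b s y) s)
    (hd : DifferentiableAt ℝ (hb.pull ψ t s) y) :
    HasDerivAt (fun s' => hb.pull ψ t s' y) (-fderiv ℝ (hb.pull ψ t s) y (b s y)) s := by
  have h1 := hb.hasDerivAt_flow_initial hL hby
  have h2 : HasFDerivAt (hb.pull ψ t s) (fderiv ℝ (hb.pull ψ t s) y) (hb.flow s y s) := by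
    rw [hb.flow_self]; exact hd.hasFDerivAt
  have h3 := HasFDerivAt.comp_hasDerivAt (f := fun s' => hb.flow s' y s) s h2 h1
  rw [map_neg] at h3
  refine h3.congr_of_eventuallyEq (Eventually.of_forall fun s' => ?_)
  exact hb.pull_eq_pull_flow t s s' y

/-- The growth bound for the flow, run back from time t, confines the supports at all times s to one
ball. -/
lemma norm_le_of_pull_ne_zero (hb : IsLipField b L) {R : ℝ}
    (hR : ∀ y, ψ y ≠ 0 → ‖y‖ ≤ R) {t s : ℝ} {y : E} (hy : hb.pull ψ t s y ≠ 0) :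
    ‖y‖ ≤ hb.lipConst * (1 + R) := by
  have h1 := hb.one_add_norm_flow_le t s (hb.flow s y t)
  rw [hb.flow_flow, hb.flow_self] at h1
  have h2 := hR _ hy
  have : (hb.lipConst : ℝ) * (1 + ‖hb.flow s y t‖) ≤ hb.lipConst * (1 + R) := by gcongr
  linarith

end

variable {E : Type*} [NormedAddCommGroup E] [NormedSpace ℝ E] [FiniteDimensional ℝ E]
  [MeasurableSpace E] [BorelSpace E] [CompleteSpace E] [SecondCountableTopology E]
  {b : ℝ → E → E} {L : ℝ → ℝ} {ψ : E → ℝ} {C : ℝ≥0}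
  (μ : Measure E) [μ.IsAddHaarMeasure]

/-- Rademacher's theorem gives differentiability in y at each fixed s; Fubini exchanges the
quantifiers, so that for almost every y almost every s is also a Lebesgue point of L and of b(·,y).
-/
lemma ae_hasDerivAt_pull (hb : IsLipField b L) (hψ : LipschitzWith C ψ) (t : ℝ) :
    ∀ᵐ y ∂μ, ∀ᵐ s, HasDerivAt (fun s' => hb.pull ψ t s' y)
      (-fderiv ℝ (hb.pull ψ t s) y (b s y)) s := by
  have hm := measurableSet_of_differentiableAt_with_param ℝ (hb.continuous_pull hψ.continuous t)
  have h1 : ∀ᵐ s : ℝ, ∀ᵐ y ∂μ, DifferentiableAt ℝ (hb.pull ψ t s) y :=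
    Eventually.of_forall fun s => (hb.lipschitzWith_pull hψ t s).ae_differentiableAt
  rw [Measure.ae_ae_comm hm] at h1
  filter_upwards [h1] with y hy
  have hiy : Integrable fun r => b r y :=
    hb.integrable_comp continuous_const (R := ‖y‖) fun _ => le_rfl
  filter_upwards [hy, LocallyIntegrable.ae_hasDerivAt_integral hiy.locallyIntegrable,
    LocallyIntegrable.ae_hasDerivAt_integral hb.integrable.locallyIntegrable] with s hd hby hL
  exact hb.hasDerivAt_pull (hL s) (hby s) hd

/-- Product rule along the flow for an absolutely continuous function of time. -/
lemma ae_integral_mul_pull (hb : IsLipField b L) (hψ : LipschitzWith C ψ) (t : ℝ) :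
    ∀ᵐ y ∂μ, ∀ (a : ℝ → ℝ) (A₀ : ℝ), IntervalIntegrable a volume 0 t →
      ∫ s in (0 : ℝ)..t, (a s * hb.pull ψ t s y
          - (A₀ + ∫ r in (0 : ℝ)..s, a r) * fderiv ℝ (hb.pull ψ t s) y (b s y))
        = (A₀ + ∫ r in (0 : ℝ)..t, a r) * ψ y - A₀ * hb.pull ψ t 0 y := by
  filter_upwards [hb.ae_hasDerivAt_pull μ hψ t] with y hy a A₀ ha
  have hA : AbsolutelyContinuousOnInterval (fun s => A₀ + ∫ r in (0 : ℝ)..s, a r) 0 t :=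
    (ha.absolutelyContinuousOnInterval_intervalIntegral left_mem_uIcc).of_dist_le (C := 1)
      fun s _ s' _ => by simp
  have h := hA.integral_deriv_mul_eq_sub (hb.absolutelyContinuousOnInterval_pull hψ t y 0 t)
  simp only [hb.pull_self, intervalIntegral.integral_same, add_zero] at h
  rw [← h]
  refine intervalIntegral.integral_congr_ae ?_
  filter_upwards [hy, ha.ae_hasDerivAt_integral] with s hs hs' hmem
  rw [hs.deriv, ((hs' (uIoc_subset_uIcc hmem) 0 left_mem_uIcc).const_add A₀).deriv]
  ring

end IsLipField

/-! ### Mollification against Lipschitz functions and the commutator estimate -/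

section Mollify

variable {E : Type*} [NormedAddCommGroup E] [NormedSpace ℝ E] [FiniteDimensional ℝ E]
  [MeasurableSpace E] [BorelSpace E] [CompleteSpace E] [SecondCountableTopology E]
  (μ : Measure E) [μ.IsAddHaarMeasure] (η : ContDiffBump (0 : E)) {g : E → ℝ} {C : ℝ≥0} {R : ℝ}

lemma ContDiffBump.normed_eq_zero_of_le {x : E} (h : η.rOut ≤ ‖x‖) : η.normed μ x = 0 := by
  rw [η.normed_def, η.zero_of_le_dist (by simpa using h), zero_div]

lemma ContDiffBump.fderiv_normed_eq_zero_of_lt {x : E} (h : η.rOut < ‖x‖) :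
    fderiv ℝ (η.normed μ) x = 0 := by
  have : η.normed μ =ᶠ[𝓝 x] fun _ => 0 := by
    filter_upwards [(isOpen_lt continuous_const continuous_norm).mem_nhds h] with y hy
    exact η.normed_eq_zero_of_le μ (le_of_lt hy)
  rw [this.fderiv_eq]; simp

lemma ContDiffBump.integral_normed_sub (z : E) : ∫ y, η.normed μ (z - y) ∂μ = 1 := by
  rw [integral_sub_left_eq_self (fun y => η.normed μ y) μ z, η.integral_normed]

lemma ContDiffBump.integrable_normed_sub (z : E) : Integrable (fun y => η.normed μ (z - y)) μ :=
  η.integrable_normed.comp_sub_left z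

lemma abs_integral_normed_mul_sub_le (hg : LipschitzWith C g) (z : E) :
    |∫ y, η.normed μ (z - y) * g y ∂μ - g z| ≤ C * η.rOut := by
  have h := η.dist_normed_convolution_le (μ := μ) (g := g) (x₀ := z) (ε := C * η.rOut)
    hg.continuous.aestronglyMeasurable (fun x hx => (hg.dist_le_mul x z).trans
      (mul_le_mul_of_nonneg_left (Metric.mem_ball.1 hx).le C.2))
  rw [convolution_eq_swap, Real.dist_eq] at h
  simpa using h

lemma integrable_mul_of_bounded_of_support {F g : E → ℝ} (hF : LocallyIntegrable F μ)
    (hgm : AEStronglyMeasurable g μ) {B R : ℝ} (hB : ∀ y, |g y| ≤ B)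
    (hR : ∀ y, g y ≠ 0 → ‖y‖ ≤ R) : Integrable (fun y => F y * g y) μ := by
  have h1 : Integrable ((Metric.closedBall (0 : E) R).indicator F) μ :=
    (hF.integrableOn_isCompact (isCompact_closedBall 0 R)).integrable_indicator
      Metric.isClosed_closedBall.measurableSet
  refine (h1.norm.mul_const B).mono' (hF.aestronglyMeasurable.mul hgm)
    (Eventually.of_forall fun y => ?_)
  by_cases hy : g y = 0
  · have hB0 : 0 ≤ B := (abs_nonneg _).trans (hB y)
    simp only [hy, mul_zero, norm_zero]; positivity
  · rw [indicator_of_mem (by simpa using hR y hy), norm_mul]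
    exact mul_le_mul_of_nonneg_left (hB y) (norm_nonneg _)

lemma exists_forall_abs_le_of_support (hg : Continuous g) (hR : ∀ y, g y ≠ 0 → ‖y‖ ≤ R) :
    ∃ B, ∀ y, |g y| ≤ B := by
  obtain ⟨B, hB⟩ := (isCompact_closedBall (0 : E) R).exists_bound_of_continuousOn hg.continuousOn
  refine ⟨max B 0, fun y => ?_⟩
  by_cases hy : g y = 0
  · simp [hy]
  · exact (hB y (by simpa using hR y hy)).trans (le_max_left _ _)

lemma hasCompactSupport_of_norm_le (hR : ∀ y, g y ≠ 0 → ‖y‖ ≤ R) : HasCompactSupport g :=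
  HasCompactSupport.of_support_subset_isCompact (isCompact_closedBall 0 R) fun y hy => by
    simpa using hR y hy

lemma continuous_fderiv_normed : Continuous (fderiv ℝ (η.normed μ)) :=
  (η.contDiff_normed (n := 1)).continuous_fderiv (by simp)

lemma integrable_mollify_mul_prod {F : E → ℝ} (hF : LocallyIntegrable F μ)
    (hg : Continuous g) (hR : ∀ y, g y ≠ 0 → ‖y‖ ≤ R) (hη : η.rOut ≤ 1) :
    Integrable (fun q : E × E => F q.2 * η.normed μ (q.2 - q.1) * g q.1) (μ.prod μ) := by
  obtain ⟨D, hD⟩ := η.hasCompactSupport_normed.exists_bound_of_continuous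
    (η.continuous_normed (μ := μ))
  have hD0 : 0 ≤ D := (norm_nonneg _).trans (hD 0)
  set K := Metric.closedBall (0 : E) (R + 1)
  have hK : MeasurableSet K := Metric.isClosed_closedBall.measurableSet
  have hFK : IntegrableOn F K μ := hF.integrableOn_isCompact (isCompact_closedBall 0 _)
  have hgi : Integrable g μ :=
    hg.integrable_of_hasCompactSupport (hasCompactSupport_of_norm_le hR)
  refine ((hgi.norm.mul_prod (hFK.integrable_indicator hK).norm).const_mul D).mono' ?_
    (Eventually.of_forall fun q => ?_)
  · refine (hF.aestronglyMeasurable.comp_snd.mul ?_).mul ?_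
    · exact ((η.continuous_normed (μ := μ)).comp
        (continuous_snd.sub continuous_fst)).aestronglyMeasurable
    · exact (hg.comp continuous_fst).aestronglyMeasurable
  · by_cases h1 : g q.1 = 0
    · simp [h1]
    by_cases h2 : η.normed μ (q.2 - q.1) = 0
    · rw [h2, mul_zero, zero_mul, norm_zero]; positivity
    have h3 : ‖q.2 - q.1‖ ≤ 1 := by
      by_contra h
      exact h2 (η.normed_eq_zero_of_le μ (hη.trans (not_le.1 h).le))
    have h4 : q.2 ∈ K := by
      have := norm_le_norm_add_norm_sub' q.2 q.1
      have := hR _ h1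
      simp only [K, mem_closedBall_zero_iff]; linarith
    rw [indicator_of_mem h4, norm_mul, norm_mul]
    have := hD (q.2 - q.1)
    calc _ ≤ ‖F q.2‖ * D * ‖g q.1‖ := by gcongr
      _ = _ := by ring

lemma integrable_mollify_mul {F : E → ℝ} (hF : LocallyIntegrable F μ)
    (hg : Continuous g) (hR : ∀ y, g y ≠ 0 → ‖y‖ ≤ R) (hη : η.rOut ≤ 1) :
    Integrable (fun y => (∫ z, F z * η.normed μ (z - y) ∂μ) * g y) μ := by
  have := (integrable_mollify_mul_prod μ η hF hg hR hη).integral_prod_left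
  simp_rw [integral_mul_const] at this
  exact this

/-- Fubini moves the mollifier from the rough F to the Lipschitz g, where it costs C times the
radius. The ball of radius R + 1 contains the supports of g and of its mollification. -/
lemma abs_integral_mollify_mul_sub_le {F : E → ℝ} (hF : LocallyIntegrable F μ)
    (hg : LipschitzWith C g) (hR : ∀ y, g y ≠ 0 → ‖y‖ ≤ R) (hη : η.rOut ≤ 1) :
    |∫ y, (∫ z, F z * η.normed μ (z - y) ∂μ) * g y ∂μ - ∫ z, F z * g z ∂μ|
      ≤ C * η.rOut * ∫ z in Metric.closedBall (0 : E) (R + 1), |F z| ∂μ := by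
  obtain ⟨B, hB⟩ := exists_forall_abs_le_of_support hg.continuous hR
  set K := Metric.closedBall (0 : E) (R + 1)
  have hK : MeasurableSet K := Metric.isClosed_closedBall.measurableSet
  have hFK : IntegrableOn F K μ := hF.integrableOn_isCompact (isCompact_closedBall 0 _)
  have hint := integrable_mollify_mul_prod μ η hF hg.continuous hR hη
  have hsw : ∫ y, (∫ z, F z * η.normed μ (z - y) ∂μ) * g y ∂μ
      = ∫ z, F z * ∫ y, η.normed μ (z - y) * g y ∂μ ∂μ := by
    simp_rw [← integral_mul_const, ← integral_const_mul, ← mul_assoc]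
    exact integral_integral_swap hint
  have hi1 : Integrable (fun z => F z * ∫ y, η.normed μ (z - y) * g y ∂μ) μ := by
    have := hint.integral_prod_right
    simp_rw [mul_assoc, integral_const_mul] at this
    exact this
  have hi2 : Integrable (fun z => F z * g z) μ :=
    integrable_mul_of_bounded_of_support μ hF hg.continuous.aestronglyMeasurable hB hR
  rw [hsw, ← integral_sub hi1 hi2, ← integral_indicator hK, ← integral_const_mul,
    ← Real.norm_eq_abs]
  refine norm_integral_le_of_norm_le ((IntegrableOn.integrable_indicator hFK.norm hK).const_mul _)
    (Eventually.of_forall fun z => ?_)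
  rw [← mul_sub, norm_mul]
  by_cases hz : z ∈ K
  · rw [indicator_of_mem hz, mul_comm, Real.norm_eq_abs (F z)]
    exact mul_le_mul_of_nonneg_right (abs_integral_normed_mul_sub_le μ η hg z) (abs_nonneg _)
  · have hz' : R + 1 < ‖z‖ := by simpa [K] using hz
    have h1 : g z = 0 := by
      by_contra h
      have := hR z h
      linarith
    have h2 : ∀ y, η.normed μ (z - y) * g y = 0 := fun y => by
      by_cases h : g y = 0
      · rw [h, mul_zero]
      rw [η.normed_eq_zero_of_le μ, zero_mul]
      have := norm_le_norm_add_norm_sub' z y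
      have := hR y h
      linarith
    simp [h1, h2, indicator_of_notMem hz]

/-- Integration by parts between a bump and a Lipschitz function; the minus sign cancels against the
one from differentiating η(z - y) in y. -/
lemma integral_fderiv_normed_sub_mul (hg : LipschitzWith C g) (z v : E) :
    ∫ y, fderiv ℝ (η.normed μ) (z - y) v * g y ∂μ
      = ∫ y, η.normed μ (z - y) * fderiv ℝ g y v ∂μ := by
  have hη1 : ContDiff ℝ 1 (η.normed μ) := η.contDiff_normed (n := 1)
  have hh1 : ContDiff ℝ 1 fun y => η.normed μ (z - y) := hη1.comp (contDiff_const.sub contDiff_id)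
  have hhc : HasCompactSupport fun y => η.normed μ (z - y) :=
    η.hasCompactSupport_normed.comp_homeomorph (Homeomorph.subLeft z)
  obtain ⟨D, hD⟩ := hh1.lipschitzWith_of_hasCompactSupport hhc (by simp)
  have h := hg.integral_lineDeriv_mul_eq (μ := μ) hD hhc v
  have h1 : ∀ y, lineDeriv ℝ (fun y => η.normed μ (z - y)) y (-v)
      = fderiv ℝ (η.normed μ) (z - y) v := fun y => by
    have hd : HasFDerivAt (fun y => η.normed μ (z - y))
        ((fderiv ℝ (η.normed μ) (z - y)).comp (-ContinuousLinearMap.id ℝ E)) y :=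
      ((hη1.differentiable (by simp)) (z - y)).hasFDerivAt.comp y ((hasFDerivAt_id y).const_sub z)
    rw [hd.differentiableAt.lineDeriv_eq_fderiv, hd.fderiv]
    simp
  simp_rw [h1] at h
  rw [← h]
  refine integral_congr_ae ?_
  filter_upwards [hg.ae_differentiableAt (μ := μ)] with y hy
  rw [hy.lineDeriv_eq_fderiv, mul_comm]

lemma fderiv_eq_zero_of_support (hR : ∀ y, g y ≠ 0 → ‖y‖ ≤ R) {y : E} (hy : fderiv ℝ g y ≠ 0) :
    ‖y‖ ≤ R := by
  have h1 : y ∈ tsupport g := support_fderiv_subset ℝ hy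
  have h2 : tsupport g ⊆ Metric.closedBall 0 R :=
    closure_minimal (fun x hx => by simpa using hR x hx) Metric.isClosed_closedBall
  simpa using h2 h1

lemma measurable_fderiv_apply_comp {β : E → E} (hβ : Measurable β) :
    Measurable fun y => fderiv ℝ g y (β y) :=
  (isBoundedBilinearMap_apply (𝕜 := ℝ) (E := E) (F := ℝ)).continuous.measurable.comp
    ((measurable_fderiv ℝ g).prodMk hβ)

/-- The commutator estimate for mollification and a Lipschitz vector field. -/
lemma abs_integral_commutator_le {β : E → E} {ℓ : ℝ} (hβ : Continuous β)
    (hℓ0 : 0 ≤ ℓ) (hℓ : ∀ y z, ‖β y - β z‖ ≤ ℓ * ‖y - z‖) (hg : LipschitzWith C g)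
    (hR : ∀ y, g y ≠ 0 → ‖y‖ ≤ R) (z : E) :
    |∫ y, (fderiv ℝ (η.normed μ) (z - y) (β z) * g y
      - η.normed μ (z - y) * fderiv ℝ g y (β y)) ∂μ| ≤ C * ℓ * η.rOut := by
  have hgc := hasCompactSupport_of_norm_le hR
  have hη : Continuous fun y => η.normed μ (z - y) :=
    (η.continuous_normed (μ := μ)).comp (continuous_const.sub continuous_id)
  have hi1 : Integrable (fun y => fderiv ℝ (η.normed μ) (z - y) (β z) * g y) μ := by
    refine Continuous.integrable_of_hasCompactSupport ?_ hgc.mul_left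
    have := continuous_fderiv_normed μ η
    exact ((this.comp (continuous_const.sub continuous_id)).clm_apply continuous_const).mul
      hg.continuous
  have hi2 : ∀ γ : E → E, Continuous γ →
      Integrable (fun y => η.normed μ (z - y) * fderiv ℝ g y (γ y)) μ := fun γ hγ => by
    obtain ⟨B, hB⟩ := (isCompact_closedBall (0 : E) R).exists_bound_of_continuousOn hγ.continuousOn
    refine integrable_mul_of_bounded_of_support μ hη.locallyIntegrable
      (measurable_fderiv_apply_comp hγ.measurable).aestronglyMeasurable (B := C * max B 0) (R := R)
      (fun y => ?_) (fun y hy => ?_)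
    · by_cases h : fderiv ℝ g y = 0
      · simp only [h, zero_apply, abs_zero]; positivity
      · have := hB y (by simpa using fderiv_eq_zero_of_support hR h)
        refine ((fderiv ℝ g y).le_opNorm _).trans ?_
        exact mul_le_mul (norm_fderiv_le_of_lipschitz ℝ hg) (this.trans (le_max_left _ _))
          (norm_nonneg _) C.2
    · exact fderiv_eq_zero_of_support hR fun h => hy (by simp [h])
  -- With β frozen at z, integration by parts moves the derivative from the bump to g. What remains
  -- contains β(z) - β(y), which is at most ℓ times the radius on the support of the bump.
  rw [integral_sub hi1 (hi2 β hβ), integral_fderiv_normed_sub_mul μ η hg,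
    ← integral_sub (hi2 _ continuous_const) (hi2 β hβ)]
  have hb : ∀ y, ‖η.normed μ (z - y) * fderiv ℝ g y (β z) - η.normed μ (z - y) * fderiv ℝ g y (β y)‖
      ≤ C * ℓ * η.rOut * η.normed μ (z - y) := fun y => by
    rw [← mul_sub, ← map_sub, norm_mul, Real.norm_of_nonneg (η.nonneg_normed _), mul_comm]
    by_cases h : η.rOut ≤ ‖z - y‖
    · rw [η.normed_eq_zero_of_le μ h]; simp
    · refine mul_le_mul_of_nonneg_right ?_ (η.nonneg_normed _)
      refine ((fderiv ℝ g y).le_opNorm _).trans ?_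
      rw [mul_assoc]
      refine mul_le_mul (norm_fderiv_le_of_lipschitz ℝ hg) ?_ (norm_nonneg _) C.2
      exact (hℓ z y).trans (mul_le_mul_of_nonneg_left (not_le.1 h).le hℓ0)
  rw [← Real.norm_eq_abs]
  refine (norm_integral_le_of_norm_le ((η.integrable_normed_sub μ z).const_mul _)
    (Eventually.of_forall hb)).trans_eq ?_
  rw [integral_const_mul, η.integral_normed_sub μ, mul_one]

end Mollify

/-! ### Uniqueness by duality for the continuity equation -/

section Duality

variable {E : Type*} [NormedAddCommGroup E] [NormedSpace ℝ E] [FiniteDimensional ℝ E]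
  [MeasurableSpace E] [BorelSpace E] [CompleteSpace E] [SecondCountableTopology E]

/-- `f` is a weak solution on `[0,T]` of the continuity equation `∂ₜ f + div (b f) = 0` with initial
datum `f₀`; only test functions that do not depend on time are used. -/
structure IsContinuitySolution (μ : Measure E) (b : ℝ → E → E) (T : ℝ) (f₀ : E → ℝ)
    (f : ℝ → E → ℝ) : Prop where
  aesm : AEStronglyMeasurable (fun q : ℝ × E => f q.1 q.2)
    ((volume.restrict (Ioo 0 T)).prod μ)
  locInt₀ : LocallyIntegrable f₀ μ
  locInt : ∀ t ∈ Icc 0 T, LocallyIntegrable (f t) μ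
  locBound : ∀ K : Set E, IsCompact K → ∃ B : ℝ, ∀ t ∈ Icc 0 T, ∫ z in K, |f t z| ∂μ ≤ B
  weakForm : ∀ χ : E → ℝ, ContDiff ℝ ∞ χ → HasCompactSupport χ → ∀ t ∈ Icc 0 T,
    ∫ z, f t z * χ z ∂μ = (∫ z, f₀ z * χ z ∂μ) +
      ∫ s in (0 : ℝ)..t, ∫ z, f s z * fderiv ℝ χ z (b s z) ∂μ

namespace IsContinuitySolution

variable {μ : Measure E} [μ.IsAddHaarMeasure] {b : ℝ → E → E} {L : ℝ → ℝ} {T : ℝ} {f₀ : E → ℝ}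
  {f : ℝ → E → ℝ}

lemma aesm_Ioc (hf : IsContinuitySolution μ b T f₀ f) {t : ℝ} (ht : t ∈ Icc 0 T) :
    AEStronglyMeasurable (fun q : ℝ × E => f q.1 q.2) ((volume.restrict (Ioc 0 t)).prod μ) := by
  refine hf.aesm.mono_ac (Measure.AbsolutelyContinuous.prod ?_ Measure.AbsolutelyContinuous.rfl)
  rw [Measure.restrict_congr_set Ioo_ae_eq_Ioc]
  exact (Measure.restrict_mono_set _ (Ioc_subset_Ioc_right ht.2)).absolutelyContinuous

lemma integrable_mul_indicator (hf : IsContinuitySolution μ b T f₀ f) (hL : Integrable L)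
    {t : ℝ} (ht : t ∈ Icc 0 T) {K : Set E} (hK : IsCompact K) :
    Integrable (fun q : ℝ × E => L q.1 * K.indicator (f q.1) q.2)
      ((volume.restrict (Ioc 0 t)).prod μ) := by
  obtain ⟨B, hB⟩ := hf.locBound K hK
  have hKm := hK.isClosed.measurableSet
  have hm : AEStronglyMeasurable (fun q : ℝ × E => L q.1 * K.indicator (f q.1) q.2)
      ((volume.restrict (Ioc 0 t)).prod μ) := by
    refine hL.aestronglyMeasurable.restrict.comp_fst.mul ?_
    exact (hf.aesm_Ioc ht).indicator (measurable_snd hKm)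
  have hKi : ∀ s ∈ Icc 0 T, Integrable (K.indicator (f s)) μ := fun s hs =>
    ((hf.locInt s hs).integrableOn_isCompact hK).integrable_indicator hKm
  have hsub : ∀ s ∈ Ioc 0 t, s ∈ Icc 0 T := fun s hs => ⟨hs.1.le, hs.2.trans ht.2⟩
  rw [integrable_prod_iff hm]
  constructor
  · filter_upwards [ae_restrict_mem measurableSet_Ioc] with s hs
    exact (hKi s (hsub s hs)).const_mul _
  · refine (hL.norm.mul_const B).restrict.mono' hm.norm.integral_prod_right' ?_
    filter_upwards [ae_restrict_mem measurableSet_Ioc] with s hs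
    simp only [norm_mul, integral_const_mul]
    rw [norm_norm]
    refine mul_le_mul_of_nonneg_left ?_ (norm_nonneg _)
    rw [Real.norm_of_nonneg (integral_nonneg fun _ => norm_nonneg _)]
    refine le_trans (le_of_eq ?_) (hB s (hsub s hs))
    rw [← integral_indicator hKm]
    exact integral_congr_ae (Eventually.of_forall fun z => norm_indicator_eq_indicator_norm _ _)

/-- Local mass of f is bounded uniformly in time and L is integrable, so L times the local mass
dominates the kernels that occur below. -/
lemma integrable_mul_of_le (hf : IsContinuitySolution μ b T f₀ f) (hL : Integrable L)
    {t : ℝ} (ht : t ∈ Icc 0 T) {R D : ℝ} (h : ℝ × E → ℝ)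
    (hh : AEStronglyMeasurable h ((volume.restrict (Ioc 0 t)).prod μ))
    (hD : ∀ q, |h q| ≤ D * |L q.1|) (hR : ∀ q, h q ≠ 0 → ‖q.2‖ ≤ R) :
    Integrable (fun q : ℝ × E => f q.1 q.2 * h q) ((volume.restrict (Ioc 0 t)).prod μ) := by
  refine ((hf.integrable_mul_indicator hL ht (isCompact_closedBall 0 R)).norm.const_mul D).mono'
    ((hf.aesm_Ioc ht).mul hh) (Eventually.of_forall fun q => ?_)
  by_cases hq : h q = 0
  · rw [hq, mul_zero, norm_zero]
    by_cases hD0 : 0 ≤ D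
    · positivity
    · have h1 := hD q
      have : |L q.1| = 0 := by
        have := abs_nonneg (h q)
        have := abs_nonneg (L q.1)
        nlinarith
      simp [abs_eq_zero.1 this]
  · rw [indicator_of_mem (by simpa using hR q hq), norm_mul, norm_mul, Real.norm_eq_abs (h q),
      Real.norm_eq_abs (L q.1), ← mul_assoc, mul_comm]
    exact mul_le_mul_of_nonneg_right (hD q) (norm_nonneg _)

variable (b) in
/-- The kernel obtained by testing the equation with a mollified observable. -/
noncomputable def commKernel (μ : Measure E) (η : ContDiffBump (0 : E)) (φ : ℝ → E → ℝ)
    (y : E) (q : ℝ × E) : ℝ :=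
  fderiv ℝ (η.normed μ) (q.2 - y) (b q.1 q.2) * φ q.1 y
    - η.normed μ (q.2 - y) * fderiv ℝ (φ q.1) y (b q.1 y)

lemma measurable_commKernel (hb : IsLipField b L) (η : ContDiffBump (0 : E)) {φ : ℝ → E → ℝ}
    (hφ : Continuous (Function.uncurry φ)) :
    Measurable fun p : E × ℝ × E => commKernel b μ η φ p.1 p.2 := by
  have happ := (isBoundedBilinearMap_apply (𝕜 := ℝ) (E := E) (F := ℝ)).continuous.measurable
  have h1 : Measurable fun p : E × ℝ × E =>
      fderiv ℝ (η.normed μ) (p.2.2 - p.1) (b p.2.1 p.2.2) :=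
    happ.comp (((continuous_fderiv_normed μ η).measurable.comp
      (measurable_snd.snd.sub measurable_fst)).prodMk (hb.meas.comp measurable_snd))
  have h2 : Measurable fun p : E × ℝ × E => fderiv ℝ (φ p.2.1) p.1 (b p.2.1 p.1) :=
    happ.comp (((measurable_fderiv_with_param ℝ hφ).comp
      (measurable_snd.fst.prodMk measurable_fst)).prodMk
        (hb.meas.comp (measurable_snd.fst.prodMk measurable_fst)))
  have h3 : Measurable fun p : E × ℝ × E => φ p.2.1 p.1 :=
    hφ.measurable.comp (measurable_snd.fst.prodMk measurable_fst)
  have h4 : Measurable fun p : E × ℝ × E => η.normed μ (p.2.2 - p.1) :=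
    (η.continuous_normed (μ := μ)).measurable.comp (measurable_snd.snd.sub measurable_fst)
  exact (h1.mul h3).sub (h4.mul h2)

/-- A crude bound depending on η, used only to justify Fubini; smallness comes from the commutator
estimate after integration in y. The radius R + 1 reflects η.rOut ≤ 1. -/
lemma abs_commKernel_le (hb : IsLipField b L) {η : ContDiffBump (0 : E)} (hη : η.rOut ≤ 1)
    {φ : ℝ → E → ℝ} {R B D D' : ℝ} {C : ℝ≥0} (hR0 : 0 ≤ R)
    (hR : ∀ s y, φ s y ≠ 0 → ‖y‖ ≤ R)
    (hB : ∀ s y, |φ s y| ≤ B) (hC : ∀ s, LipschitzWith C (φ s))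
    (hD : ∀ x, ‖η.normed μ x‖ ≤ D) (hD' : ∀ x, ‖fderiv ℝ (η.normed μ) x‖ ≤ D') (y : E)
    (q : ℝ × E) :
    |commKernel b μ η φ y q| ≤ (D' * (2 + R) * B + D * (C * (1 + R))) * |L q.1| ∧
      (commKernel b μ η φ y q ≠ 0 → ‖y‖ ≤ R ∧ ‖q.2‖ ≤ R + 1) := by
  have hD0 : 0 ≤ D := (norm_nonneg _).trans (hD 0)
  have hD0' : 0 ≤ D' := (norm_nonneg _).trans (hD' 0)
  have hB0 : 0 ≤ B := (abs_nonneg _).trans (hB 0 0)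
  rw [abs_of_nonneg (hb.nonneg _)]
  have hL0 := hb.nonneg q.1
  by_cases hy : R < ‖y‖
  · have h1 : φ q.1 y = 0 := by
      by_contra h
      exact absurd (hR _ _ h) (not_le.2 hy)
    have h2 : fderiv ℝ (φ q.1) y = 0 := by
      by_contra h
      exact absurd (fderiv_eq_zero_of_support (hR q.1) h) (not_le.2 hy)
    have h3 : commKernel b μ η φ y q = 0 := by simp [commKernel, h1, h2]
    rw [h3]
    exact ⟨by rw [abs_zero]; positivity, fun h => absurd rfl h⟩
  have hy := not_lt.1 hy
  by_cases hz : η.rOut < ‖q.2 - y‖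
  · have h3 : commKernel b μ η φ y q = 0 := by
      rw [commKernel, η.fderiv_normed_eq_zero_of_lt μ hz, η.normed_eq_zero_of_le μ hz.le]
      simp
    rw [h3]
    exact ⟨by rw [abs_zero]; positivity, fun h => absurd rfl h⟩
  have hz' : ‖q.2‖ ≤ R + 1 := by
    have := norm_le_norm_add_norm_sub' q.2 y
    linarith [not_lt.1 hz]
  refine ⟨?_, fun _ => ⟨hy, hz'⟩⟩
  have h1 : |fderiv ℝ (η.normed μ) (q.2 - y) (b q.1 q.2)| ≤ D' * (L q.1 * (2 + R)) := by
    refine ((fderiv ℝ (η.normed μ) (q.2 - y)).le_opNorm _).trans ?_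
    refine mul_le_mul (hD' _) ((hb.norm_le _ _).trans ?_) (norm_nonneg _) hD0'
    exact mul_le_mul_of_nonneg_left (by linarith) hL0
  have h2 : |fderiv ℝ (φ q.1) y (b q.1 y)| ≤ C * (L q.1 * (1 + R)) := by
    refine ((fderiv ℝ (φ q.1) y).le_opNorm _).trans ?_
    refine mul_le_mul (norm_fderiv_le_of_lipschitz ℝ (hC _)) ((hb.norm_le _ _).trans ?_)
      (norm_nonneg _) C.2
    exact mul_le_mul_of_nonneg_left (by linarith) hL0
  calc |commKernel b μ η φ y q| ≤ _ := abs_sub _ _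
    _ ≤ D' * (L q.1 * (2 + R)) * B + D * (C * (L q.1 * (1 + R))) := by
        rw [abs_mul, abs_mul]
        exact add_le_add (mul_le_mul h1 (hB _ _) (abs_nonneg _) (by positivity))
          (mul_le_mul (hD _) h2 (abs_nonneg _) hD0)
    _ = _ := by ring

end IsContinuitySolution

end Duality

section Duality

variable {E : Type*} [NormedAddCommGroup E] [NormedSpace ℝ E] [FiniteDimensional ℝ E]
  [MeasurableSpace E] [BorelSpace E] [CompleteSpace E] [SecondCountableTopology E]

namespace IsContinuitySolution

variable {μ : Measure E} [μ.IsAddHaarMeasure] {b : ℝ → E → E} {L : ℝ → ℝ} {T : ℝ} {f₀ : E → ℝ}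
  {f : ℝ → E → ℝ}

lemma exists_bounds_normed (μ : Measure E) [μ.IsAddHaarMeasure] (η : ContDiffBump (0 : E)) :
    ∃ D D' : ℝ, 0 ≤ D ∧ 0 ≤ D' ∧ (∀ x, ‖η.normed μ x‖ ≤ D) ∧
      ∀ x, ‖fderiv ℝ (η.normed μ) x‖ ≤ D' := by
  obtain ⟨D, hD⟩ := η.hasCompactSupport_normed.exists_bound_of_continuous
    (η.continuous_normed (μ := μ))
  obtain ⟨D', hD'⟩ := (η.hasCompactSupport_normed.fderiv ℝ).exists_bound_of_continuous
    (continuous_fderiv_normed μ η)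
  exact ⟨D, D', (norm_nonneg _).trans (hD 0), (norm_nonneg _).trans (hD' 0), hD, hD'⟩

lemma weakForm_normed (hf : IsContinuitySolution μ b T f₀ f) (η : ContDiffBump (0 : E)) (y : E)
    {t : ℝ} (ht : t ∈ Icc 0 T) :
    (∫ z, f₀ z * η.normed μ (z - y) ∂μ) +
      ∫ s in (0 : ℝ)..t, ∫ z, f s z * fderiv ℝ (η.normed μ) (z - y) (b s z) ∂μ
      = ∫ z, f t z * η.normed μ (z - y) ∂μ := by
  have hc : ContDiff ℝ ∞ fun z => η.normed μ (z - y) :=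
    (η.contDiff_normed (n := ⊤)).comp (contDiff_id.sub contDiff_const)
  have hs : HasCompactSupport fun z => η.normed μ (z - y) :=
    η.hasCompactSupport_normed.comp_homeomorph (Homeomorph.subRight y)
  rw [hf.weakForm _ hc hs t ht]
  simp only [fderiv_comp_sub]

/-- For fixed y the weak form with the bump centred at y shows that the mollification of f(s) at y
is absolutely continuous in s. Its product with the pulled-back observable is then differentiated,
using the backward transport equation. -/
lemma ae_mollified_identity (hf : IsContinuitySolution μ b T f₀ f) (hb : IsLipField b L)
    (η : ContDiffBump (0 : E)) {ψ : E → ℝ} {C : ℝ≥0} (hψ : LipschitzWith C ψ)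
    {t : ℝ} (ht : t ∈ Icc 0 T) :
    ∀ᵐ y ∂μ, (∫ z, f t z * η.normed μ (z - y) ∂μ) * ψ y
        - (∫ z, f₀ z * η.normed μ (z - y) ∂μ) * hb.pull ψ t 0 y
      = ∫ s in Ioc 0 t, ∫ z, f s z * commKernel b μ η (hb.pull ψ t) y (s, z) ∂μ := by
  obtain ⟨D, D', hD0, hD0', hD, hD'⟩ := exists_bounds_normed μ η
  filter_upwards [hb.ae_integral_mul_pull μ hψ t] with y hy
  have hsupp : ∀ z, ‖y‖ + η.rOut < ‖z‖ → η.rOut < ‖z - y‖ := fun z hz => by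
    have := norm_le_norm_add_norm_sub' z y
    linarith
  have happ := (isBoundedBilinearMap_apply (𝕜 := ℝ) (E := E) (F := ℝ)).continuous.measurable
  have hder : ∀ s z, |fderiv ℝ (η.normed μ) (z - y) (b s z)|
      ≤ D' * (1 + (‖y‖ + η.rOut)) * |L s| := fun s z => by
    have := η.rOut_pos
    rw [abs_of_nonneg (hb.nonneg s)]
    have hL0 := hb.nonneg s
    by_cases hz : ‖y‖ + η.rOut < ‖z‖
    · rw [η.fderiv_normed_eq_zero_of_lt μ (hsupp z hz)]
      simp only [zero_apply, abs_zero]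
      positivity
    · refine ((fderiv ℝ (η.normed μ) (z - y)).le_opNorm _).trans ?_
      rw [mul_assoc]
      refine mul_le_mul (hD' _) ((hb.norm_le _ _).trans ?_) (norm_nonneg _) hD0'
      rw [mul_comm]
      exact mul_le_mul_of_nonneg_right (by linarith) hL0
  have hder0 : ∀ s z, fderiv ℝ (η.normed μ) (z - y) (b s z) ≠ 0 → ‖z‖ ≤ ‖y‖ + η.rOut :=
    fun s z h => by
      by_contra hz
      rw [η.fderiv_normed_eq_zero_of_lt μ (hsupp z (not_le.1 hz))] at h
      exact h rfl
  have hmeas : Measurable fun q : ℝ × E => fderiv ℝ (η.normed μ) (q.2 - y) (b q.1 q.2) :=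
    happ.comp (((continuous_fderiv_normed μ η).measurable.comp
      (measurable_snd.sub measurable_const)).prodMk hb.meas)
  have hint := (hf.integrable_mul_of_le hb.integrable ht _ hmeas.aestronglyMeasurable
    (fun q => hder q.1 q.2) (fun q => hder0 q.1 q.2)).integral_prod_left
  have hai : IntervalIntegrable
      (fun s => ∫ z, f s z * fderiv ℝ (η.normed μ) (z - y) (b s z) ∂μ) volume 0 t :=
    (intervalIntegrable_iff_integrableOn_Ioc_of_le ht.1).2 hint
  -- The exceptional null set of y was fixed before the amplitude, so the amplitude may depend on y,
  -- as it does here.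
  have key := hy _ (∫ z, f₀ z * η.normed μ (z - y) ∂μ) hai
  rw [hf.weakForm_normed η y ht] at key
  rw [← key, intervalIntegral.integral_of_le ht.1]
  refine setIntegral_congr_fun measurableSet_Ioc fun s hs => ?_
  have hsT : s ∈ Icc 0 T := ⟨hs.1.le, hs.2.trans ht.2⟩
  have h1 : Integrable (fun z => f s z * fderiv ℝ (η.normed μ) (z - y) (b s z)) μ :=
    integrable_mul_of_bounded_of_support μ (hf.locInt s hsT)
      (hmeas.comp measurable_prodMk_left).aestronglyMeasurable (hder s) (hder0 s)
  have h2 : Integrable (fun z => f s z * η.normed μ (z - y)) μ :=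
    integrable_mul_of_bounded_of_support μ (hf.locInt s hsT)
      ((η.continuous_normed (μ := μ)).comp (continuous_id.sub continuous_const)
        ).aestronglyMeasurable (fun z => hD _) fun z h => by
          by_contra hz
          exact h (η.normed_eq_zero_of_le μ (hsupp z (not_le.1 hz)).le)
  simp only [hf.weakForm_normed η y hsT, commKernel]
  rw [← integral_mul_const, ← integral_mul_const, ← integral_sub (h1.mul_const _) (h2.mul_const _)]
  refine integral_congr_ae (Eventually.of_forall fun z => ?_)
  simp only
  ring

/-- The constant M must not depend on η. It collects two mollification errors, at times t and 0, and
the commutator error integrated against |f| in space-time. -/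
lemma exists_forall_abs_sub_le (hf : IsContinuitySolution μ b T f₀ f) (hb : IsLipField b L)
    {ψ : E → ℝ} {C : ℝ≥0} (hψ : LipschitzWith C ψ) {R₀ : ℝ} (hR₀ : 0 ≤ R₀)
    (hψR : ∀ y, ψ y ≠ 0 → ‖y‖ ≤ R₀) {t : ℝ} (ht : t ∈ Icc 0 T) :
    ∃ M, ∀ η : ContDiffBump (0 : E), η.rOut ≤ 1 →
      |∫ z, f t z * ψ z ∂μ - ∫ z, f₀ z * hb.pull ψ t 0 z ∂μ| ≤ M * η.rOut := by
  set φ := hb.pull ψ t with hφ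
  set R := hb.lipConst * (1 + R₀) with hR
  have hRnn : 0 ≤ R := by positivity
  have hφR : ∀ s y, φ s y ≠ 0 → ‖y‖ ≤ R := fun s y h => hb.norm_le_of_pull_ne_zero hψR h
  set C' := C * hb.lipConst with hC'
  have hφC : ∀ s, LipschitzWith C' (φ s) := fun s => hb.lipschitzWith_pull hψ t s
  obtain ⟨B, hB⟩ := exists_forall_abs_le_of_support hψ.continuous hψR
  have hφB : ∀ s y, |φ s y| ≤ B := fun s y => hB _
  have hφt : φ t = ψ := hb.pull_self t
  set K := Metric.closedBall (0 : E) (R + 1) with hK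
  set ν := (volume.restrict (Ioc 0 t)).prod μ with hν
  have hKi := (hf.integrable_mul_indicator hb.integrable ht (isCompact_closedBall 0 (R + 1))).norm
  refine ⟨C' * (∫ z in K, |f t z| ∂μ) + C' * (∫ z in K, |f₀ z| ∂μ)
    + C' * ∫ q, ‖L q.1 * K.indicator (f q.1) q.2‖ ∂ν, fun η hη => ?_⟩
  obtain ⟨D, D', hD0, hD0', hD, hD'⟩ := exists_bounds_normed μ η
  have hk := abs_commKernel_le (μ := μ) hb hη hRnn hφR hφB hφC hD hD'
  have hkm : Measurable fun p : E × ℝ × E => commKernel b μ η φ p.1 p.2 :=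
    measurable_commKernel hb η (hb.continuous_pull hψ.continuous t)
  set D₁ := D' * (2 + R) * B + D * (C' * (1 + R)) with hD₁
  have hB0 : 0 ≤ B := (abs_nonneg _).trans (hB 0)
  have hD₁0 : 0 ≤ D₁ := by positivity
  have hG : Integrable (fun p : E × ℝ × E => f p.2.1 p.2.2 * commKernel b μ η φ p.1 p.2)
      (μ.prod ν) := by
    have h1 : Integrable ((Metric.closedBall (0 : E) R).indicator fun _ => D₁) μ :=
      (integrable_indicator_iff Metric.isClosed_closedBall.measurableSet).2
        (integrableOn_const (hs := (isCompact_closedBall (0 : E) R).measure_lt_top.ne))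
    refine (h1.mul_prod hKi).mono' ?_ (Eventually.of_forall fun p => ?_)
    · exact (hf.aesm_Ioc ht).comp_snd.mul hkm.aestronglyMeasurable
    · by_cases h : commKernel b μ η φ p.1 p.2 = 0
      · rw [h, mul_zero, norm_zero]
        exact mul_nonneg (indicator_nonneg (fun _ _ => hD₁0) _) (norm_nonneg _)
      · obtain ⟨hp1, hp2⟩ := (hk p.1 p.2).2 h
        rw [indicator_of_mem (by simpa using hp1),
          indicator_of_mem (by simpa [hK] using hp2), norm_mul, norm_mul,
          Real.norm_eq_abs (commKernel _ _ _ _ _ _), Real.norm_eq_abs (L _), ← mul_assoc, mul_comm]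
        exact mul_le_mul_of_nonneg_right (hk p.1 p.2).1 (norm_nonneg _)
  -- Integrating the identity over y and exchanging the order leaves the y-integral of the kernel
  -- innermost, the form in which the commutator is small.
  have hid : ∫ y, ((∫ z, f t z * η.normed μ (z - y) ∂μ) * ψ y
        - (∫ z, f₀ z * η.normed μ (z - y) ∂μ) * φ 0 y) ∂μ
      = ∫ q, f q.1 q.2 * ∫ y, commKernel b μ η φ y q ∂μ ∂ν := by
    simp_rw [← integral_const_mul]
    rw [← integral_integral_swap hG]
    refine integral_congr_ae ?_
    filter_upwards [hf.ae_mollified_identity hb η hψ ht, hG.prod_right_ae] with y hy hyi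
    rw [hy]
    exact (integral_prod _ hyi).symm
  have hcomm : |∫ q, f q.1 q.2 * ∫ y, commKernel b μ η φ y q ∂μ ∂ν|
      ≤ C' * (∫ q, ‖L q.1 * K.indicator (f q.1) q.2‖ ∂ν) * η.rOut := by
    rw [mul_right_comm, ← integral_const_mul, ← Real.norm_eq_abs]
    refine norm_integral_le_of_norm_le (hKi.const_mul _) (Eventually.of_forall fun q => ?_)
    by_cases hq : q.2 ∈ K
    · have h1 := abs_integral_commutator_le μ η
        (LipschitzWith.of_dist_le_mul (K := ⟨L q.1, hb.nonneg _⟩) fun y z => by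
          rw [dist_eq_norm, dist_eq_norm]; exact hb.lip q.1 y z).continuous
        (hb.nonneg q.1) (hb.lip q.1) (hφC q.1) (hφR q.1) q.2
      rw [indicator_of_mem hq, norm_mul, norm_mul, Real.norm_of_nonneg (hb.nonneg q.1)]
      calc ‖f q.1 q.2‖ * ‖∫ y, commKernel b μ η φ y q ∂μ‖
          ≤ ‖f q.1 q.2‖ * (C' * L q.1 * η.rOut) := mul_le_mul_of_nonneg_left h1 (norm_nonneg _)
        _ = _ := by ring
    · have h1 : ∀ y, commKernel b μ η φ y q = 0 := fun y => by
        by_contra h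
        exact hq (by simpa [hK] using ((hk y q).2 h).2)
      simp [h1, indicator_of_notMem hq]
  have hψR' : ∀ y, ψ y ≠ 0 → ‖y‖ ≤ R := fun y h => hφR t y (by rwa [hφt])
  have hψC' : LipschitzWith C' ψ := hφt ▸ hφC t
  have e1 := abs_integral_mollify_mul_sub_le μ η (hf.locInt t ht) hψC' hψR' hη
  have e2 := abs_integral_mollify_mul_sub_le μ η hf.locInt₀ (hφC 0) (hφR 0) hη
  rw [← hid, integral_sub (integrable_mollify_mul μ η (hf.locInt t ht) hψC'.continuous hψR' hη)
    (integrable_mollify_mul μ η hf.locInt₀ (hφC 0).continuous (hφR 0) hη)] at hcomm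
  rw [abs_le] at e1 e2 hcomm ⊢
  constructor <;> nlinarith [e1.1, e1.2, e2.1, e2.2, hcomm.1, hcomm.2]

/-- Weak solutions are transported by the flow. -/
theorem integral_mul_eq (hf : IsContinuitySolution μ b T f₀ f) (hb : IsLipField b L)
    {ψ : E → ℝ} (hψ : ContDiff ℝ ∞ ψ) (hψc : HasCompactSupport ψ) {t : ℝ} (ht : t ∈ Icc 0 T) :
    ∫ z, f t z * ψ z ∂μ = ∫ z, f₀ z * ψ (hb.flow 0 z t) ∂μ := by
  obtain ⟨C, hC⟩ := hψ.lipschitzWith_of_hasCompactSupport hψc (by simp)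
  obtain ⟨R, hR⟩ := hψc.isBounded.exists_norm_le
  have hψR : ∀ y, ψ y ≠ 0 → ‖y‖ ≤ max R 0 := fun y h =>
    (hR y (subset_tsupport _ h)).trans (le_max_left _ _)
  obtain ⟨M, hM⟩ := hf.exists_forall_abs_sub_le hb hC (le_max_right _ _) hψR ht
  rw [← sub_eq_zero, ← abs_nonpos_iff]
  refine le_of_tendsto_of_tendsto (b := 𝓝[>] (0 : ℝ)) (f := fun _ => _) tendsto_const_nhds
    (g := fun ε => M * ε) ?_ ?_
  · have : Continuous fun ε : ℝ => M * ε := by fun_prop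
    have := this.tendsto 0
    rw [mul_zero] at this
    exact this.mono_left nhdsWithin_le_nhds
  · filter_upwards [Ioo_mem_nhdsGT (zero_lt_one (α := ℝ))] with ε hε
    exact hM ⟨ε / 2, ε, half_pos hε.1, half_lt_self hε.1⟩ hε.2.le

end IsContinuitySolution

end Duality

/-! ### Convergence of mollifications -/

section Moll

variable {E : Type*} [NormedAddCommGroup E] [NormedSpace ℝ E] [FiniteDimensional ℝ E]
  [MeasurableSpace E] [BorelSpace E] [CompleteSpace E] [SecondCountableTopology E]
  {F : Type*} [NormedAddCommGroup F] [NormedSpace ℝ F] [CompleteSpace F]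
  (μ : Measure E) [μ.IsAddHaarMeasure]

/-- A sequence of bump functions shrinking to the origin. -/
noncomputable def shrinkingBump (E : Type*) [NormedAddCommGroup E] [NormedSpace ℝ E]
    [FiniteDimensional ℝ E] (n : ℕ) : ContDiffBump (0 : E) :=
  ⟨1 / (n + 1) / 2, 1 / (n + 1), by positivity, half_lt_self (by positivity)⟩

lemma shrinkingBump_rOut_le (n : ℕ) : (shrinkingBump E n).rOut ≤ 1 :=
  (div_le_one (by positivity)).2 (by simp)

lemma tendsto_shrinkingBump_rOut :
    Tendsto (fun n => (shrinkingBump E n).rOut) atTop (𝓝 0) :=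
  tendsto_one_div_add_atTop_nhds_zero_nat

/-- Mollification of `k` by a bump function. -/
noncomputable def mollify (η : ContDiffBump (0 : E)) (k : E → F) (z : E) : F :=
  ∫ y, η.normed μ (z - y) • k y ∂μ

variable {μ}

lemma mollify_eq_convolution (η : ContDiffBump (0 : E)) (k : E → F) :
    mollify μ η k = convolution (η.normed μ) k (ContinuousLinearMap.lsmul ℝ ℝ) μ := by
  funext z
  rw [convolution_eq_swap]; rfl

lemma contDiff_mollify (η : ContDiffBump (0 : E)) {k : E → F} (hk : LocallyIntegrable k μ) :
    ContDiff ℝ ∞ (mollify μ η k) := by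
  rw [mollify_eq_convolution]
  exact (η.hasCompactSupport_normed (μ := μ)).contDiff_convolution_left _ (η.contDiff_normed (n := ⊤)) hk

lemma fderiv_mollify (η : ContDiffBump (0 : E)) {k : E → F} (hk : LocallyIntegrable k μ) (z e : E) :
    fderiv ℝ (mollify μ η k) z e = ∫ y, fderiv ℝ (η.normed μ) (z - y) e • k y ∂μ := by
  have h := (η.hasCompactSupport_normed (μ := μ)).hasFDerivAt_convolution_left (μ := μ)
    (ContinuousLinearMap.lsmul ℝ ℝ) (η.contDiff_normed (n := 1)) hk z
  have hce : ConvolutionExistsAt (fderiv ℝ (η.normed μ)) k z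
      ((ContinuousLinearMap.lsmul ℝ ℝ : ℝ →L[ℝ] F →L[ℝ] F).precompL E) μ :=
    ((η.hasCompactSupport_normed (μ := μ)).fderiv ℝ).convolutionExists_left _
      (continuous_fderiv_normed μ η) hk z
  rw [mollify_eq_convolution, h.fderiv, convolution_eq_swap]
  rw [ContinuousLinearMap.integral_apply]
  · rfl
  · exact hce.integrable_swap

lemma norm_mollify_le (η : ContDiffBump (0 : E)) {k : E → F} {B : ℝ}
    (hB : ∀ᵐ y ∂μ, ‖k y‖ ≤ B) (z : E) : ‖mollify μ η k z‖ ≤ B := by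
  refine (norm_integral_le_of_norm_le ((η.integrable_normed_sub μ z).mul_const B) ?_).trans_eq ?_
  · filter_upwards [hB] with y hy
    rw [norm_smul, Real.norm_of_nonneg (η.nonneg_normed _)]
    exact mul_le_mul_of_nonneg_left hy (η.nonneg_normed _)
  · rw [integral_mul_const, η.integral_normed_sub μ, one_mul]

lemma norm_le_of_mollify_ne_zero {η : ContDiffBump (0 : E)} (hη : η.rOut ≤ 1) {k : E → F} {R : ℝ}
    (hR : ∀ y, k y ≠ 0 → ‖y‖ ≤ R) {z : E} (hz : mollify μ η k z ≠ 0) : ‖z‖ ≤ R + 1 := by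
  by_contra h
  refine hz ?_
  rw [mollify]
  have : ∀ y, η.normed μ (z - y) • k y = 0 := fun y => by
    by_cases hy : k y = 0
    · rw [hy, smul_zero]
    · rw [η.normed_eq_zero_of_le μ, zero_smul]
      have := hR y hy
      have := norm_le_norm_add_norm_sub' z y
      linarith [not_le.1 h]
  simp [this]

lemma hasCompactSupport_mollify {η : ContDiffBump (0 : E)} (hη : η.rOut ≤ 1) {k : E → F} {R : ℝ}
    (hR : ∀ y, k y ≠ 0 → ‖y‖ ≤ R) : HasCompactSupport (mollify μ η k) :=
  HasCompactSupport.of_support_subset_isCompact (isCompact_closedBall 0 (R + 1)) fun y hy => by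
    simpa using norm_le_of_mollify_ne_zero hη hR hy

lemma ae_tendsto_mollify {k : E → F} (hk : LocallyIntegrable k μ) :
    ∀ᵐ z ∂μ, Tendsto (fun n => mollify μ (shrinkingBump E n) k z) atTop (𝓝 (k z)) := by
  simp_rw [mollify_eq_convolution]
  refine ContDiffBump.ae_convolution_tendsto_right_of_locallyIntegrable (K := 2)
    tendsto_shrinkingBump_rOut (Eventually.of_forall fun n => ?_) hk
  change (1 : ℝ) / (n + 1) ≤ 2 * (1 / (n + 1) / 2)
  linarith

lemma tendsto_mollify_of_continuous {k : E → F} (hk : Continuous k) (z : E) :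
    Tendsto (fun n => mollify μ (shrinkingBump E n) k z) atTop (𝓝 (k z)) := by
  simp_rw [mollify_eq_convolution]
  exact ContDiffBump.convolution_tendsto_right_of_continuous tendsto_shrinkingBump_rOut hk z

lemma locallyIntegrable_of_bounded {k : E → F} (hk : AEStronglyMeasurable k μ) {B : ℝ}
    (hB : ∀ y, ‖k y‖ ≤ B) : LocallyIntegrable k μ :=
  (locallyIntegrable_const B).mono hk (Eventually.of_forall fun y => (hB y).trans (le_abs_self B))

/-- Integrals against mollifications converge when `ρ`-almost everywhere the mollifications do. -/
lemma tendsto_integral_mul_mollify {ρ : Measure E} {f k : E → ℝ} (hf : LocallyIntegrable f ρ)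
    (hk : AEStronglyMeasurable k μ) {B R : ℝ} (hB : ∀ y, ‖k y‖ ≤ B) (hR : ∀ y, k y ≠ 0 → ‖y‖ ≤ R)
    (hconv : ∀ᵐ z ∂ρ, Tendsto (fun n => mollify μ (shrinkingBump E n) k z) atTop (𝓝 (k z))) :
    Tendsto (fun n => ∫ z, f z * mollify μ (shrinkingBump E n) k z ∂ρ) atTop
      (𝓝 (∫ z, f z * k z ∂ρ)) := by
  have hK := (isCompact_closedBall (0 : E) (R + 1))
  have hKm := hK.isClosed.measurableSet
  have hB0 : 0 ≤ B := (norm_nonneg _).trans (hB 0)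
  have hkl := locallyIntegrable_of_bounded hk hB
  refine tendsto_integral_of_dominated_convergence
    (fun z => ‖(Metric.closedBall (0 : E) (R + 1)).indicator f z‖ * B) (fun n => ?_) ?_
    (fun n => Eventually.of_forall fun z => ?_) ?_
  · exact hf.aestronglyMeasurable.mul (contDiff_mollify _ hkl).continuous.aestronglyMeasurable
  · exact (((hf.integrableOn_isCompact hK).integrable_indicator hKm).norm).mul_const _
  · by_cases h : mollify μ (shrinkingBump E n) k z = 0
    · rw [h, mul_zero, norm_zero]; positivity
    · have := norm_le_of_mollify_ne_zero (shrinkingBump_rOut_le n) hR h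
      rw [indicator_of_mem (by simpa using this), norm_mul]
      exact mul_le_mul_of_nonneg_left
        (norm_mollify_le _ (Eventually.of_forall hB) z) (norm_nonneg _)
  · filter_upwards [hconv] with z hz
    exact tendsto_const_nhds.mul hz

/-- Continuous compactly supported functions are pointwise limits of smooth ones with a common bound
and a common compact support, so dominated convergence applies for any locally finite measure. -/
lemma MeasureTheory.Measure.ext_of_integral_contDiff {ρ σ : Measure E}
    [IsFiniteMeasureOnCompacts ρ] [IsFiniteMeasureOnCompacts σ]
    (h : ∀ ψ : E → ℝ, ContDiff ℝ ∞ ψ → HasCompactSupport ψ → ∫ z, ψ z ∂ρ = ∫ z, ψ z ∂σ) :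
    ρ = σ := by
  refine Measure.ext_of_integral_eq_on_compactlySupported fun k => ?_
  have hkc : Continuous k := k.continuous
  obtain ⟨B, hB⟩ := k.hasCompactSupport.exists_bound_of_continuous hkc
  obtain ⟨R, hR⟩ := k.hasCompactSupport.isBounded.exists_norm_le
  have hR' : ∀ y, k y ≠ 0 → ‖y‖ ≤ R := fun y hy => hR y (subset_tsupport _ hy)
  have hlim : ∀ τ : Measure E, IsFiniteMeasureOnCompacts τ →
      Tendsto (fun n => ∫ z, mollify .addHaar (shrinkingBump E n) k z ∂τ) atTop
        (𝓝 (∫ z, k z ∂τ)) := fun τ _ => by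
    have := tendsto_integral_mul_mollify (μ := .addHaar) (ρ := τ) (f := fun _ => 1)
      (locallyIntegrable_const 1) hkc.aestronglyMeasurable hB hR'
      (Eventually.of_forall (tendsto_mollify_of_continuous hkc))
    simpa using this
  refine tendsto_nhds_unique (hlim ρ inferInstance) ((hlim σ inferInstance).congr fun n => ?_)
  exact (h _ (contDiff_mollify _ hkc.locallyIntegrable)
    (hasCompactSupport_mollify (shrinkingBump_rOut_le n) hR')).symm

end Moll

/-! ### Change of volume and the representation formula -/

section Representation

variable {E : Type*} [NormedAddCommGroup E] [NormedSpace ℝ E] [FiniteDimensional ℝ E]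
  [MeasurableSpace E] [BorelSpace E] [CompleteSpace E] [SecondCountableTopology E]
  {μ : Measure E} [μ.IsAddHaarMeasure] {b : ℝ → E → E} {L : ℝ → ℝ} {T c : ℝ} {f₀ : E → ℝ}
  {f : ℝ → E → ℝ}

/-- If the divergence of `b` is the constant `-c`, then `exp (c t)` solves the continuity
equation. -/
lemma isContinuitySolution_exp (hdiv : ∀ s ∈ Ioo 0 T, ∀ χ : E → ℝ, ContDiff ℝ ∞ χ →
      HasCompactSupport χ → ∫ z, fderiv ℝ χ z (b s z) ∂μ = c * ∫ z, χ z ∂μ) :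
    IsContinuitySolution μ b T (fun _ => 1) (fun t _ => Real.exp (c * t)) where
  aesm := (by fun_prop : Continuous fun q : ℝ × E => Real.exp (c * q.1)).aestronglyMeasurable
  locInt₀ := locallyIntegrable_const _
  locInt t _ := locallyIntegrable_const _
  locBound K _ := by
    refine ⟨Real.exp (|c| * T) * μ.real K, fun t ht => ?_⟩
    rw [setIntegral_const, smul_eq_mul, mul_comm, abs_of_pos (Real.exp_pos _)]
    have : c * t ≤ |c| * T :=
      mul_le_mul (le_abs_self c) ht.2 ht.1 (abs_nonneg c)
    exact mul_le_mul_of_nonneg_right (Real.exp_le_exp.2 this) measureReal_nonneg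
  weakForm χ hχ hχc t ht := by
    have h1 : ∫ s in (0 : ℝ)..t, ∫ z, Real.exp (c * s) * fderiv ℝ χ z (b s z) ∂μ
        = ∫ s in (0 : ℝ)..t, (∫ z, χ z ∂μ) * (Real.exp (c * s) * c) := by
      -- The divergence is known on the open interval only; the endpoint s = T, reached when t = T,
      -- is discarded.
      have hT : ∀ᵐ s : ℝ, s ≠ T := by simp [ae_iff, measure_singleton]
      refine intervalIntegral.integral_congr_ae ?_
      filter_upwards [hT] with s hs hs'
      rw [uIoc_of_le ht.1] at hs'
      rw [integral_const_mul, hdiv s ⟨hs'.1, lt_of_le_of_ne (hs'.2.trans ht.2) hs⟩ χ hχ hχc]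
      ring
    have h2 : ∫ s in (0 : ℝ)..t, Real.exp (c * s) * c = Real.exp (c * t) - 1 := by
      have := intervalIntegral.integral_eq_sub_of_hasDerivAt (a := 0) (b := t)
        (f := fun s => Real.exp (c * s)) (f' := fun s => Real.exp (c * s) * c)
        (fun s _ => by simpa using ((hasDerivAt_id s).const_mul c).exp)
        (by apply Continuous.intervalIntegrable; fun_prop)
      simpa using this
    rw [h1, intervalIntegral.integral_const_mul, h2, integral_const_mul]
    simp only [one_mul]
    ring

/-- Liouville's formula by duality: the spatially constant solution exp(ct) with datum 1 is
transported by the flow, which says that the push-forward of μ and exp(ct) μ integrate test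
functions equally. -/
lemma map_flow_eq_smul (hb : IsLipField b L) (hdiv : ∀ s ∈ Ioo 0 T, ∀ χ : E → ℝ, ContDiff ℝ ∞ χ →
      HasCompactSupport χ → ∫ z, fderiv ℝ χ z (b s z) ∂μ = c * ∫ z, χ z ∂μ) {t : ℝ}
    (ht : t ∈ Icc 0 T) :
    μ.map (hb.flowHomeo 0 t) = ENNReal.ofReal (Real.exp (c * t)) • μ := by
  have hfin : IsFiniteMeasureOnCompacts (μ.map (hb.flowHomeo 0 t)) :=
    ⟨fun K hK => by
      rw [Measure.map_apply (hb.flowHomeo 0 t).continuous.measurable hK.measurableSet]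
      exact ((hb.flowHomeo 0 t).isCompact_preimage.2 hK).measure_lt_top⟩
  have hfin2 : IsFiniteMeasureOnCompacts (ENNReal.ofReal (Real.exp (c * t)) • μ) :=
    IsFiniteMeasureOnCompacts.smul μ ENNReal.ofReal_ne_top
  refine Measure.ext_of_integral_contDiff fun ψ hψ hψc => ?_
  have h := (isContinuitySolution_exp hdiv).integral_mul_eq hb hψ hψc ht
  simp only [one_mul, integral_const_mul] at h
  rw [integral_smul_measure, ENNReal.toReal_ofReal (Real.exp_pos _).le, smul_eq_mul, h]
  exact (integral_map_equiv (hb.flowHomeo 0 t).toMeasurableEquiv ψ)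

lemma map_flow_symm_eq_smul {Φ : E ≃ₜ E} {a : ℝ} (h : μ.map Φ = ENNReal.ofReal (Real.exp a) • μ) :
    μ.map Φ.symm = ENNReal.ofReal (Real.exp (-a)) • μ := by
  have h1 : (μ.map Φ).map Φ.symm = μ := by
    rw [Measure.map_map Φ.symm.continuous.measurable Φ.continuous.measurable]
    simp
  rw [h, Measure.map_smul] at h1
  conv_rhs => rw [← h1]
  rw [smul_smul, ← ENNReal.ofReal_mul (Real.exp_pos _).le, ← Real.exp_add]
  simp

lemma locallyIntegrable_comp_homeomorph {F : Type*} [NormedAddCommGroup F] {Ψ : E ≃ₜ E} {a : ℝ≥0∞}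
    (ha : a ≠ ⊤) (hΨ : μ.map Ψ = a • μ) {k : E → F} (hk : LocallyIntegrable k μ) :
    LocallyIntegrable (fun z => k (Ψ z)) μ := by
  have h1 : LocallyIntegrable k (μ.map Ψ) := by
    intro x
    obtain ⟨U, hU, h⟩ := hk x
    refine ⟨U, hU, ?_⟩
    rw [hΨ, IntegrableOn, Measure.restrict_smul]
    exact h.smul_measure ha
  rw [locallyIntegrable_map_homeomorph] at h1
  exact h1

/-- In the transported identity the substitution z ↦ flow from 0 to t turns the datum into its
composition with the backward flow, at the price of the volume factor. -/
theorem IsContinuitySolution.ae_eq (hf : IsContinuitySolution μ b T f₀ f) (hb : IsLipField b L)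
    (hdiv : ∀ s ∈ Ioo 0 T, ∀ χ : E → ℝ, ContDiff ℝ ∞ χ →
      HasCompactSupport χ → ∫ z, fderiv ℝ χ z (b s z) ∂μ = c * ∫ z, χ z ∂μ) {t : ℝ}
    (ht : t ∈ Icc 0 T) :
    ∀ᵐ z ∂μ, f t z = Real.exp (c * t) * f₀ (hb.flow t z 0) := by
  have hΦ := map_flow_eq_smul hb hdiv ht
  have hΨ := map_flow_symm_eq_smul hΦ
  have hloc : LocallyIntegrable (fun z => f₀ (hb.flow t z 0)) μ :=
    locallyIntegrable_comp_homeomorph ENNReal.ofReal_ne_top hΨ hf.locInt₀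
  refine ae_eq_of_integral_contDiff_smul_eq (hf.locInt t ht)
    (hloc.smul (Real.exp (c * t))) fun ψ hψ hψc => ?_
  have h1 := hf.integral_mul_eq hb hψ hψc ht
  have h2 : ∫ z, f₀ z * ψ (hb.flow 0 z t) ∂μ
      = ∫ z, f₀ (hb.flow t z 0) * ψ z ∂(μ.map (hb.flowHomeo 0 t)) := by
    have := integral_map_equiv (μ := μ) (hb.flowHomeo 0 t).toMeasurableEquiv
      (fun z => f₀ (hb.flow t z 0) * ψ z)
    refine Eq.trans ?_ this.symm
    refine integral_congr_ae (Eventually.of_forall fun z => ?_)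
    change f₀ z * ψ (hb.flow 0 z t) = f₀ (hb.flow t (hb.flow 0 z t) 0) * ψ (hb.flow 0 z t)
    rw [hb.flow_flow, hb.flow_self]
  rw [hΦ, integral_smul_measure, ENNReal.toReal_ofReal (Real.exp_pos _).le] at h2
  simp only [smul_eq_mul] at h2 ⊢
  rw [h2, ← integral_const_mul] at h1
  simpa only [mul_comm, mul_left_comm, mul_assoc] using h1

end Representation

/-! ### Weak derivatives and the chain rule for Lipschitz changes of variables -/

section WeakDeriv

variable {E : Type*} [NormedAddCommGroup E] [NormedSpace ℝ E] [FiniteDimensional ℝ E]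
  [MeasurableSpace E] [BorelSpace E] [CompleteSpace E] [SecondCountableTopology E]
  {F : Type*} [NormedAddCommGroup F] [NormedSpace ℝ F] [CompleteSpace F]

/-- `G` is the weak (distributional) derivative of `f`. -/
structure HasWeakFDeriv (μ : Measure E) (f : E → F) (G : E → E →L[ℝ] F) : Prop where
  locInt : LocallyIntegrable f μ
  locInt_deriv : LocallyIntegrable G μ
  integral_eq : ∀ φ : E → ℝ, ContDiff ℝ ∞ φ → HasCompactSupport φ → ∀ e : E,
    ∫ x, (fderiv ℝ φ x e) • f x ∂μ = - ∫ x, φ x • G x e ∂μ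

variable {μ : Measure E} [μ.IsAddHaarMeasure]

lemma LocallyIntegrable.clm_apply_const {G : E → E →L[ℝ] F} (hG : LocallyIntegrable G μ) (e : E) :
    LocallyIntegrable (fun z => G z e) μ := by
  intro x
  obtain ⟨U, hU, h⟩ := hG x
  exact ⟨U, hU, (ContinuousLinearMap.apply ℝ F e).integrable_comp h⟩

lemma fderiv_normed_const_sub (η : ContDiffBump (0 : E)) (z y v : E) :
    fderiv ℝ (fun y => η.normed μ (z - y)) y v = -fderiv ℝ (η.normed μ) (z - y) v := by
  have hd : HasFDerivAt (fun y => η.normed μ (z - y))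
      ((fderiv ℝ (η.normed μ) (z - y)).comp (-ContinuousLinearMap.id ℝ E)) y :=
    (((η.contDiff_normed (n := 1)).differentiable (by simp)) (z - y)).hasFDerivAt.comp y
      ((hasFDerivAt_id y).const_sub z)
  rw [hd.fderiv]
  simp

lemma LocallyIntegrable.norm_fun {F : Type*} [NormedAddCommGroup F] {f : E → F}
    (hf : LocallyIntegrable f μ) : LocallyIntegrable (fun z => ‖f z‖) μ := fun x =>
  let ⟨U, hU, h⟩ := hf x
  ⟨U, hU, h.norm⟩

namespace HasWeakFDeriv

lemma fderiv_mollify {f : E → F} {G : E → E →L[ℝ] F} (h : HasWeakFDeriv μ f G)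
    (η : ContDiffBump (0 : E)) (z e : E) :
    fderiv ℝ (mollify μ η f) z e = mollify μ η (fun y => G y e) z := by
  have hc : ContDiff ℝ ∞ fun y => η.normed μ (z - y) :=
    (η.contDiff_normed (n := ⊤)).comp (contDiff_const.sub contDiff_id)
  have hs : HasCompactSupport fun y => η.normed μ (z - y) :=
    η.hasCompactSupport_normed.comp_homeomorph (Homeomorph.subLeft z)
  have key := h.integral_eq _ hc hs e
  rw [_root_.fderiv_mollify η h.locInt, mollify, ← neg_eq_iff_eq_neg.2 key, ← integral_neg]
  refine integral_congr_ae (Eventually.of_forall fun y => ?_)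
  simp only [fderiv_normed_const_sub, neg_smul, neg_neg]

/-- Testing a weak derivative with a bounded compactly supported field `h` whose divergence, in the
weak sense, is the bounded function `g`. -/
lemma integral_mul_eq_of_div {f : E → ℝ} {G : E → E →L[ℝ] ℝ} (hf : HasWeakFDeriv μ f G)
    {g : E → ℝ} {h : E → E} (hgm : Measurable g) (hhm : Measurable h) {B R : ℝ}
    (hgB : ∀ y, ‖g y‖ ≤ B) (hhB : ∀ y, ‖h y‖ ≤ B) (hgR : ∀ y, g y ≠ 0 → ‖y‖ ≤ R)
    (hhR : ∀ y, h y ≠ 0 → ‖y‖ ≤ R)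
    (hdiv : ∀ F : E → ℝ, ContDiff ℝ ∞ F → HasCompactSupport F →
      ∫ y, F y * g y ∂μ = - ∫ y, fderiv ℝ F y (h y) ∂μ) :
    ∫ z, f z * g z ∂μ = - ∫ z, G z (h z) ∂μ := by
  classical
  set 𝔅 := Module.finBasis ℝ E with h𝔅
  set ℓ : Fin (Module.finrank ℝ E) → E →L[ℝ] ℝ := fun i => (𝔅.coord i).toContinuousLinearMap
  have hsum : ∀ v : E, v = ∑ i, ℓ i v • 𝔅 i := fun v => (𝔅.sum_repr v).symm
  have hℓm : ∀ i, Measurable fun y => ℓ i (h y) := fun i => (ℓ i).continuous.measurable.comp hhm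
  have hℓB : ∀ i y, ‖ℓ i (h y)‖ ≤ ‖ℓ i‖ * B := fun i y =>
    ((ℓ i).le_opNorm _).trans (mul_le_mul_of_nonneg_left (hhB y) (norm_nonneg _))
  have hℓR : ∀ i y, ℓ i (h y) ≠ 0 → ‖y‖ ≤ R := fun i y hy => hhR y fun h0 => hy (by simp [h0])
  have hℓl : ∀ i, LocallyIntegrable (fun y => ℓ i (h y)) μ := fun i =>
    locallyIntegrable_of_bounded (hℓm i).aestronglyMeasurable (hℓB i)
  have hgl : LocallyIntegrable g μ := locallyIntegrable_of_bounded hgm.aestronglyMeasurable hgB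
  have hGl : ∀ i, LocallyIntegrable (fun z => G z (𝔅 i)) μ := fun i =>
    LocallyIntegrable.clm_apply_const hf.locInt_deriv _
  have hmi : ∀ i n, ContDiff ℝ ∞ (mollify μ (shrinkingBump E n) fun y => ℓ i (h y)) := fun i n =>
    contDiff_mollify _ (hℓl i)
  have hmc : ∀ i n, HasCompactSupport (mollify μ (shrinkingBump E n) fun y => ℓ i (h y)) :=
    fun i n => hasCompactSupport_mollify (shrinkingBump_rOut_le n) (hℓR i)
  -- Mollification commutes with the weak divergence, so the mollified components of h are smooth
  -- fields with divergence the mollified g.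
  have hdivn : ∀ n z, ∑ i, fderiv ℝ (mollify μ (shrinkingBump E n) fun y => ℓ i (h y)) z (𝔅 i)
      = mollify μ (shrinkingBump E n) g z := fun n z => by
    set η := shrinkingBump E n
    have hc : ContDiff ℝ ∞ fun y => η.normed μ (z - y) :=
      (η.contDiff_normed (n := ⊤)).comp (contDiff_const.sub contDiff_id)
    have hs : HasCompactSupport fun y => η.normed μ (z - y) :=
      η.hasCompactSupport_normed.comp_homeomorph (Homeomorph.subLeft z)
    have key := hdiv _ hc hs
    have hint : ∀ i, Integrable (fun y => fderiv ℝ (η.normed μ) (z - y) (𝔅 i) • ℓ i (h y)) μ :=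
      fun i => by
        have hcd : Continuous fun y => fderiv ℝ (η.normed μ) (z - y) (𝔅 i) :=
          ((continuous_fderiv_normed μ η).comp (continuous_const.sub continuous_id)).clm_apply
            continuous_const
        exact integrable_mul_of_bounded_of_support μ hcd.locallyIntegrable
          (hℓm i).aestronglyMeasurable (hℓB i) (hℓR i)
    simp_rw [_root_.fderiv_mollify η (hℓl _)]
    rw [← integral_finsetSum _ fun i _ => hint i]
    simp only [mollify, smul_eq_mul]
    rw [key, ← integral_neg]
    refine integral_congr_ae (Eventually.of_forall fun y => ?_)
    simp only [fderiv_normed_const_sub]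
    conv_rhs => rw [hsum (h y)]
    simp [map_sum, mul_comm]
  have hid : ∀ n, ∫ z, f z * mollify μ (shrinkingBump E n) g z ∂μ
      = - ∑ i, ∫ z, G z (𝔅 i) * mollify μ (shrinkingBump E n) (fun y => ℓ i (h y)) z ∂μ := fun n => by
    simp_rw [← hdivn, Finset.mul_sum]
    rw [integral_finsetSum, ← Finset.sum_neg_distrib]
    · refine Finset.sum_congr rfl fun i _ => ?_
      have := hf.integral_eq _ (hmi i n) (hmc i n) (𝔅 i)
      simpa only [smul_eq_mul, mul_comm] using this
    · intro i _
      have hc : Continuous fun z =>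
          fderiv ℝ (mollify μ (shrinkingBump E n) fun y => ℓ i (h y)) z (𝔅 i) :=
        ((hmi i n).continuous_fderiv (by simp)).clm_apply continuous_const
      have hs : HasCompactSupport fun z =>
          fderiv ℝ (mollify μ (shrinkingBump E n) fun y => ℓ i (h y)) z (𝔅 i) :=
        (hmc i n).fderiv_apply ℝ (𝔅 i)
      simpa only [smul_eq_mul] using
        hf.locInt.integrable_smul_right_of_hasCompactSupport hc hs
  -- Here f and G are only locally integrable; boundedness and compact support of g and h supply the
  -- domination.
  have hlim1 := tendsto_integral_mul_mollify hf.locInt hgm.aestronglyMeasurable hgB hgR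
    (ae_tendsto_mollify hgl)
  have hlim2 : Tendsto (fun n => - ∑ i, ∫ z, G z (𝔅 i) *
      mollify μ (shrinkingBump E n) (fun y => ℓ i (h y)) z ∂μ) atTop
      (𝓝 (- ∑ i, ∫ z, G z (𝔅 i) * ℓ i (h z) ∂μ)) :=
    (tendsto_finsetSum _ fun i _ => tendsto_integral_mul_mollify (hGl i)
      (hℓm i).aestronglyMeasurable (hℓB i) (hℓR i) (ae_tendsto_mollify (hℓl i))).neg
  rw [tendsto_nhds_unique hlim1 (hlim2.congr fun n => (hid n).symm), ← integral_finsetSum]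
  · congr 1
    refine integral_congr_ae (Eventually.of_forall fun z => ?_)
    simp only
    conv_rhs => rw [hsum (h z)]
    simp [map_sum, mul_comm]
  · exact fun i _ => integrable_mul_of_bounded_of_support μ (hGl i)
      (hℓm i).aestronglyMeasurable (hℓB i) (hℓR i)

lemma locallyIntegrable_comp_fderiv {G : E → E →L[ℝ] F} (hG : LocallyIntegrable G μ)
    {Ψ : E ≃ₜ E} {C : ℝ≥0} (hΨ : LipschitzWith C Ψ) {a : ℝ≥0∞} (ha : a ≠ ⊤)
    (hmap : μ.map Ψ = a • μ) :
    LocallyIntegrable (fun z => (G (Ψ z)).comp (fderiv ℝ Ψ z)) μ := by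
  have h1 := locallyIntegrable_comp_homeomorph ha hmap hG
  refine ((LocallyIntegrable.norm_fun h1).smul (C : ℝ)).mono ?_ (Eventually.of_forall fun z => ?_)
  · exact (isBoundedBilinearMap_comp (𝕜 := ℝ) (E := E) (F := E) (G := F)).continuous
      |>.comp_aestronglyMeasurable₂ h1.aestronglyMeasurable
        (measurable_fderiv ℝ Ψ).aestronglyMeasurable
  · refine ((G (Ψ z)).opNorm_comp_le _).trans ?_
    simp only [Pi.smul_apply, smul_eq_mul, norm_mul, norm_norm, NNReal.norm_eq]
    rw [mul_comm]
    exact mul_le_mul_of_nonneg_right (norm_fderiv_le_of_lipschitz ℝ hΨ) (norm_nonneg _)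

/-- The chain rule for a weak derivative and a bi-Lipschitz change of variables that multiplies
the measure by a constant. -/
theorem comp_homeomorph {f : E → ℝ} {G : E → E →L[ℝ] ℝ} (hf : HasWeakFDeriv μ f G)
    {Ψ : E ≃ₜ E} {C : ℝ≥0} (hΨ : LipschitzWith C Ψ) {a : ℝ≥0∞} (ha0 : a ≠ 0) (ha : a ≠ ⊤)
    (hmap : μ.map Ψ = a • μ) :
    HasWeakFDeriv μ (fun z => f (Ψ z)) (fun z => (G (Ψ z)).comp (fderiv ℝ Ψ z)) := by
  refine ⟨locallyIntegrable_comp_homeomorph ha hmap hf.locInt,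
    locallyIntegrable_comp_fderiv hf.locInt_deriv hΨ ha hmap, fun φ hφ hφc e => ?_⟩
  have hΨd : ∀ᵐ z ∂μ, DifferentiableAt ℝ Ψ z := hΨ.ae_differentiableAt
  obtain ⟨D, hD⟩ := hφ.lipschitzWith_of_hasCompactSupport hφc (by simp)
  obtain ⟨B, hB⟩ := hφc.exists_bound_of_continuous hφ.continuous
  obtain ⟨R, hR⟩ := (hφc.isCompact.image Ψ.continuous).isBounded.exists_norm_le
  have har : a.toReal ≠ 0 := ENNReal.toReal_ne_zero.2 ⟨ha0, ha⟩
  have hcv : ∀ k : E → ℝ, ∫ z, k (Ψ z) ∂μ = a.toReal * ∫ z, k z ∂μ := fun k => by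
    have := integral_map_equiv (μ := μ) Ψ.toMeasurableEquiv k
    have h2 : ∫ z, k z ∂(μ.map Ψ) = ∫ z, k (Ψ z) ∂μ := this
    rw [← h2, hmap, integral_smul_measure, smul_eq_mul]
  -- The test field φe is transported by Ψ (a Piola transform). Because Ψ scales volume by a
  -- constant, the transported field h has weak divergence the transported ∂ₑφ, and no derivative of
  -- a Jacobian appears.
  set g : E → ℝ := fun w => fderiv ℝ φ (Ψ.symm w) e with hg
  set h : E → E := fun w => φ (Ψ.symm w) • fderiv ℝ Ψ (Ψ.symm w) e with hh
  have hgm : Measurable g :=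
    ((measurable_fderiv_apply_const ℝ φ e)).comp Ψ.symm.continuous.measurable
  have hhm : Measurable h :=
    (hφ.continuous.measurable.comp Ψ.symm.continuous.measurable).smul
      ((measurable_fderiv_apply_const ℝ Ψ e).comp Ψ.symm.continuous.measurable)
  have hB0 : 0 ≤ B := (norm_nonneg _).trans (hB 0)
  have hgB : ∀ y, ‖g y‖ ≤ max (D * ‖e‖) (B * (C * ‖e‖)) := fun y =>
    le_max_of_le_left (((fderiv ℝ φ _).le_opNorm e).trans
      (mul_le_mul_of_nonneg_right (norm_fderiv_le_of_lipschitz ℝ hD) (norm_nonneg _)))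
  have hhB : ∀ y, ‖h y‖ ≤ max (D * ‖e‖) (B * (C * ‖e‖)) := fun y => by
    refine le_max_of_le_right ?_
    rw [norm_smul]
    refine mul_le_mul (hB _) (((fderiv ℝ Ψ _).le_opNorm e).trans
      (mul_le_mul_of_nonneg_right (norm_fderiv_le_of_lipschitz ℝ hΨ) (norm_nonneg _)))
      (norm_nonneg _) hB0
  have hgR : ∀ y, g y ≠ 0 → ‖y‖ ≤ R := fun y hy => by
    refine hR y ⟨Ψ.symm y, ?_, Ψ.apply_symm_apply y⟩
    exact support_fderiv_subset ℝ fun h0 => hy (by simp [hg, h0])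
  have hhR : ∀ y, h y ≠ 0 → ‖y‖ ≤ R := fun y hy => by
    refine hR y ⟨Ψ.symm y, ?_, Ψ.apply_symm_apply y⟩
    exact subset_tsupport _ fun h0 => hy (by simp [hh, h0])
  have key := hf.integral_mul_eq_of_div hgm hhm hgB hhB hgR hhR fun F hF hFc => ?_
  · have e1 := hcv fun w => f w * g w
    have e2 := hcv fun w => G w (h w)
    rw [key, mul_neg, ← e2] at e1
    simp only [hg, hh, Ψ.symm_apply_apply, map_smul, smul_eq_mul] at e1
    simp only [smul_eq_mul, ContinuousLinearMap.comp_apply]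
    rw [← e1]
    simp only [mul_comm]
  · obtain ⟨A, hA⟩ := hF.lipschitzWith_of_hasCompactSupport hFc (by simp)
    have e1 := hcv fun w => F w * g w
    have e2 := hcv fun w => fderiv ℝ F w (h w)
    simp only [hg, hh, Ψ.symm_apply_apply, map_smul, smul_eq_mul] at e1 e2
    -- The divergence identity for h, pulled back by Ψ, is integration by parts between the
    -- Lipschitz function F ∘ Ψ and φ.
    have e3 := (hA.comp hΨ).integral_lineDeriv_mul_eq (μ := μ) hD hφc e
    have e4 : ∫ z, lineDeriv ℝ (F ∘ Ψ) z e * φ z ∂μ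
        = ∫ z, φ z * fderiv ℝ F (Ψ z) (fderiv ℝ Ψ z e) ∂μ := by
      refine integral_congr_ae ?_
      filter_upwards [hΨd] with z hz
      have hFd : DifferentiableAt ℝ F (Ψ z) := (hF.differentiable (by simp)) _
      rw [(hFd.comp z hz).lineDeriv_eq_fderiv, fderiv_comp z hFd hz, mul_comm]
      rfl
    have e5 : ∫ z, lineDeriv ℝ φ z (-e) * (F ∘ Ψ) z ∂μ
        = - ∫ z, F (Ψ z) * fderiv ℝ φ z e ∂μ := by
      rw [← integral_neg]
      refine integral_congr_ae (Eventually.of_forall fun z => ?_)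
      simp only
      rw [((hφ.differentiable (by simp)) z).lineDeriv_eq_fderiv, map_neg, Function.comp_apply]
      ring
    rw [e4, e5, e1, e2] at e3
    have e6 : a.toReal * ∫ y, F y * g y ∂μ = a.toReal * -∫ y, fderiv ℝ F y (h y) ∂μ := by
      rw [hg, hh]
      simp only [map_smul, smul_eq_mul]
      linarith
    exact mul_left_cancel₀ har e6

end HasWeakFDeriv

end WeakDeriv

/-! ### A Lipschitz, jointly measurable representative of the velocity field -/

section RegularRepresentative

variable {E : Type*} [NormedAddCommGroup E] [NormedSpace ℝ E] [FiniteDimensional ℝ E]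
  [MeasurableSpace E] [BorelSpace E] [CompleteSpace E] [SecondCountableTopology E]
  {F : Type*} [NormedAddCommGroup F] [NormedSpace ℝ F] [CompleteSpace F]
  {μ : Measure E} [μ.IsAddHaarMeasure]

lemma mollify_congr_ae (η : ContDiffBump (0 : E)) {k k' : E → F} (h : k =ᵐ[μ] k') :
    mollify μ η k = mollify μ η k' := by
  funext z
  refine integral_congr_ae ?_
  filter_upwards [h] with y hy
  rw [hy]

lemma mollify_add_of_periodic (η : ContDiffBump (0 : E)) {k : E → F} {e : E}
    (h : ∀ y, k (y + e) = k y) (z : E) : mollify μ η k (z + e) = mollify μ η k z := by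
  rw [mollify, ← integral_add_right_eq_self _ e]
  simp only [h, add_sub_add_right_eq_sub]
  rfl

/-- The gradient of a mollification averages the weak derivative, so all mollifications share the
Lipschitz constant ℓ. -/
lemma HasWeakFDeriv.norm_mollify_sub_le {w : E → F} {Dw : E → E →L[ℝ] F}
    (h : HasWeakFDeriv μ w Dw) {ℓ : ℝ} (hℓ : ∀ᵐ x ∂μ, ‖Dw x‖ ≤ ℓ) (η : ContDiffBump (0 : E))
    (y z : E) : ‖mollify μ η w y - mollify μ η w z‖ ≤ ℓ * ‖y - z‖ := by
  have hℓ0 : 0 ≤ ℓ := by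
    obtain ⟨x, hx⟩ := hℓ.exists
    exact (norm_nonneg _).trans hx
  refine Convex.norm_image_sub_le_of_norm_fderiv_le (𝕜 := ℝ) (s := univ)
    (fun x _ => (contDiff_mollify η h.locInt).differentiable (by simp) x) (fun x _ => ?_)
    convex_univ (mem_univ z) (mem_univ y)
  refine ContinuousLinearMap.opNorm_le_bound _ hℓ0 fun e => ?_
  rw [h.fderiv_mollify]
  refine norm_mollify_le η ?_ x
  filter_upwards [hℓ] with q hq
  exact ((Dw q).le_opNorm e).trans (mul_le_mul_of_nonneg_right hq (norm_nonneg _))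

/-- The mollifications of a function with a bounded weak derivative converge everywhere. -/
lemma HasWeakFDeriv.exists_tendsto_mollify {w : E → F} {Dw : E → E →L[ℝ] F}
    (h : HasWeakFDeriv μ w Dw) {ℓ : ℝ} (hℓ : ∀ᵐ x ∂μ, ‖Dw x‖ ≤ ℓ) (z : E) :
    ∃ a, Tendsto (fun n => mollify μ (shrinkingBump E n) w z) atTop (𝓝 a) := by
  -- Convergence almost everywhere gives convergence on a dense set, and the common Lipschitz
  -- constant propagates it to every point.
  have hdense := Measure.dense_of_ae (ae_tendsto_mollify h.locInt)
  have hℓ0 : 0 ≤ ℓ := by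
    obtain ⟨x, hx⟩ := hℓ.exists
    exact (norm_nonneg _).trans hx
  refine cauchySeq_tendsto_of_complete (Metric.cauchySeq_iff.2 fun ε hε => ?_)
  have hδ : 0 < ε / (3 * (ℓ + 1)) := by positivity
  obtain ⟨y, hy, hyz⟩ := hdense.exists_dist_lt z hδ
  obtain ⟨N, hN⟩ := Metric.cauchySeq_iff.1 hy.cauchySeq (ε / 3) (by positivity)
  refine ⟨N, fun m hm n hn => ?_⟩
  have hb : ∀ n, dist (mollify μ (shrinkingBump E n) w z) (mollify μ (shrinkingBump E n) w y)
      < ε / 3 := fun n => by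
    rw [dist_eq_norm]
    refine (h.norm_mollify_sub_le hℓ _ z y).trans_lt ?_
    rw [dist_eq_norm] at hyz
    calc ℓ * ‖z - y‖ ≤ (ℓ + 1) * ‖z - y‖ :=
          mul_le_mul_of_nonneg_right (by linarith) (norm_nonneg _)
      _ < (ℓ + 1) * (ε / (3 * (ℓ + 1))) := mul_lt_mul_of_pos_left hyz (by linarith)
      _ = ε / 3 := by field_simp
  have h1 := hN m hm n hn
  have h2 := hb m
  have h3 := hb n
  rw [dist_comm] at h3
  have := dist_triangle4 (mollify μ (shrinkingBump E m) w z) (mollify μ (shrinkingBump E m) w y)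
    (mollify μ (shrinkingBump E n) w y) (mollify μ (shrinkingBump E n) w z)
  linarith

variable (μ) in
/-- The limit of the mollifications of `w`. -/
noncomputable def regularRep [Nonempty F] (w : E → F) (z : E) : F :=
  limUnder atTop fun n => mollify μ (shrinkingBump E n) w z

lemma HasWeakFDeriv.tendsto_regularRep {w : E → F} {Dw : E → E →L[ℝ] F}
    (h : HasWeakFDeriv μ w Dw) {ℓ : ℝ} (hℓ : ∀ᵐ x ∂μ, ‖Dw x‖ ≤ ℓ) (z : E) :
    Tendsto (fun n => mollify μ (shrinkingBump E n) w z) atTop (𝓝 (regularRep μ w z)) :=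
  tendsto_nhds_limUnder (h.exists_tendsto_mollify hℓ z)

lemma regularRep_congr_ae {w w' : E → F} (h : w =ᵐ[μ] w') : regularRep μ w = regularRep μ w' := by
  funext z
  simp only [regularRep, mollify_congr_ae _ h]

lemma HasWeakFDeriv.ae_eq_regularRep {w : E → F} {Dw : E → E →L[ℝ] F}
    (h : HasWeakFDeriv μ w Dw) {ℓ : ℝ} (hℓ : ∀ᵐ x ∂μ, ‖Dw x‖ ≤ ℓ) : w =ᵐ[μ] regularRep μ w := by
  filter_upwards [ae_tendsto_mollify h.locInt] with z hz
  exact tendsto_nhds_unique hz (h.tendsto_regularRep hℓ z)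

lemma HasWeakFDeriv.norm_regularRep_sub_le {w : E → F} {Dw : E → E →L[ℝ] F}
    (h : HasWeakFDeriv μ w Dw) {ℓ : ℝ} (hℓ : ∀ᵐ x ∂μ, ‖Dw x‖ ≤ ℓ) (y z : E) :
    ‖regularRep μ w y - regularRep μ w z‖ ≤ ℓ * ‖y - z‖ :=
  le_of_tendsto ((h.tendsto_regularRep hℓ y).sub (h.tendsto_regularRep hℓ z)).norm
    (Eventually.of_forall fun _ => h.norm_mollify_sub_le hℓ _ y z)

lemma HasWeakFDeriv.norm_regularRep_le {w : E → F} {Dw : E → E →L[ℝ] F}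
    (h : HasWeakFDeriv μ w Dw) {ℓ B : ℝ} (hℓ : ∀ᵐ x ∂μ, ‖Dw x‖ ≤ ℓ) (hB : ∀ᵐ x ∂μ, ‖w x‖ ≤ B)
    (z : E) : ‖regularRep μ w z‖ ≤ B :=
  le_of_tendsto (h.tendsto_regularRep hℓ z).norm
    (Eventually.of_forall fun _ => norm_mollify_le _ hB z)

/-- An essential supremum is at most c exactly when the slice of {c < ‖g‖} is null, a measurable
condition on t. -/
lemma measurable_eLpNorm_top {α : Type*} [MeasurableSpace α] {G : Type*} [NormedAddCommGroup G]
    {g : α × E → G} (hg : StronglyMeasurable g) :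
    Measurable fun t => eLpNorm (fun x => g (t, x)) ⊤ μ := by
  refine measurable_of_Iic fun c => ?_
  have h1 : (fun t => eLpNorm (fun x => g (t, x)) ⊤ μ) ⁻¹' Iic c
      = {t | μ (Prod.mk t ⁻¹' {q | c < ‖g q‖ₑ}) = 0} := by
    ext t
    simp only [mem_preimage, mem_Iic, eLpNorm_exponent_top, mem_ofPred_eq]
    constructor
    · intro h
      have := ae_le_eLpNormEssSup (f := fun x => g (t, x)) (μ := μ)
      rw [← compl_mem_ae_iff]
      filter_upwards [this] with x hx
      simpa using hx.trans h
    · intro h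
      refine essSup_le_of_ae_le c ?_
      rw [← compl_mem_ae_iff] at h
      filter_upwards [h] with x hx
      simpa using hx
  rw [h1]
  exact (measurable_measure_prodMk_left (measurableSet_lt measurable_const hg.enorm))
    (measurableSet_singleton 0)

lemma ae_norm_le_toReal_eLpNorm_top {G : Type*} [NormedAddCommGroup G] {g : E → G}
    (hg : eLpNorm g ⊤ μ ≠ ⊤) : ∀ᵐ x ∂μ, ‖g x‖ ≤ (eLpNorm g ⊤ μ).toReal := by
  filter_upwards [ae_le_eLpNormEssSup (f := g) (μ := μ)] with x hx
  rw [eLpNorm_exponent_top] at hg ⊢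
  rw [← toReal_enorm]
  exact ENNReal.toReal_mono hg hx

end RegularRepresentative

lemma HasWeakDerivField.hasWeakFDeriv {d : ℕ} {w : Eucl d → Eucl d}
    {Dw : Eucl d → Eucl d →L[ℝ] Eucl d} (h : HasWeakDerivField w Dw) :
    HasWeakFDeriv volume w Dw :=
  ⟨h.locInt, h.locInt_deriv, h.integral_eq⟩

/-- A velocity field in `L¹(0,T; W^{1,∞})` has a representative that is Lipschitz at all times. -/
theorem MemL1W1inf.exists_regular {d : ℕ} {T : ℝ} {u : ℝ → Eucl d → Eucl d}
    {Du : ℝ → Eucl d → Eucl d →L[ℝ] Eucl d} (hu : MemL1W1inf T u Du) {M : ℝ≥0}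
    (hM : normL1W1inf T u Du ≤ M) :
    ∃ (v : ℝ → Eucl d → Eucl d) (m : ℝ → ℝ), Measurable (Function.uncurry v) ∧ Integrable m ∧
      ∫ t, m t ≤ M ∧ (∀ t x, ‖v t x‖ ≤ m t) ∧ (∀ t x y, ‖v t x - v t y‖ ≤ m t * ‖x - y‖) ∧
      (∀ t, TorusPeriodic (v t)) ∧ ∀ᵐ t ∂volume.restrict (Ioo 0 T), u t =ᵐ[volume] v t := by
  classical
  set u' := hu.aesm.mk with hu'
  set Du' := hu.aesm_deriv.mk with hDu'
  have hum : StronglyMeasurable u' := hu.aesm.stronglyMeasurable_mk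
  have hDum : StronglyMeasurable Du' := hu.aesm_deriv.stronglyMeasurable_mk
  have hue : ∀ᵐ t ∂volume.restrict (Ioo 0 T), u t =ᵐ[volume] fun x => u' (t, x) :=
    Measure.ae_ae_of_ae_prod hu.aesm.ae_eq_mk
  have hDue : ∀ᵐ t ∂volume.restrict (Ioo 0 T), Du t =ᵐ[volume] fun x => Du' (t, x) :=
    Measure.ae_ae_of_ae_prod hu.aesm_deriv.ae_eq_mk
  set N : ℝ → ℝ≥0∞ := fun t =>
    eLpNorm (fun x => u' (t, x)) ⊤ volume + eLpNorm (fun x => Du' (t, x)) ⊤ volume with hN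
  have hNm : Measurable N := (measurable_eLpNorm_top hum).add (measurable_eLpNorm_top hDum)
  have hNe : ∀ᵐ t ∂volume.restrict (Ioo 0 T),
      eLpNorm (u t) ⊤ volume + eLpNorm (Du t) ⊤ volume = N t := by
    filter_upwards [hue, hDue] with t h1 h2
    simp only [hN]
    rw [eLpNorm_congr_ae h1, eLpNorm_congr_ae h2]
  have hNint : ∫⁻ t in Ioo 0 T, N t ≤ M := by
    rw [← lintegral_congr_ae hNe]; exact hM
  have hNfin : ∀ᵐ t ∂volume.restrict (Ioo 0 T), N t < ⊤ :=
    ae_lt_top hNm (hNint.trans_lt ENNReal.coe_lt_top).ne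
  -- The good times are taken in a measurable set of full measure; the representative and its bound
  -- vanish outside it, so the estimates hold at every time.
  obtain ⟨S, hSae, hSm, hS⟩ := (((((hNfin.and hue).and hDue).and hu.weakDeriv).and
    (ae_restrict_mem measurableSet_Ioo)).exists_measurable_mem)
  set N' : ℝ → ℝ≥0∞ := S.indicator N with hN'
  have hN'm : Measurable N' := hNm.indicator hSm
  have hN'int : ∫⁻ t, N' t ≤ M := by
    refine le_trans ?_ hNint
    rw [← lintegral_indicator measurableSet_Ioo]
    refine lintegral_mono fun t => ?_
    exact indicator_le_indicator_of_subset (fun t ht => (hS t ht).2) (fun _ => zero_le) t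
  have hN'fin : ∫⁻ t, N' t ≠ ⊤ := (hN'int.trans_lt ENNReal.coe_lt_top).ne
  set v : ℝ → Eucl d → Eucl d := fun t => if t ∈ S then regularRep volume fun x => u' (t, x) else 0
    with hv
  have hreg : ∀ t ∈ S, v t = regularRep volume (u t) ∧ HasWeakFDeriv volume (u t) (Du t) ∧
      (∀ᵐ x, ‖u t x‖ ≤ (N' t).toReal) ∧ (∀ᵐ x, ‖Du t x‖ ≤ (N' t).toReal) := fun t ht => by
    obtain ⟨⟨⟨⟨h1, h2⟩, h3⟩, h4⟩, h5⟩ := hS t ht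
    have e1 := eLpNorm_congr_ae (p := ⊤) h2
    have e2 := eLpNorm_congr_ae (p := ⊤) h3
    have eN : N' t = N t := indicator_of_mem ht _
    have hadd := ENNReal.add_lt_top.1 h1
    refine ⟨?_, h4.hasWeakFDeriv, ?_, ?_⟩
    · simp only [hv, if_pos ht]
      exact regularRep_congr_ae h2.symm
    · have hle : eLpNorm (u t) ⊤ volume ≤ N t := by
        rw [e1]; exact le_self_add
      filter_upwards [ae_norm_le_toReal_eLpNorm_top (hle.trans_lt h1).ne] with x hx
      rw [eN]
      exact hx.trans (ENNReal.toReal_mono h1.ne hle)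
    · have hle : eLpNorm (Du t) ⊤ volume ≤ N t := by
        rw [e2]; exact le_add_self
      filter_upwards [ae_norm_le_toReal_eLpNorm_top (hle.trans_lt h1).ne] with x hx
      rw [eN]
      exact hx.trans (ENNReal.toReal_mono h1.ne hle)
  refine ⟨v, fun t => (N' t).toReal, ?_, integrable_toReal_of_lintegral_ne_top hN'm.aemeasurable
    hN'fin, ?_, fun t x => ?_, fun t x y => ?_, fun t x i => ?_, ?_⟩
  · have hw : ∀ n, Measurable fun q : ℝ × Eucl d => S.indicator
        (fun t => mollify volume (shrinkingBump (Eucl d) n) (fun y => u' (t, y)) q.2) q.1 := fun n => by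
      have hsm : StronglyMeasurable fun q : ℝ × Eucl d =>
          mollify volume (shrinkingBump (Eucl d) n) (fun y => u' (q.1, y)) q.2 := by
        refine StronglyMeasurable.integral_prod_right (f := fun (q : ℝ × Eucl d) y =>
          (shrinkingBump (Eucl d) n).normed volume (q.2 - y) • u' (q.1, y)) ?_
        refine StronglyMeasurable.fun_smul ?_ (hum.comp_measurable
          (measurable_fst.fst.prodMk measurable_snd))
        exact (((shrinkingBump (Eucl d) n).continuous_normed (μ := volume)).comp
          (by fun_prop : Continuous fun p : (ℝ × Eucl d) × Eucl d => p.1.2 - p.2)).stronglyMeasurable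
      exact hsm.measurable.indicator (measurable_fst hSm)
    -- Joint measurability passes to the limit because the same mollifying sequence is used at every
    -- time.
    refine measurable_of_tendsto_metrizable hw (tendsto_pi_nhds.2 fun q => ?_)
    by_cases ht : q.1 ∈ S
    · obtain ⟨h1, h2, h3, h4⟩ := hreg q.1 ht
      have h5 := (hS q.1 ht).1.1.1.2
      simp only [indicator_of_mem ht, Function.uncurry_def]
      rw [h1]
      have := h2.tendsto_regularRep h4 q.2
      simpa only [mollify_congr_ae _ h5] using this
    · simp only [indicator_of_notMem ht, Function.uncurry_def, hv, if_neg ht, Pi.zero_apply]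
      exact tendsto_const_nhds
  · rw [integral_toReal hN'm.aemeasurable (ae_lt_top hN'm hN'fin)]
    exact ENNReal.toReal_le_coe_of_le_coe hN'int
  · by_cases ht : t ∈ S
    · obtain ⟨h1, h2, h3, h4⟩ := hreg t ht
      rw [h1]
      exact h2.norm_regularRep_le h4 h3 x
    · simp [hv, if_neg ht]
  · by_cases ht : t ∈ S
    · obtain ⟨h1, h2, h3, h4⟩ := hreg t ht
      rw [h1]
      exact h2.norm_regularRep_sub_le h4 x y
    · simp only [hv, if_neg ht, Pi.zero_apply, sub_self, norm_zero]
      positivity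
  · by_cases ht : t ∈ S
    · obtain ⟨h1, h2, h3, h4⟩ := hreg t ht
      rw [h1]
      have hper := hu.periodic t (hS t ht).2
      simp only [regularRep, mollify_add_of_periodic _ (fun y => hper y i)]
    · simp [hv, if_neg ht]
  · filter_upwards [hSae] with t ht
    obtain ⟨h1, h2, h3, h4⟩ := hreg t ht
    rw [h1]
    exact h2.ae_eq_regularRep h4

/-! ### Periodicity and fundamental domains -/

section Generic

variable {E : Type*} [NormedAddCommGroup E] [NormedSpace ℝ E] [FiniteDimensional ℝ E]
  [MeasurableSpace E] [BorelSpace E] [CompleteSpace E] [SecondCountableTopology E]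
  {μ : Measure E} [μ.IsAddHaarMeasure]

lemma IsLipField.flow_add_of_periodic {b : ℝ → E → E} {L : ℝ → ℝ} (hb : IsLipField b L) {e : E}
    (he : ∀ t y, b t (y + e) = b t y) (s t : ℝ) (z : E) :
    hb.flow s (z + e) t = hb.flow s z t + e := by
  have hc := hb.isCurve_flow s z
  have h : IsLipField.IsCurve b s (z + e) fun t => hb.flow s z t + e := by
    refine ⟨hc.cont.add continuous_const, ?_, fun t => ?_⟩
    · obtain ⟨R, hR⟩ := hc.bdd
      exact ⟨R + ‖e‖, fun t => (norm_add_le _ _).trans (add_le_add (hR t) le_rfl)⟩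
    · simp only [he]
      rw [hc.eq t]
      abel
  exact (congrFun (h.eq_flow hb) t).symm

lemma HasWeakFDeriv.ae_eq {F : Type*} [NormedAddCommGroup F] [NormedSpace ℝ F] [CompleteSpace F]
    {f : E → F} {G G' : E → E →L[ℝ] F} (h : HasWeakFDeriv μ f G) (h' : HasWeakFDeriv μ f G') :
    G =ᵐ[μ] G' := by
  have hi : ∀ i, ∀ᵐ z ∂μ, G z (Module.finBasis ℝ E i) = G' z (Module.finBasis ℝ E i) := fun i => by
    refine ae_eq_of_integral_contDiff_smul_eq
      (LocallyIntegrable.clm_apply_const h.locInt_deriv _)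
      (LocallyIntegrable.clm_apply_const h'.locInt_deriv _) fun φ hφ hφc => ?_
    rw [← neg_inj, ← h.integral_eq φ hφ hφc, ← h'.integral_eq φ hφ hφc]
  filter_upwards [ae_all_iff.2 hi] with z hz
  exact ContinuousLinearMap.coe_injective ((Module.finBasis ℝ E).ext hz)

/-- The translate of G is a weak derivative of the same function, by the chain rule for
translations, and weak derivatives are unique. Thus periodicity of the gradients follows from that
of f. -/
lemma HasWeakFDeriv.ae_eq_add_of_periodic {f : E → ℝ} {G : E → E →L[ℝ] ℝ}
    (h : HasWeakFDeriv μ f G) {e : E} (he : ∀ z, f (z + e) = f z) :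
    ∀ᵐ z ∂μ, G (z + e) = G z := by
  have h1 := h.comp_homeomorph (Ψ := Homeomorph.addRight e) (C := 1) (a := 1)
    (LipschitzWith.of_dist_le_mul fun x y => by simp) one_ne_zero ENNReal.one_ne_top
    (by rw [one_smul]; exact map_add_right_eq_self μ e)
  have hd : ∀ z, fderiv ℝ (fun y : E => y + e) z = ContinuousLinearMap.id ℝ E := fun z => by
    have : HasFDerivAt (fun y : E => y + e) (ContinuousLinearMap.id ℝ E) z :=
      (hasFDerivAt_id z).add_const e
    exact this.fderiv
  simp only [Homeomorph.coe_addRight, he, hd, ContinuousLinearMap.comp_id] at h1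
  exact h1.ae_eq h

lemma integral_fderiv_mul_eq {χ f : E → ℝ} (hχ : ContDiff ℝ ∞ χ) (hχc : HasCompactSupport χ)
    {C : ℝ≥0} (hf : LipschitzWith C f) (e : E) :
    ∫ z, fderiv ℝ χ z e * f z ∂μ = - ∫ z, lineDeriv ℝ f z e * χ z ∂μ := by
  obtain ⟨D, hD⟩ := hχ.lipschitzWith_of_hasCompactSupport hχc (by simp)
  rw [hf.integral_lineDeriv_mul_eq hD hχc, ← integral_neg]
  refine integral_congr_ae (Eventually.of_forall fun z => ?_)
  simp only
  rw [((hχ.differentiable (by simp)) z).lineDeriv_eq_fderiv, map_neg, neg_mul, neg_neg]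

/-- A function invariant under a group of translations has the same integral over any two sets of
representatives; these are described by equivariant maps to the group. -/
lemma setLIntegral_eq_of_equivariant {X ι : Type*} [MeasurableSpace X] [AddCommGroup X]
    [MeasurableAdd X] {μ : Measure X} [μ.IsAddRightInvariant] [AddCommGroup ι] [Countable ι]
    {τ : ι → X} {N N' : X → ι} (hNm : ∀ n, MeasurableSet (N ⁻¹' {n}))
    (hNm' : ∀ n, MeasurableSet (N' ⁻¹' {n})) (hN : ∀ n x, N (x + τ n) = N x + n)
    (hN' : ∀ n x, N' (x + τ n) = N' x + n) {H : X → ℝ≥0∞}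
    (hH : ∀ n, ∀ᵐ x ∂μ, H (x + τ n) = H x) :
    ∫⁻ x in N' ⁻¹' {0}, H x ∂μ = ∫⁻ x in N ⁻¹' {0}, H x ∂μ := by
  -- Each domain is cut along the other's indexing: the piece N' = 0, N = n is the translate by τ n
  -- of the piece N = 0, N' = -n.
  have h1 : N' ⁻¹' {0} = ⋃ n, N' ⁻¹' {0} ∩ N ⁻¹' {n} := by
    ext x; simp
  have h2 : N ⁻¹' {0} = ⋃ n, N ⁻¹' {0} ∩ N' ⁻¹' {-n} := by
    ext x
    simp only [mem_preimage, mem_singleton_iff, mem_iUnion, mem_inter_iff, exists_and_left,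
      iff_self_and]
    exact fun _ => ⟨-N' x, by simp⟩
  rw [h1, h2, lintegral_iUnion (fun n => (hNm' 0).inter (hNm n)),
    lintegral_iUnion (fun n => (hNm 0).inter (hNm' (-n)))]
  · refine tsum_congr fun n => ?_
    rw [← lintegral_indicator ((hNm' 0).inter (hNm n)),
      ← lintegral_indicator ((hNm 0).inter (hNm' (-n))), ← lintegral_add_right_eq_self _ (τ n)]
    refine lintegral_congr_ae ?_
    filter_upwards [hH n] with x hx
    have hiff : x + τ n ∈ N' ⁻¹' {0} ∩ N ⁻¹' {n} ↔ x ∈ N ⁻¹' {0} ∩ N' ⁻¹' {-n} := by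
      simp only [mem_inter_iff, mem_preimage, mem_singleton_iff, hN, hN']
      rw [and_comm, add_eq_zero_iff_eq_neg, add_eq_right]
    by_cases hx' : x ∈ N ⁻¹' {0} ∩ N' ⁻¹' {-n}
    · rw [indicator_of_mem hx', indicator_of_mem (hiff.2 hx'), hx]
    · rw [indicator_of_notMem hx', indicator_of_notMem fun h => hx' (hiff.1 h)]
  · intro n m hnm
    refine disjoint_left.2 fun x hx hx' => hnm ?_
    exact neg_inj.1 ((show N' x = -n from hx.2).symm.trans hx'.2)
  · intro n m hnm
    refine disjoint_left.2 fun x hx hx' => hnm ?_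
    exact (show N x = n from hx.2).symm.trans hx'.2

end Generic

/-! ### The kinetic characteristic field -/

section Kinetic

variable {d : ℕ}

instance : (volume : Measure (Phase d)).IsAddHaarMeasure :=
  inferInstanceAs (((volume : Measure (Eucl d)).prod (volume : Measure (Eucl d))).IsAddHaarMeasure)

/-- The translation of phase space by an integer vector in the space variable. -/
noncomputable def latticeShift (n : Fin d → ℤ) : Phase d :=
  (WithLp.toLp 2 fun i => (n i : ℝ), 0)

/-- The index of the unit cell containing the space variable. -/
noncomputable def cellIndex (z : Phase d) (i : Fin d) : ℤ := ⌊z.1 i⌋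

lemma cellIndex_add_latticeShift (n : Fin d → ℤ) (z : Phase d) :
    cellIndex (z + latticeShift n) = cellIndex z + n := by
  funext i
  simp [cellIndex, latticeShift]

lemma measurableSet_cellIndex (n : Fin d → ℤ) :
    MeasurableSet ((cellIndex : Phase d → Fin d → ℤ) ⁻¹' {n}) := by
  have : Measurable (cellIndex : Phase d → Fin d → ℤ) := by
    refine measurable_pi_lambda _ fun i => Int.measurable_floor.comp ?_
    exact ((EuclideanSpace.proj (𝕜 := ℝ) i).continuous.comp continuous_fst).measurable
  exact this (measurableSet_singleton n)

lemma cellIndex_preimage_zero :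
    (cellIndex : Phase d → Fin d → ℤ) ⁻¹' {0} = unitCell d ×ˢ (univ : Set (Eucl d)) := by
  ext z
  simp only [mem_preimage, mem_singleton_iff, mem_prod, mem_univ, and_true, unitCell,
    mem_ofPred_eq, funext_iff, cellIndex, Pi.zero_apply, Int.floor_eq_zero_iff]

lemma sum_smul_single (x : Eucl d) : ∑ i, x i • EuclideanSpace.single i (1 : ℝ) = x := by
  simpa using (EuclideanSpace.basisFun (Fin d) ℝ).sum_repr x

lemma TorusPeriodic.add_int {β : Type*} {g : Eucl d → β} (hg : TorusPeriodic g) (n : Fin d → ℤ)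
    (x : Eucl d) : g (x + WithLp.toLp 2 fun i => (n i : ℝ)) = g x := by
  let P : AddSubgroup (Eucl d) :=
    { carrier := {c | ∀ x, g (x + c) = g x}
      zero_mem' := fun x => by rw [add_zero]
      add_mem' := fun {a c} ha hc x => by rw [← add_assoc, hc, ha]
      neg_mem' := fun {a} ha x => by rw [← ha (x + -a), neg_add_cancel_right] }
  have h : (WithLp.toLp 2 fun i => (n i : ℝ) : Eucl d) ∈ P := by
    rw [← sum_smul_single (WithLp.toLp 2 fun i => (n i : ℝ) : Eucl d)]
    refine sum_mem fun i _ => ?_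
    have : ((n i : ℝ) • EuclideanSpace.single i (1 : ℝ) : Eucl d)
        = n i • EuclideanSpace.single i (1 : ℝ) := Int.cast_smul_eq_zsmul ℝ _ _
    simp only [this]
    exact zsmul_mem (show EuclideanSpace.single i (1 : ℝ) ∈ P from fun x => hg x i) _
  exact h x

/-- The characteristic field `(v, w(t,x) - v)` of the kinetic equation, cut off outside of
`(0,T)`. -/
noncomputable def kineticField (T : ℝ) (w : ℝ → Eucl d → Eucl d) (t : ℝ) (z : Phase d) : Phase d :=
  (Ioo 0 T).indicator (fun t => (z.2, w t z.1 - z.2)) t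

lemma kineticField_of_mem {T : ℝ} (w : ℝ → Eucl d → Eucl d) {t : ℝ} (ht : t ∈ Ioo 0 T)
    (z : Phase d) : kineticField T w t z = (z.2, w t z.1 - z.2) := indicator_of_mem ht _

lemma kineticField_of_notMem {T : ℝ} (w : ℝ → Eucl d → Eucl d) {t : ℝ} (ht : t ∉ Ioo 0 T)
    (z : Phase d) : kineticField T w t z = 0 := indicator_of_notMem ht _

lemma kineticField_add_latticeShift {T : ℝ} {w : ℝ → Eucl d → Eucl d}
    (hw : ∀ t, TorusPeriodic (w t)) (n : Fin d → ℤ) (t : ℝ) (z : Phase d) :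
    kineticField T w t (z + latticeShift n) = kineticField T w t z := by
  by_cases ht : t ∈ Ioo 0 T
  · rw [kineticField_of_mem w ht, kineticField_of_mem w ht]
    simp [latticeShift, (hw t).add_int]
  · rw [kineticField_of_notMem w ht, kineticField_of_notMem w ht]

/-- The Lipschitz constant of `kineticField`. -/
noncomputable def kineticBound (T : ℝ) (m : ℝ → ℝ) (t : ℝ) : ℝ :=
  (Ioo 0 T).indicator (fun _ => 1) t + m t

lemma integral_kineticBound {T : ℝ} (hT : 0 < T) {m : ℝ → ℝ} (hm : Integrable m) :
    Integrable (kineticBound T m) ∧ ∫ t, kineticBound T m t = T + ∫ t, m t := by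
  have h1 : Integrable ((Ioo 0 T).indicator fun _ => (1 : ℝ)) :=
    (integrable_indicator_iff measurableSet_Ioo).2 (integrableOn_const (by simp))
  refine ⟨h1.add hm, ?_⟩
  change ∫ t, ((Ioo 0 T).indicator (fun _ => (1 : ℝ)) t + m t) = _
  rw [integral_add h1 hm, integral_indicator measurableSet_Ioo]
  simp [hT.le]

variable {T : ℝ} {w : ℝ → Eucl d → Eucl d} {m : ℝ → ℝ}

lemma isLipField_kineticField (hT : 0 < T) (hwm : Measurable (Function.uncurry w))
    (hm : Integrable m) (hw : ∀ t x, ‖w t x‖ ≤ m t)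
    (hwl : ∀ t x y, ‖w t x - w t y‖ ≤ m t * ‖x - y‖) :
    IsLipField (kineticField T w) (kineticBound T m) where
  meas := by
    have h1 : Measurable fun q : ℝ × Phase d => (q.2.2, w q.1 q.2.1 - q.2.2) :=
      measurable_snd.snd.prodMk
        ((hwm.comp (measurable_fst.prodMk measurable_snd.fst)).sub measurable_snd.snd)
    have h2 : Function.uncurry (kineticField T w) = (Prod.fst ⁻¹' Ioo 0 T).indicator
        fun q : ℝ × Phase d => (q.2.2, w q.1 q.2.1 - q.2.2) := by
      funext q
      by_cases ht : q.1 ∈ Ioo 0 T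
      · rw [indicator_of_mem (by exact ht)]
        exact kineticField_of_mem w ht q.2
      · rw [indicator_of_notMem (by exact ht)]
        exact kineticField_of_notMem w ht q.2
    rw [h2]
    exact h1.indicator (measurable_fst measurableSet_Ioo)
  integrable := (integral_kineticBound hT hm).1
  lip t y z := by
    have hm0 : 0 ≤ m t := (norm_nonneg _).trans (hw t 0)
    by_cases ht : t ∈ Ioo 0 T
    · rw [kineticField_of_mem w ht, kineticField_of_mem w ht, kineticBound, indicator_of_mem ht]
      have h1 : ‖y.1 - z.1‖ ≤ ‖y - z‖ := norm_fst_le (y - z)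
      have h2 : ‖y.2 - z.2‖ ≤ ‖y - z‖ := norm_snd_le (y - z)
      rw [Prod.mk_sub_mk, Prod.norm_mk, add_mul, one_mul]
      refine max_le ?_ ?_
      · have := mul_nonneg hm0 (norm_nonneg (y - z))
        linarith
      · rw [sub_sub_sub_comm]
        refine (norm_sub_le _ _).trans ?_
        have h3 := (hwl t y.1 z.1).trans (mul_le_mul_of_nonneg_left h1 hm0)
        linarith
    · rw [kineticField_of_notMem w ht, kineticField_of_notMem w ht, sub_self, norm_zero,
        kineticBound, indicator_of_notMem ht]
      positivity
  growth t := by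
    have hm0 : 0 ≤ m t := (norm_nonneg _).trans (hw t 0)
    by_cases ht : t ∈ Ioo 0 T
    · rw [kineticField_of_mem w ht, kineticBound, indicator_of_mem ht]
      have := hw t 0
      simp only [Prod.norm_mk, Prod.snd_zero, Prod.fst_zero, sub_zero, norm_zero]
      exact max_le (by positivity) (by linarith)
    · rw [kineticField_of_notMem w ht, norm_zero, kineticBound, indicator_of_notMem ht]
      positivity

/-- Velocities along characteristics are controlled by the initial velocity. -/
lemma one_add_norm_snd_flow_le (hb : IsLipField (kineticField T w) (kineticBound T m))
    (hw : ∀ t x, ‖w t x‖ ≤ m t) (s t : ℝ) (z : Phase d) :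
    1 + ‖(hb.flow s z t).2‖ ≤ hb.lipConst * (1 + ‖z.2‖) := by
  have hc := hb.isCurve_flow s z
  obtain ⟨R, hR⟩ := hc.bdd
  have hfi := hb.integrable_flow s z
  -- The velocity component of the field is bounded through v alone, uniformly in x; Gronwall
  -- therefore closes in v, whatever the position on the covering space ℝᵈ.
  have hbound : ∀ r y, ‖(kineticField T w r y).2‖ ≤ kineticBound T m r * (1 + ‖y.2‖) := fun r y => by
    have hm0 : 0 ≤ m r := (norm_nonneg _).trans (hw r 0)
    by_cases hr : r ∈ Ioo 0 T
    · rw [kineticField_of_mem w hr, kineticBound, indicator_of_mem hr]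
      refine (norm_sub_le _ _).trans ?_
      have := hw r y.1
      have := mul_nonneg hm0 (norm_nonneg y.2)
      nlinarith
    · rw [kineticField_of_notMem w hr, kineticBound, indicator_of_notMem hr]
      simp only [Prod.snd_zero, norm_zero, zero_add]
      positivity
  have h := gronwall_of_le_abs_integral hb.integrable hb.nonneg
    (h := fun t => 1 + ‖(hb.flow s z t).2‖) (B := 1 + R)
    (fun t => by linarith [hR t, norm_snd_le (hb.flow s z t)]) (fun t => by positivity)
    (δ := 1 + ‖z.2‖) (s := s) (fun t => ?_) t
  · refine h.trans ?_
    have := abs_intervalIntegral_le_integral hb.integrable hb.nonneg s t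
    rw [IsLipField.coe_lipConst, mul_right_comm]
    gcongr
  · rw [add_assoc]
    refine add_le_add le_rfl ?_
    have h2 : (hb.flow s z t).2
        = z.2 + ∫ r in s..t, (kineticField T w r (hb.flow s z r)).2 := by
      conv_lhs => rw [hc.eq t]
      rw [Prod.snd_add]
      congr 1
      exact ((ContinuousLinearMap.snd ℝ (Eucl d) (Eucl d)).intervalIntegral_comp_comm
        hfi.intervalIntegrable).symm
    rw [h2]
    refine (norm_add_le _ _).trans (add_le_add le_rfl ?_)
    refine intervalIntegral.norm_integral_le_abs_of_norm_le
      (Eventually.of_forall fun r => hbound r _) ?_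
    exact hb.integrable.intervalIntegrable.mul_continuousOn
      (continuous_const.add hc.cont.snd.norm).continuousOn

/-- The divergence of the kinetic field is `-d`. -/
lemma integral_fderiv_kineticField {s : ℝ} (hs : s ∈ Ioo 0 T)
    (hwl : ∀ t x y, ‖w t x - w t y‖ ≤ m t * ‖x - y‖) (hm0 : 0 ≤ m s) {χ : Phase d → ℝ}
    (hχ : ContDiff ℝ ∞ χ) (hχc : HasCompactSupport χ) :
    ∫ z, fderiv ℝ χ z (kineticField T w s z) = d * ∫ z, χ z := by
  have hwL : LipschitzWith ⟨m s, hm0⟩ (w s) := LipschitzWith.of_dist_le_mul fun x y => by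
    rw [dist_eq_norm, dist_eq_norm]; exact hwl s x y
  have hproj : ∀ i, LipschitzWith 1 fun x : Eucl d => x i := fun i =>
    LipschitzWith.of_dist_le_mul fun x y => by
      rw [NNReal.coe_one, one_mul, dist_eq_norm, dist_eq_norm]
      exact PiLp.norm_apply_le (x - y) i
  have hint : ∀ (g : Phase d → ℝ) (e : Phase d), Continuous g →
      Integrable fun z => fderiv ℝ χ z e * g z := fun g e hg =>
    (((hχ.continuous_fderiv (by simp)).clm_apply continuous_const).mul hg
      ).integrable_of_hasCompactSupport ((hχc.fderiv_apply ℝ e).mul_right)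
  have hid : ∀ z : Phase d, fderiv ℝ χ z (kineticField T w s z)
      = ∑ i, (fderiv ℝ χ z (EuclideanSpace.single i 1, 0) * z.2 i
        + fderiv ℝ χ z (0, EuclideanSpace.single i 1) * w s z.1 i
        - fderiv ℝ χ z (0, EuclideanSpace.single i 1) * z.2 i) := fun z => by
    have h1 : kineticField T w s z = ∑ i, (z.2 i • (EuclideanSpace.single i 1, 0)
        + w s z.1 i • (0, EuclideanSpace.single i 1)
        - z.2 i • ((0, EuclideanSpace.single i 1) : Phase d)) := by
      rw [kineticField_of_mem w hs]
      refine Prod.ext ?_ ?_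
      · simp [Prod.fst_sum, sum_smul_single]
      · simp [Prod.snd_sum, sum_smul_single, Finset.sum_sub_distrib]
    rw [h1, map_sum]
    refine Finset.sum_congr rfl fun i _ => ?_
    rw [map_sub, map_add, map_smul, map_smul, map_smul]
    simp only [smul_eq_mul, mul_comm]
  have hl1 : LipschitzWith 1 fun z : Phase d => z.2 := LipschitzWith.prod_snd
  have hl2 : LipschitzWith 1 fun z : Phase d => z.1 := LipschitzWith.prod_fst
  -- Of the three contributions, vᵢ does not vary with xᵢ and wᵢ does not vary with v. Only the
  -- friction term -vᵢ has a divergence, equal to -1 for each i.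
  have hA : ∀ i, ∫ z : Phase d, fderiv ℝ χ z (EuclideanSpace.single i 1, 0) * z.2 i = 0 :=
    fun i => by
      refine (integral_fderiv_mul_eq (f := fun z : Phase d => z.2 i) hχ hχc
        ((hproj i).comp hl1) _).trans ?_
      simp [lineDeriv]
  have hB : ∀ i, ∫ z : Phase d, fderiv ℝ χ z (0, EuclideanSpace.single i 1) * w s z.1 i = 0 :=
    fun i => by
      refine (integral_fderiv_mul_eq (f := fun z : Phase d => w s z.1 i) hχ hχc
        ((hproj i).comp (hwL.comp hl2)) _).trans ?_
      simp [lineDeriv]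
  have hC : ∀ i, ∫ z : Phase d, fderiv ℝ χ z (0, EuclideanSpace.single i 1) * z.2 i
      = -∫ z, χ z := fun i => by
    refine (integral_fderiv_mul_eq (f := fun z : Phase d => z.2 i) hχ hχc
      ((hproj i).comp hl1) _).trans ?_
    simp [lineDeriv]
  have hc1 : ∀ i, Continuous fun z : Phase d => z.2 i := fun i =>
    ((hproj i).comp hl1).continuous
  have hc2 : ∀ i, Continuous fun z : Phase d => w s z.1 i := fun i =>
    ((hproj i).comp (hwL.comp hl2)).continuous
  simp_rw [hid]
  have hI : ∀ i : Fin d, Integrable fun z : Phase d =>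
      fderiv ℝ χ z (EuclideanSpace.single i 1, 0) * z.2 i
        + fderiv ℝ χ z (0, EuclideanSpace.single i 1) * w s z.1 i
        - fderiv ℝ χ z (0, EuclideanSpace.single i 1) * z.2 i := fun i =>
    ((hint _ _ (hc1 i)).add (hint _ _ (hc2 i))).sub (hint _ _ (hc1 i))
  rw [integral_finsetSum _ fun i _ => hI i]
  have : ∀ i : Fin d, ∫ z : Phase d, (fderiv ℝ χ z (EuclideanSpace.single i 1, 0) * z.2 i
        + fderiv ℝ χ z (0, EuclideanSpace.single i 1) * w s z.1 i
        - fderiv ℝ χ z (0, EuclideanSpace.single i 1) * z.2 i) = ∫ z, χ z := fun i => by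
    have hI' : Integrable fun z : Phase d => fderiv ℝ χ z (EuclideanSpace.single i 1, 0) * z.2 i
        + fderiv ℝ χ z (0, EuclideanSpace.single i 1) * w s z.1 i :=
      (hint _ _ (hc1 i)).add (hint _ _ (hc2 i))
    rw [integral_sub hI' (hint _ _ (hc1 i)),
      integral_add (hint _ _ (hc1 i)) (hint _ _ (hc2 i)), hA, hB, hC]
    ring
  simp [this]

lemma IsKineticSolution.isContinuitySolution {u : ℝ → Eucl d → Eucl d} {f₀ : Phase d → ℝ}
    {f : ℝ → Phase d → ℝ} (hf : IsKineticSolution T u f₀ f) (hT : 0 < T)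
    (hf₀ : LocallyIntegrable f₀)
    (huw : ∀ᵐ t ∂volume.restrict (Ioo 0 T), u t =ᵐ[volume] w t) :
    IsContinuitySolution volume (kineticField T w) T f₀ f where
  aesm := hf.aesm
  locInt₀ := hf₀
  locInt := hf.locInt
  locBound := hf.locBound
  weakForm χ hχ hχc t ht := by
    -- A time cutoff equal to 1 on a neighbourhood of [0,T]: it makes a spatial test function
    -- compactly supported in time without contributing a time derivative there.
    let θ : ContDiffBump (0 : ℝ) := ⟨T + 1, T + 2, by linarith, by linarith⟩
    have hθ1 : ∀ s ∈ Icc 0 T, ∀ z : Phase d,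
        (fun q : ℝ × Phase d => θ q.1 * χ q.2) =ᶠ[𝓝 (s, z)] fun q => χ q.2 := fun s hs z => by
      have hU : Prod.fst ⁻¹' Metric.ball (0 : ℝ) (T + 1) ∈ 𝓝 (s, z) := by
        refine (Metric.isOpen_ball.preimage continuous_fst).mem_nhds ?_
        simp only [mem_preimage, Metric.mem_ball, dist_zero_right, Real.norm_eq_abs]
        rw [abs_of_nonneg hs.1]
        linarith [hs.2]
      filter_upwards [hU] with q hq
      rw [θ.one_of_mem_closedBall (Metric.ball_subset_closedBall hq), one_mul]
    have hφ : ContDiff ℝ ∞ fun q : ℝ × Phase d => θ q.1 * χ q.2 :=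
      (θ.contDiff.comp contDiff_fst).mul (hχ.comp contDiff_snd)
    have hφc : HasCompactSupport fun q : ℝ × Phase d => θ q.1 * χ q.2 := by
      refine HasCompactSupport.of_support_subset_isCompact
        (θ.hasCompactSupport.isCompact.prod hχc.isCompact) fun q hq => ?_
      exact ⟨subset_tsupport _ (left_ne_zero_of_mul hq),
        subset_tsupport _ (right_ne_zero_of_mul hq)⟩
    have h := hf.weakForm _ hφ hφc t ht
    have e1 : ∀ s ∈ Icc 0 T, ∀ z : Phase d, θ s * χ z = χ z := fun s hs z =>
      (hθ1 s hs z).eq_of_nhds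
    simp only [e1 t ht, e1 0 ⟨le_rfl, hT.le⟩] at h
    rw [h]
    congr 1
    refine intervalIntegral.integral_congr_ae ?_
    have hne : ∀ᵐ s : ℝ, s ≠ T := by simp [ae_iff, measure_singleton]
    filter_upwards [hne, (ae_restrict_iff' measurableSet_Ioo).1 huw] with s hs1 hs2 hs3
    rw [uIoc_of_le ht.1] at hs3
    have hsT : s ∈ Ioo 0 T := ⟨hs3.1, lt_of_le_of_ne (hs3.2.trans ht.2) hs1⟩
    refine integral_congr_ae ?_
    filter_upwards [Measure.quasiMeasurePreserving_fst.ae (hs2 hsT)] with z hz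
    rw [kineticField_of_mem w hsT, (hθ1 s ⟨hsT.1.le, hsT.2.le⟩ z).fderiv_eq, ← hz]
    have hd : HasFDerivAt (fun q : ℝ × Phase d => χ q.2)
        ((fderiv ℝ χ z).comp (ContinuousLinearMap.snd ℝ ℝ (Phase d))) (s, z) :=
      HasFDerivAt.comp (s, z) ((hχ.differentiable (by simp)) z).hasFDerivAt hasFDerivAt_snd
    rw [hd.fderiv]
    rfl

end Kinetic

/-! ### Weak gradients on phase space -/

section Generic

variable {E : Type*} [NormedAddCommGroup E] [NormedSpace ℝ E] [FiniteDimensional ℝ E]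
  [MeasurableSpace E] [BorelSpace E] [CompleteSpace E] [SecondCountableTopology E]
  {μ : Measure E} [μ.IsAddHaarMeasure]

lemma LocallyIntegrable.comp_of_norm_le {F F' : Type*} [NormedAddCommGroup F]
    [NormedAddCommGroup F'] {g : E → F} (hg : LocallyIntegrable g μ) {h : F → F'}
    (hh : Continuous h) {C : ℝ} (hC : ∀ y, ‖h y‖ ≤ C * ‖y‖) :
    LocallyIntegrable (fun x => h (g x)) μ := by
  refine ((LocallyIntegrable.norm_fun hg).smul C).mono
    (hh.comp_aestronglyMeasurable hg.aestronglyMeasurable) (Eventually.of_forall fun z => ?_)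
  refine (hC (g z)).trans ?_
  simp only [Pi.smul_apply, smul_eq_mul, norm_mul, norm_norm]
  exact mul_le_mul_of_nonneg_right (Real.le_norm_self C) (norm_nonneg _)

lemma HasWeakFDeriv.congr_const_mul {f g : E → ℝ} {G : E → E →L[ℝ] ℝ} (hg : HasWeakFDeriv μ g G)
    {c : ℝ} (hf : ∀ᵐ z ∂μ, f z = c * g z) : HasWeakFDeriv μ f fun z => c • G z where
  locInt := (hg.locInt.smul c).congr (hf.mono fun z hz => hz.symm)
  locInt_deriv := hg.locInt_deriv.smul c
  integral_eq φ hφ hφc e := by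
    have h1 : ∫ x, fderiv ℝ φ x e • f x ∂μ = c * ∫ x, fderiv ℝ φ x e • g x ∂μ := by
      rw [← integral_const_mul]
      refine integral_congr_ae (hf.mono fun z hz => ?_)
      simp only [hz, smul_eq_mul]
      ring
    have h2 : ∫ x, φ x • (c • G x) e ∂μ = c * ∫ x, φ x • G x e ∂μ := by
      rw [← integral_const_mul]
      refine integral_congr_ae (Eventually.of_forall fun z => ?_)
      simp only [smul_eq_mul, smul_apply]
      ring
    rw [h1, h2, hg.integral_eq φ hφ hφc e, mul_neg]

end Generic

section Kinetic

variable {d : ℕ}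

/-- The linear form on phase space with the given components. -/
noncomputable def phaseForm (a b : Eucl d) : Phase d →L[ℝ] ℝ :=
  (innerSL ℝ a).comp (ContinuousLinearMap.fst ℝ _ _)
    + (innerSL ℝ b).comp (ContinuousLinearMap.snd ℝ _ _)

lemma phaseForm_apply (a b : Eucl d) (e : Phase d) :
    phaseForm a b e = inner ℝ a e.1 + inner ℝ b e.2 := rfl

lemma phaseForm_injective {a b a' b' : Eucl d} (h : phaseForm a b = phaseForm a' b') :
    a = a' ∧ b = b' := by
  refine ⟨ext_inner_right ℝ fun e => ?_, ext_inner_right ℝ fun e => ?_⟩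
  · simpa [phaseForm_apply] using DFunLike.congr_fun h (e, 0)
  · simpa [phaseForm_apply] using DFunLike.congr_fun h (0, e)

lemma norm_innerSL_comp_le {A : Phase d →L[ℝ] Eucl d} (hA : ‖A‖ ≤ 1) (a : Eucl d) :
    ‖(innerSL ℝ a).comp A‖ ≤ 1 * ‖a‖ := by
  refine ((innerSL ℝ a).opNorm_comp_le A).trans ?_
  rw [innerSL_apply_norm, mul_comm]
  exact mul_le_mul_of_nonneg_right hA (norm_nonneg _)

lemma norm_phaseForm_le (a b : Eucl d) : ‖phaseForm a b‖ ≤ ‖a‖ + ‖b‖ := by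
  refine (norm_add_le _ _).trans (add_le_add ?_ ?_)
  · simpa using norm_innerSL_comp_le (ContinuousLinearMap.norm_fst_le ℝ (Eucl d) (Eucl d)) a
  · simpa using norm_innerSL_comp_le (ContinuousLinearMap.norm_snd_le ℝ (Eucl d) (Eucl d)) b

lemma HasWeakGrads.hasWeakFDeriv {f : Phase d → ℝ} {gx gv : Phase d → Eucl d}
    (h : HasWeakGrads f gx gv) : HasWeakFDeriv volume f fun z => phaseForm (gx z) (gv z) where
  locInt := h.locInt
  locInt_deriv := by
    have hc : ∀ A : Phase d →L[ℝ] Eucl d, Continuous fun a : Eucl d => (innerSL ℝ a).comp A :=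
      fun A => (innerSL ℝ).continuous.clm_comp continuous_const
    exact (LocallyIntegrable.comp_of_norm_le h.locInt_x (hc _)
        (norm_innerSL_comp_le (ContinuousLinearMap.norm_fst_le ℝ (Eucl d) (Eucl d)))).add
      (LocallyIntegrable.comp_of_norm_le h.locInt_v (hc _)
        (norm_innerSL_comp_le (ContinuousLinearMap.norm_snd_le ℝ (Eucl d) (Eucl d))))
  integral_eq φ hφ hφc e := by
    have hi1 : ∀ e : Phase d, Integrable fun z => f z * fderiv ℝ φ z e := fun e =>
      h.locInt.integrable_smul_right_of_hasCompactSupport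
        ((hφ.continuous_fderiv (by simp)).clm_apply continuous_const) (hφc.fderiv_apply ℝ e)
    have hi2 : ∀ {g : Phase d → Eucl d}, LocallyIntegrable g → ∀ a : Eucl d,
        Integrable fun z => inner ℝ (g z) a * φ z := fun hg a =>
      (LocallyIntegrable.comp_of_norm_le hg (h := fun y => inner ℝ y a) (C := ‖a‖)
        (continuous_id.inner continuous_const) fun y => by
          rw [mul_comm]; exact norm_inner_le_norm y a)
        |>.integrable_smul_right_of_hasCompactSupport hφ.continuous hφc
    have h1 : ∫ z, fderiv ℝ φ z e • f z
        = (∫ z, f z * fderiv ℝ φ z (e.1, 0)) + ∫ z, f z * fderiv ℝ φ z (0, e.2) := by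
      rw [← integral_add (hi1 _) (hi1 _)]
      refine integral_congr_ae (Eventually.of_forall fun z => ?_)
      simp only [smul_eq_mul]
      rw [← mul_add, ← map_add, Prod.mk_add_mk, add_zero, zero_add, mul_comm]
    have h2 : ∫ z, φ z • phaseForm (gx z) (gv z) e
        = (∫ z, inner ℝ (gx z) e.1 * φ z) + ∫ z, inner ℝ (gv z) e.2 * φ z := by
      rw [← integral_add (hi2 h.locInt_x _) (hi2 h.locInt_v _)]
      refine integral_congr_ae (Eventually.of_forall fun z => ?_)
      simp only [smul_eq_mul, phaseForm_apply]
      ring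
    rw [h1, h2, h.integral_x φ hφ hφc, h.integral_v φ hφ hφc, neg_add]

/-- The gradients are the Riesz representatives of the two restrictions of G; restriction to a
factor does not increase the norm. -/
lemma HasWeakFDeriv.hasWeakGrads {f : Phase d → ℝ} {G : Phase d → Phase d →L[ℝ] ℝ}
    (h : HasWeakFDeriv volume f G) : ∃ gx gv : Phase d → Eucl d, HasWeakGrads f gx gv ∧
      (∀ z, ‖gx z‖ ≤ ‖G z‖) ∧ ∀ z, ‖gv z‖ ≤ ‖G z‖ := by
  let R : (Eucl d →L[ℝ] Phase d) → (Phase d →L[ℝ] ℝ) → Eucl d :=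
    fun A ℓ => (InnerProductSpace.toDual ℝ (Eucl d)).symm (ℓ.comp A)
  have hR : ∀ A ℓ e, inner ℝ (R A ℓ) e = ℓ (A e) := fun A ℓ e =>
    InnerProductSpace.toDual_symm_apply
  have hRn : ∀ A : Eucl d →L[ℝ] Phase d, ‖A‖ ≤ 1 → ∀ ℓ, ‖R A ℓ‖ ≤ 1 * ‖ℓ‖ := fun A hA ℓ => by
    rw [LinearIsometryEquiv.norm_map, mul_comm]
    exact (ℓ.opNorm_comp_le A).trans (mul_le_mul_of_nonneg_left hA (norm_nonneg _))
  have hRc : ∀ A, Continuous (R A) := fun A =>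
    (LinearIsometryEquiv.continuous _).comp (continuous_id.clm_comp continuous_const)
  have hl := ContinuousLinearMap.norm_inl_le_one ℝ (Eucl d) (Eucl d)
  have hr := ContinuousLinearMap.norm_inr_le_one ℝ (Eucl d) (Eucl d)
  refine ⟨fun z => R (ContinuousLinearMap.inl ℝ _ _) (G z),
    fun z => R (ContinuousLinearMap.inr ℝ _ _) (G z), ⟨h.locInt, ?_, ?_, ?_, ?_⟩,
    fun z => by simpa using hRn _ hl (G z), fun z => by simpa using hRn _ hr (G z)⟩
  · exact LocallyIntegrable.comp_of_norm_le h.locInt_deriv (hRc _) (hRn _ hl)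
  · exact LocallyIntegrable.comp_of_norm_le h.locInt_deriv (hRc _) (hRn _ hr)
  · intro φ hφ hφc e
    simpa [hR, mul_comm] using h.integral_eq φ hφ hφc (e, 0)
  · intro φ hφ hφc e
    simpa [hR, mul_comm] using h.integral_eq φ hφ hφc (0, e)

lemma HasWeakGrads.ae_eq_add_latticeShift {f : Phase d → ℝ} {gx gv : Phase d → Eucl d}
    (h : HasWeakGrads f gx gv) (hf : ∀ v, TorusPeriodic fun x => f (x, v)) (n : Fin d → ℤ) :
    ∀ᵐ z, f (z + latticeShift n) = f z ∧ gx (z + latticeShift n) = gx z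
      ∧ gv (z + latticeShift n) = gv z := by
  have hp : ∀ z, f (z + latticeShift n) = f z := fun z => by
    have := (hf z.2).add_int n z.1
    simpa [latticeShift, Prod.add_def] using this
  filter_upwards [h.hasWeakFDeriv.ae_eq_add_of_periodic hp] with z hz
  exact ⟨hp z, phaseForm_injective hz⟩

/-! ### Velocity weights and moments under the flow -/

lemma bracket_le (v : Eucl d) : bracket v ≤ 1 + ‖v‖ :=
  Real.sqrt_le_iff.2 ⟨by positivity, by nlinarith [norm_nonneg v]⟩

lemma one_add_norm_le_bracket (v : Eucl d) : 1 + ‖v‖ ≤ 2 * bracket v := by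
  have h1 : 1 ≤ bracket v := Real.one_le_sqrt.2 (by nlinarith [sq_nonneg ‖v‖])
  have h2 : ‖v‖ ≤ bracket v := Real.le_sqrt_of_sq_le (by linarith)
  linarith

/-- The sum is at most three times the largest term. -/
lemma Real.add_add_rpow_le {a b c p : ℝ} (ha : 0 ≤ a) (hb : 0 ≤ b) (hc : 0 ≤ c) (hp : 0 ≤ p) :
    (a + b + c) ^ p ≤ 3 ^ p * (a ^ p + b ^ p + c ^ p) := by
  have key : ∀ x, 0 ≤ x → a ≤ x → b ≤ x → c ≤ x → x ^ p ≤ a ^ p + b ^ p + c ^ p →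
      (a + b + c) ^ p ≤ 3 ^ p * (a ^ p + b ^ p + c ^ p) := fun x hx h1 h2 h3 h => by
    refine (Real.rpow_le_rpow (by positivity) (by linarith : a + b + c ≤ 3 * x) hp).trans ?_
    rw [Real.mul_rpow (by norm_num) hx]
    gcongr
  have := Real.rpow_nonneg ha p
  have := Real.rpow_nonneg hb p
  have := Real.rpow_nonneg hc p
  rcases le_total a b with h1 | h1 <;> rcases le_total b c with h2 | h2 <;>
    rcases le_total a c with h3 | h3
  all_goals first
    | exact key c hc (by linarith) (by linarith) le_rfl (by linarith)
    | exact key b hb (by linarith) le_rfl (by linarith) (by linarith)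
    | exact key a ha le_rfl (by linarith) (by linarith) (by linarith)

lemma bracket_rpow_mul_le {v v₀ : Eucl d} {C B q p : ℝ} (hq : 0 ≤ q) (hp : 0 ≤ p)
    (hv : bracket v ≤ C * bracket v₀) (hC : 0 ≤ C) (hB : 0 ≤ B) {a b c a₀ b₀ c₀ : ℝ} (ha : 0 ≤ a)
    (hb : 0 ≤ b) (hc : 0 ≤ c) (ha₀ : 0 ≤ a₀) (hb₀ : 0 ≤ b₀) (hc₀ : 0 ≤ c₀)
    (h1 : a ≤ B * (a₀ + b₀ + c₀)) (h2 : b ≤ B * (a₀ + b₀ + c₀)) (h3 : c ≤ B * (a₀ + b₀ + c₀)) :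
    bracket v ^ q * (a ^ p + b ^ p + c ^ p)
      ≤ C ^ q * (3 * (B ^ p * 3 ^ p)) * (bracket v₀ ^ q * (a₀ ^ p + b₀ ^ p + c₀ ^ p)) := by
  have hb0 : 0 ≤ bracket v₀ := Real.sqrt_nonneg _
  have hV : bracket v ^ q ≤ C ^ q * bracket v₀ ^ q := by
    rw [← Real.mul_rpow hC hb0]
    exact Real.rpow_le_rpow (Real.sqrt_nonneg _) hv hq
  have key : ∀ y, 0 ≤ y → y ≤ B * (a₀ + b₀ + c₀) →
      y ^ p ≤ B ^ p * 3 ^ p * (a₀ ^ p + b₀ ^ p + c₀ ^ p) := fun y hy h => by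
    refine (Real.rpow_le_rpow hy h hp).trans ?_
    rw [Real.mul_rpow hB (by positivity), mul_assoc]
    exact mul_le_mul_of_nonneg_left (Real.add_add_rpow_le ha₀ hb₀ hc₀ hp) (by positivity)
  have hS : a ^ p + b ^ p + c ^ p ≤ 3 * (B ^ p * 3 ^ p * (a₀ ^ p + b₀ ^ p + c₀ ^ p)) := by
    linarith [key a ha h1, key b hb h2, key c hc h3]
  refine (mul_le_mul hV hS (by positivity) (by positivity)).trans_eq (by ring)

variable {T : ℝ} {w : ℝ → Eucl d → Eucl d} {m : ℝ → ℝ}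

/-- The backward kinetic flow contracts phase volume, and commutes with lattice translations. -/
lemma setLIntegral_comp_flow_le (hb : IsLipField (kineticField T w) (kineticBound T m))
    (hw : ∀ t, TorusPeriodic (w t)) {H : Phase d → ℝ≥0∞}
    (hH : ∀ n, ∀ᵐ z, H (z + latticeShift n) = H z) {t c : ℝ} (hc : 0 ≤ c)
    (hmap : (volume : Measure (Phase d)).map (hb.flowHomeo 0 t)
      = ENNReal.ofReal (Real.exp c) • volume) :
    ∫⁻ z in unitCell d ×ˢ (univ : Set (Eucl d)), H (hb.flow t z 0)
      ≤ ∫⁻ z in unitCell d ×ˢ (univ : Set (Eucl d)), H z := by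
  -- The set N' = 0 is the image of the unit cell under the backward flow. As the flow commutes with
  -- lattice shifts, N' is equivariant and this image is again a fundamental domain.
  set N' : Phase d → Fin d → ℤ := fun z => cellIndex (hb.flow 0 z t)
  let Ψ := (hb.flowHomeo 0 t).symm.toMeasurableEquiv
  have hm : (volume : Measure (Phase d)).map Ψ = ENNReal.ofReal (Real.exp (-c)) • volume :=
    map_flow_symm_eq_smul hmap
  have hpre : Ψ ⁻¹' (N' ⁻¹' {0}) = (cellIndex : Phase d → Fin d → ℤ) ⁻¹' {0} := by
    ext z
    have : hb.flow 0 (hb.flow t z 0) t = z := by rw [hb.flow_flow, hb.flow_self]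
    change cellIndex (hb.flow 0 (hb.flow t z 0) t) = 0 ↔ cellIndex z = 0
    rw [this]
  have hmeas : ∀ n, MeasurableSet (N' ⁻¹' {n}) := fun n =>
    (hb.lipschitzWith_flow 0 t).continuous.measurable (measurableSet_cellIndex n)
  have h1 : ∫⁻ z in N' ⁻¹' {0}, H z ∂((volume : Measure (Phase d)).map Ψ)
      = ∫⁻ z in (cellIndex : Phase d → Fin d → ℤ) ⁻¹' {0}, H (hb.flow t z 0) := by
    rw [Ψ.restrict_map, hpre, lintegral_map_equiv]
    rfl
  rw [← cellIndex_preimage_zero, ← h1, hm, Measure.restrict_smul, lintegral_smul_measure,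
    ← setLIntegral_eq_of_equivariant measurableSet_cellIndex hmeas
      (fun n z => cellIndex_add_latticeShift n z) (fun n z => ?_) hH]
  · rw [smul_eq_mul]
    refine mul_le_of_le_one_left zero_le (ENNReal.ofReal_le_one.2 ?_)
    exact Real.exp_le_one_iff.2 (neg_nonpos.2 hc)
  · simp only [N']
    rw [hb.flow_add_of_periodic (fun s y => kineticField_add_latticeShift hw n s y),
      cellIndex_add_latticeShift]

end Kinetic

/-! ### The weighted Sobolev estimate -/

theorem lemma2p5 (d : ℕ) (hd : 1 ≤ d) (k p : ℝ) (hk : 0 ≤ k) (hp : 1 ≤ p) (T : ℝ) (hT : 0 < T)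
    (M : ℝ≥0) :
    ∃ K : ℝ≥0,
      ∀ (u : ℝ → Eucl d → Eucl d) (Du : ℝ → Eucl d → Eucl d →L[ℝ] Eucl d),
        MemL1W1inf T u Du → normL1W1inf T u Du ≤ (M : ℝ≥0∞) →
      ∀ (f₀ : Phase d → ℝ) (gx₀ gv₀ : Phase d → Eucl d),
        (∀ v : Eucl d, TorusPeriodic (fun x => f₀ (x, v))) →
        (∀ᵐ z : Phase d, 0 ≤ f₀ z) →
        HasWeakGrads f₀ gx₀ gv₀ →
        weightedMoment k p f₀ gx₀ gv₀ < ⊤ →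
      ∀ f : ℝ → Phase d → ℝ, IsKineticSolution T u f₀ f →
      ∀ t ∈ Set.Icc 0 T,
        ∃ gx gv : Phase d → Eucl d, HasWeakGrads (f t) gx gv ∧
          weightedMoment k p (f t) gx gv ≤ (K : ℝ≥0∞) * weightedMoment k p f₀ gx₀ gv₀ := by
  have hp0 : 0 ≤ p := zero_le_one.trans hp
  set C : ℝ := 2 * Real.exp (2 * (T + M)) with hC
  have hC1 : 1 ≤ C := by
    have : 1 ≤ Real.exp (2 * (T + M)) := Real.one_le_exp (by positivity)
    linarith
  set B : ℝ := Real.exp (d * T) * C with hB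
  -- Here 2C compares the brackets along a characteristic, and B bounds f(t) and both its gradients
  -- by the sum of the initial quantities. The factor 3 ^ p comes from the power of that sum and the
  -- factor 3 from adding three such bounds.
  refine ⟨((C * 2) ^ (k * p) * (3 * (B ^ p * 3 ^ p))).toNNReal, ?_⟩
  intro u Du hu hM f₀ gx₀ gv₀ hper _ hf₀ _ f hf t ht
  obtain ⟨w, m, hwm, hm, hmM, hw, hwl, hwp, huw⟩ := hu.exists_regular hM
  have hm0 : ∀ s, 0 ≤ m s := fun s => (norm_nonneg _).trans (hw s 0)
  have hb := isLipField_kineticField hT hwm hm hw hwl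
  have hLC : (hb.lipConst : ℝ) ≤ C := by
    rw [IsLipField.coe_lipConst, (integral_kineticBound hT hm).2, hC]
    gcongr
  have hdiv : ∀ s ∈ Ioo 0 T, ∀ χ : Phase d → ℝ, ContDiff ℝ ∞ χ → HasCompactSupport χ →
      ∫ z, fderiv ℝ χ z (kineticField T w s z) = d * ∫ z, χ z := fun s hs χ hχ hχc =>
    integral_fderiv_kineticField hs hwl (hm0 s) hχ hχc
  have hmap := map_flow_eq_smul hb hdiv ht
  have hae := (hf.isContinuitySolution hT hf₀.locInt huw).ae_eq hb hdiv ht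
  have hΨ : LipschitzWith hb.lipConst (hb.flowHomeo 0 t).symm := hb.lipschitzWith_flow t 0
  have hweak := (hf₀.hasWeakFDeriv.comp_homeomorph hΨ
    (ENNReal.ofReal_pos.2 (Real.exp_pos _)).ne' ENNReal.ofReal_ne_top
    (map_flow_symm_eq_smul hmap)).congr_const_mul hae
  obtain ⟨gx, gv, hg, hgx, hgv⟩ := hweak.hasWeakGrads
  refine ⟨gx, gv, hg, ?_⟩
  set H : Phase d → ℝ≥0∞ := fun z =>
    ENNReal.ofReal (bracket z.2 ^ (k * p) * (|f₀ z| ^ p + ‖gx₀ z‖ ^ p + ‖gv₀ z‖ ^ p)) with hH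
  have hHper : ∀ n, ∀ᵐ z, H (z + latticeShift n) = H z := fun n => by
    filter_upwards [hf₀.ae_eq_add_latticeShift hper n] with z hz
    simp only [hH, hz.1, hz.2.1, hz.2.2]
    simp [latticeShift]
  have hexp : Real.exp (d * t) ≤ Real.exp (d * T) :=
    Real.exp_le_exp.2 (mul_le_mul_of_nonneg_left ht.2 (Nat.cast_nonneg d))
  have hpt : ∀ᵐ z : Phase d,
      ENNReal.ofReal (bracket z.2 ^ (k * p) * (|f t z| ^ p + ‖gx z‖ ^ p + ‖gv z‖ ^ p))
        ≤ ENNReal.ofReal ((C * 2) ^ (k * p) * (3 * (B ^ p * 3 ^ p))) * H (hb.flow t z 0) := by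
    filter_upwards [hae] with z hz
    have hG : ‖Real.exp (d * t) • (phaseForm (gx₀ (hb.flow t z 0)) (gv₀ (hb.flow t z 0))).comp
        (fderiv ℝ (hb.flowHomeo 0 t).symm z)‖
        ≤ B * (|f₀ (hb.flow t z 0)| + ‖gx₀ (hb.flow t z 0)‖ + ‖gv₀ (hb.flow t z 0)‖) := by
      rw [norm_smul, Real.norm_eq_abs, Real.abs_exp, hB, mul_assoc]
      refine mul_le_mul hexp ?_ (norm_nonneg _) (Real.exp_pos _).le
      refine (ContinuousLinearMap.opNorm_comp_le _ _).trans ?_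
      rw [mul_comm]
      refine mul_le_mul ((norm_fderiv_le_of_lipschitz ℝ hΨ).trans hLC) ?_ (norm_nonneg _)
        (zero_le_one.trans hC1)
      refine (norm_phaseForm_le _ _).trans ?_
      linarith [abs_nonneg (f₀ (hb.flow t z 0))]
    rw [← ENNReal.ofReal_mul (by positivity)]
    refine ENNReal.ofReal_le_ofReal (bracket_rpow_mul_le (mul_nonneg hk hp0) hp0 ?_ (by positivity)
      (by positivity) (abs_nonneg _) (norm_nonneg _) (norm_nonneg _) (abs_nonneg _)
      (norm_nonneg _) (norm_nonneg _) ?_ ((hgx z).trans hG) ((hgv z).trans hG))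
    -- The velocity bound is applied forward from the foot of the characteristic at time 0, since
    -- the weight at time t is to be bounded by the initial one.
    · have h1 := one_add_norm_snd_flow_le hb hw 0 t (hb.flow t z 0)
      rw [hb.flow_flow, hb.flow_self] at h1
      refine (bracket_le _).trans (h1.trans ?_)
      rw [mul_assoc]
      exact mul_le_mul hLC (one_add_norm_le_bracket _) (by positivity) (by positivity)
    · rw [hz, abs_mul, Real.abs_exp, hB]
      refine mul_le_mul ?_ ?_ (abs_nonneg _) (by positivity)
      -- For f itself no derivative of Ψ enters, and C ≥ 1 lets the same B serve.
      · nlinarith [Real.exp_pos ((d : ℝ) * T)]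
      · linarith [norm_nonneg (gx₀ (hb.flow t z 0)), norm_nonneg (gv₀ (hb.flow t z 0))]
  calc weightedMoment k p (f t) gx gv
      ≤ ∫⁻ z in unitCell d ×ˢ (univ : Set (Eucl d)),
          ENNReal.ofReal ((C * 2) ^ (k * p) * (3 * (B ^ p * 3 ^ p))) * H (hb.flow t z 0) :=
        lintegral_mono_ae (ae_restrict_of_ae hpt)
    _ = ENNReal.ofReal ((C * 2) ^ (k * p) * (3 * (B ^ p * 3 ^ p)))
          * ∫⁻ z in unitCell d ×ˢ (univ : Set (Eucl d)), H (hb.flow t z 0) :=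
        lintegral_const_mul' _ _ ENNReal.ofReal_ne_top
    _ ≤ _ := mul_le_mul_right (setLIntegral_comp_flow_le hb hwp hHper
        (mul_nonneg (Nat.cast_nonneg d) ht.1) hmap) _
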